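/- **Setting.** Let $n_x,n_u,\tau\ge 1$. Consider $\min_{u}\mathcal J(u)$ over commands $u=(u_0;\dots;u_{\tau-1})\in\mathbb R^{\tau n_u}$, where $\mathcal J=h\circ g$, $g(u)=(x_1;\dots;x_\tau)$ is given by $x_0=\bar x_0$, $x_{t+1}=f(x_t,u_t)$, and $h(x_1;\dots;x_\tau)=\sum_{t=1}^\tau h_t(x_t)$. Put $\mathcal J^*=\inf\mathcal J$. All norms are Euclidean, resp. the induced operator norms; $\nabla$ of a vector-valued map is the transpose of its Jacobian. Assume that each $h_t:\mathbb R^{n_x}\to\mathbb R$ is twice differentiable and $\mu_h$-strongly convex ($\mu_h>0$) with $L_h$-Lipschitz gradient and $M_h$-Lipschitz Hessian, that $f:\mathbb R^{n_x}\times\mathbb R^{n_u}\to\mathbb R^{n_x}$ is differentiable and Lipschitz with Lipschitz gradient, and that $\|\nabla_u f(x,u)\lambda\|\ge\sigma_f\|\lambda\|$ for all $x,u,\lambda$, for some $\sigma_f>0$. **(0) Constants of $g$.** Let $l_x,l_u$ be Lipschitz constants of $f(\cdot,u)$ and $f(x,\cdot)$, and let $L_{xx},L_{xu},L_{uu}$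 be Lipschitz constants of $\nabla_xf(\cdot,u)$, $\nabla_uf(\cdot,u)$, $\nabla_uf(x,\cdot)$, in each case uniformly in the other variable. Put $S=\sum_{t=0}^{\tau-1}l_x^t$. Then $g$ is $l_g$-Lipschitz, $\nabla g$ is $L_g$-Lipschitz and $\|\nabla g(u)m\|\ge\sigma_g\|m\|$ for all $u,m$, with $$l_g=l_uS,\qquad L_g=S\,(L_{xx}l_g^2+2L_{xu}l_g+L_{uu}),\qquad \sigma_g=\frac{\sigma_f}{1+l_x}>0 .$$ In what follows $l_g$, $L_g>0$, $\sigma_g>0$ are any constants with these three properties of $g$. **Algorithm.** For a command $u$ with states $x_t$ and $\nu\geq 0$, $\mathrm{LQR}_\nu(\mathcal J)(u)$ is the minimizer over $v=(v_0;\dots;v_{\tau-1})$ of $$\sum_{t=1}^{\tau}\Big(\tfrac12y_t^\top\nabla^2h_t(x_t)y_t+\nabla h_t(x_t)^\top y_t\Big)+\frac\nu2\sum_{t=0}^{\tau-1}\|v_t\|^2,\qquad y_0=0,\quad y_{t+1}=\nabla_xf(x_t,u_t)^\top y_t+\nabla_uf(x_t,u_t)^\top v_t$$ (and $0$ if there is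 no unique minimizer). The ILQR iterates are $u^{(k+1)}=u^{(k)}+\mathrm{LQR}_{\nu(u^{(k)})}(\mathcal J)(u^{(k)})$ from any $u^{(0)}$, with $$\nu(u)=L_g\|\nabla h(g(u))\|+\frac{2l_g^2\,(M_hl_g^2/3+L_gL_h)\,\|\nabla h(g(u))\|}{L_g\|\nabla h(g(u))\|+\sigma_gl_g\mu_h}.$$ Put $\delta_k=\mathcal J(u^{(k)})-\mathcal J^*$, $\rho_h=L_h/\mu_h$, $\rho_g=l_g/\sigma_g$, $\theta_g=L_g/(\sigma_g^2\sqrt{\mu_h})$, $\theta_h=M_h/(2\mu_h^{3/2})$, $\alpha=4\rho_g^2\big(2\rho_g^2\theta_h/(3\theta_g)+\rho_h\big)$, $$Q=\theta_h\Big(1+\frac{\sqrt{\rho_h}\rho_g^3}3\Big)+\sqrt{\rho_h}\,\theta_g(1+\rho_g\rho_h),\qquad \bar\delta=\frac1{32\rho_hQ^2},\qquad \bar\lambda=\sqrt{2\rho_h\bar\delta}=\frac1{4Q},$$ $$k_1=4\theta_g\big(\sqrt{\delta_0}-\sqrt{\bar\delta}\big)+2\rho_h\ln\frac{\delta_0}{\bar\delta}+2\alpha\ln\frac{\theta_g\sqrt{\delta_0}+\rho_g}{\theta_g\sqrt{\bar\delta}+\rho_g},$$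 and let $\lambda_h(x)=\sqrt{\nabla h(x)^\top\nabla^2h(x)^{-1}\nabla h(x)}$ be the Newton decrement of $h$. **Theorem.** 1. For every command $u$, $v=\mathrm{LQR}_{\nu(u)}(\mathcal J)(u)$ is a minimizer of the linear quadratic problem with $\nu=\nu(u)$, and the sufficient decrease condition holds: $$\mathcal J(u+v)\le\mathcal J(u)+\nabla h(g(u))^\top y+\tfrac12y^\top\nabla^2h(g(u))y+\tfrac{\nu(u)}2\|v\|^2=\mathcal J(u)+\tfrac12\nabla\mathcal J(u)^\top v,\qquad y=\nabla g(u)^\top v .$$ 2. The number of iterations of ILQR to reach (and keep) an accuracy $\varepsilon$ is at most $\max\{0,k_1\}+O(\ln\ln(1/\varepsilon))$ as $\varepsilon\to0$. That is, it is at most $\max\{0,k_1\}+C\ln\ln(1/\varepsilon)$ for $0<\varepsilon\le\varepsilon_0$, where $C$ and $\varepsilon_0>0$ depend only on $\mu_h,L_h,M_h,l_g,L_g,\sigma_g$ (not on the dimensions, $\tau$, $f$, the $h_t$, $\bar x_0$ or $u^{(0)}$). 3. $\bar\delta$ determines the quadratic convergence phase: $\delta_k\le\bar\delta$ for every $k\ge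 k_1$, and whenever $\delta_k\le\bar\delta$ one has $\lambda_h(g(u^{(k)}))\le\bar\lambda$ and $\lambda_h(g(u^{(k+1)}))\le\bar\lambda^{-1}\lambda_h(g(u^{(k)}))^2$. 4. The total computational complexity of $k$ iterations is $O(k\,\tau\,(n_x+n_u)^3)$ basic operations, with an absolute constant. That is, for given dimensions and $k$ there is a straight-line program, the same for all problems satisfying the assumptions, all $u^{(0)}$ and all admissible constants, that computes $u^{(0)},\dots,u^{(k)}$ with at most that many basic operations. A basic operation is $+,-,\times,\div$, a square root, or the evaluation of one entry of $f$, $\nabla_xf$, $\nabla_uf$, $h_t$, $\nabla h_t$ or $\nabla^2h_t$ at a computed point. -/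

import Mathlib

open scoped InnerProductSpace

noncomputable section

namespace ILQR

/-- `ℝⁿ` with its Euclidean norm. -/
abbrev Vec (n : ℕ) : Type := EuclideanSpace ℝ (Fin n)

/-- Concatenations `(z_1; …; z_τ) ∈ ℝ^{τ n}` with the Euclidean norm of `ℝ^{τ n}`. -/
abbrev Seq (τ n : ℕ) : Type := PiLp 2 (fun _ : Fin τ => Vec n)

/-- The data of a discrete time control problem with horizon `τ`: the dynamics `f`, the costs
(`h t` is the cost on the state at time `t + 1`) and the fixed initial state. -/
structure ControlProblem (nx nu τ : ℕ) where
  f : Vec nx × Vec nu → Vec nx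
  h : Fin τ → Vec nx → ℝ
  xinit : Vec nx

/-- The constants: strong convexity, smoothness and Hessian-Lipschitz constants of the costs,
and Lipschitz constant, smoothness constant and surjectivity constant of the control in `τ` steps. -/
structure Constants where
  μh : ℝ
  Lh : ℝ
  Mh : ℝ
  lg : ℝ
  Lg : ℝ
  σg : ℝ

namespace ControlProblem

variable {nx nu τ : ℕ}

/-! ### The objective -/

/-- The states `x_0, x_1, …, x_τ` driven by the command `u`
(with the constant continuation after time `τ`, which is never used). -/
def state (P : ControlProblem nx nu τ) (u : Seq τ nu) : ℕ → Vec nx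
  | 0 => P.xinit
  | t + 1 => if ht : t < τ then P.f (state P u t, u ⟨t, ht⟩) else state P u t

/-- The control in `τ` steps, `g(u) = (x_1; …; x_τ)`. -/
def g (P : ControlProblem nx nu τ) (u : Seq τ nu) : Seq τ nx :=
  WithLp.toLp 2 fun t : Fin τ => P.state u (t + 1)

/-- The total cost `h(x_1; …; x_τ) = ∑ h_t(x_t)`. -/
def totalCost (P : ControlProblem nx nu τ) (x : Seq τ nx) : ℝ := ∑ t : Fin τ, P.h t (x t)

/-- The objective `𝒥 = h ∘ g`. -/
def J (P : ControlProblem nx nu τ) (u : Seq τ nu) : ℝ := P.totalCost (P.g u)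

/-- The optimal value `𝒥*`. -/
def Jstar (P : ControlProblem nx nu τ) : ℝ := ⨅ u : Seq τ nu, P.J u

/-! ### First and second order information -/

/-- The partial Jacobian `∇ₓ f(x, u)ᵀ`. -/
def Dx (P : ControlProblem nx nu τ) (x : Vec nx) (u : Vec nu) : Vec nx →L[ℝ] Vec nx :=
  fderiv ℝ (fun z => P.f (z, u)) x

/-- The partial Jacobian `∇ᵤ f(x, u)ᵀ`. -/
def Du (P : ControlProblem nx nu τ) (x : Vec nx) (u : Vec nu) : Vec nu →L[ℝ] Vec nx :=
  fderiv ℝ (fun w => P.f (x, w)) u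

/-- The Hessian `∇² φ(x)` of a function on a Hilbert space, as an operator. -/
def _root_.ILQR.hess {E : Type*} [NormedAddCommGroup E] [InnerProductSpace ℝ E] [CompleteSpace E]
    (φ : E → ℝ) (x : E) : E →L[ℝ] E :=
  fderiv ℝ (gradient φ) x

/-- The Newton decrement `√(∇h(x)ᵀ ∇²h(x)⁻¹ ∇h(x))` of the total cost. -/
def newtonDecrement (P : ControlProblem nx nu τ) (x : Seq τ nx) : ℝ :=
  √⟪gradient P.totalCost x, (hess P.totalCost x).inverse (gradient P.totalCost x)⟫_ℝ

/-! ### The linear quadratic regulator -/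

/-- The states `y_0 = 0, y_{t+1} = A_t y_t + B_t v_t` of the dynamics linearized along the
trajectory of `u`. -/
def linState (P : ControlProblem nx nu τ) (u v : Seq τ nu) : ℕ → Vec nx
  | 0 => 0
  | t + 1 =>
    if ht : t < τ then
      P.Dx (P.state u t) (u ⟨t, ht⟩) (linState P u v t)
        + P.Du (P.state u t) (u ⟨t, ht⟩) (v ⟨t, ht⟩)
    else linState P u v t

/-- The regularized linear quadratic objective
`∑_{t=1}^τ (½ y_tᵀ P_t y_t + p_tᵀ y_t) + ν/2 ∑_{t=0}^{τ-1} ‖v_t‖²`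
with `P_t = ∇²h_t(x_t)` and `p_t = ∇h_t(x_t)`. -/
def lqObjective (P : ControlProblem nx nu τ) (ν : ℝ) (u v : Seq τ nu) : ℝ :=
  ∑ t : Fin τ,
      (1 / 2 * ⟪P.linState u v (t + 1),
          hess (P.h t) (P.state u (t + 1)) (P.linState u v (t + 1))⟫_ℝ
        + ⟪gradient (P.h t) (P.state u (t + 1)), P.linState u v (t + 1)⟫_ℝ)
    + ν / 2 * ∑ t : Fin τ, ‖v t‖ ^ 2

/-- `v` solves the linear quadratic problem. -/
def IsLQRSolution (P : ControlProblem nx nu τ) (ν : ℝ) (u v : Seq τ nu) : Prop :=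
  ∀ w : Seq τ nu, P.lqObjective ν u v ≤ P.lqObjective ν u w

open Classical in
/-- The oracle `LQR_ν(𝒥)(u)`: the minimizer of the linear quadratic problem. For convex costs and
`ν > 0` it exists and is unique; where there is no unique minimizer the null direction is taken
(with the regularization used below this concerns only commands with `∇h(g(u)) = 0`, where
the null direction is a minimizer). -/
def lqr (P : ControlProblem nx nu τ) (ν : ℝ) (u : Seq τ nu) : Seq τ nu :=
  if hv : ∃! v, P.IsLQRSolution ν u v then hv.exists.choose else 0

/-- The model `q_h^{g(u)} ∘ ℓ_g^u (v)`, the quadratic expansion of the total cost composed with the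
linear expansion of the control in `τ` steps. -/
def model (P : ControlProblem nx nu τ) (u v : Seq τ nu) : ℝ :=
  ⟪gradient P.totalCost (P.g u), fderiv ℝ P.g u v⟫_ℝ
    + 1 / 2 * ⟪fderiv ℝ P.g u v, hess P.totalCost (P.g u) (fderiv ℝ P.g u v)⟫_ℝ

/-- The sufficient decrease condition at `u` for the regularization `ν`: with
`v = LQR_ν(𝒥)(u)`,
`𝒥(u + v) ≤ 𝒥(u) + q(ℓ(v)) + ν/2 ‖v‖² = 𝒥(u) + ½ ∇𝒥(u)ᵀ v`. -/
def SufficientDecrease (P : ControlProblem nx nu τ) (ν : ℝ) (u : Seq τ nu) : Prop :=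
  P.J (u + P.lqr ν u) ≤ P.J u + P.model u (P.lqr ν u) + ν / 2 * ‖P.lqr ν u‖ ^ 2 ∧
  P.J u + P.model u (P.lqr ν u) + ν / 2 * ‖P.lqr ν u‖ ^ 2
    = P.J u + 1 / 2 * ⟪gradient P.J u, P.lqr ν u⟫_ℝ

/-- The regularization `ν(u)`. -/
def reg (P : ControlProblem nx nu τ) (c : Constants) (u : Seq τ nu) : ℝ :=
  c.Lg * ‖gradient P.totalCost (P.g u)‖
    + 2 * c.lg ^ 2 * (c.Mh * c.lg ^ 2 / 3 + c.Lg * c.Lh) * ‖gradient P.totalCost (P.g u)‖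
      / (c.Lg * ‖gradient P.totalCost (P.g u)‖ + c.σg * c.lg * c.μh)

/-- The iterates `u^(k+1) = u^(k) + LQR_{ν(u^(k))}(𝒥)(u^(k))` of the ILQR algorithm. -/
def iterate (P : ControlProblem nx nu τ) (c : Constants) (u₀ : Seq τ nu) : ℕ → Seq τ nu
  | 0 => u₀
  | k + 1 => iterate P c u₀ k + P.lqr (P.reg c (iterate P c u₀ k)) (iterate P c u₀ k)

/-! ### Assumptions -/

/-- The linearized dynamics are surjective: `σ_min(∇ᵤ f(x, u)) ≥ σ > 0`, where `∇ᵤ f` is the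
transpose of the Jacobian. -/
def SurjectiveDynamics (P : ControlProblem nx nu τ) (σ : ℝ) : Prop :=
  0 < σ ∧ ∀ x u, ∀ l : Vec nx, σ * ‖l‖ ≤ ‖ContinuousLinearMap.adjoint (P.Du x u) l‖

/-- The dynamics are Lipschitz continuous with Lipschitz continuous gradients and have surjective
linearizations. -/
structure RegularDynamics (P : ControlProblem nx nu τ) : Prop where
  differentiable : Differentiable ℝ P.f
  lipschitz : ∃ K, LipschitzWith K P.f
  grad_lipschitz : ∃ K, LipschitzWith K (fderiv ℝ P.f)
  surjective : ∃ σf, P.SurjectiveDynamics σf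

/-- All costs `h_t` are `μ`-strongly convex with `μ > 0`, and twice differentiable with
`L`-Lipschitz continuous gradients and `M`-Lipschitz continuous Hessians. -/
structure RegularCosts (P : ControlProblem nx nu τ) (μ L M : ℝ) : Prop where
  pos : 0 < μ
  strongConvex : ∀ t, StrongConvexOn Set.univ μ (P.h t)
  differentiable : ∀ t, Differentiable ℝ (P.h t)
  twice_differentiable : ∀ t, Differentiable ℝ (gradient (P.h t))
  grad_lipschitz : ∀ t x y, ‖gradient (P.h t) x - gradient (P.h t) y‖ ≤ L * ‖x - y‖
  hess_lipschitz : ∀ t x y, ‖hess (P.h t) x - hess (P.h t) y‖ ≤ M * ‖x - y‖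

/-- Constants of the dynamics: Lipschitz constants of the partial functions and of the partial
gradients, uniformly in the other variable. -/
structure DynamicsConstants (P : ControlProblem nx nu τ) (lx lu Lxx Lxu Luu : ℝ) : Prop where
  lip_x : ∀ u x x', ‖P.f (x, u) - P.f (x', u)‖ ≤ lx * ‖x - x'‖
  lip_u : ∀ x u u', ‖P.f (x, u) - P.f (x, u')‖ ≤ lu * ‖u - u'‖
  lip_xx : ∀ u x x', ‖P.Dx x u - P.Dx x' u‖ ≤ Lxx * ‖x - x'‖
  lip_xu : ∀ u x x', ‖P.Du x u - P.Du x' u‖ ≤ Lxu * ‖x - x'‖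
  lip_uu : ∀ x u u', ‖P.Du x u - P.Du x u'‖ ≤ Luu * ‖u - u'‖

/-- `g` is `l`-Lipschitz continuous with `L`-Lipschitz continuous gradients and satisfies
`σ_min(∇g(u)) ≥ σ > 0` for all `u`. -/
structure TrajectoryConstants (P : ControlProblem nx nu τ) (l L σ : ℝ) : Prop where
  lipschitz : ∀ u v, ‖P.g u - P.g v‖ ≤ l * ‖u - v‖
  grad_lipschitz : ∀ u v, ‖fderiv ℝ P.g u - fderiv ℝ P.g v‖ ≤ L * ‖u - v‖
  pos : 0 < σ
  surjective : ∀ u, ∀ m : Seq τ nx,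
    σ * ‖m‖ ≤ ‖ContinuousLinearMap.adjoint (fderiv ℝ P.g u) m‖

/-- The standing assumptions on a problem, together with admissible constants
(`L_g` is taken positive since the complexity bound divides by it; any positive number is an
admissible `L_g` when `g` is affine). -/
structure Admissible (P : ControlProblem nx nu τ) (c : Constants) : Prop where
  dynamics : P.RegularDynamics
  costs : P.RegularCosts c.μh c.Lh c.Mh
  trajectory : P.TrajectoryConstants c.lg c.Lg c.σg
  Lg_pos : 0 < c.Lg

end ControlProblem

/-! ### Constants of the complexity bound -/

namespace Constants

variable (c : Constants)

def ρh : ℝ := c.Lh / c.μh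
def ρg : ℝ := c.lg / c.σg
def θg : ℝ := c.Lg / (c.σg ^ 2 * √c.μh)
def θh : ℝ := c.Mh / (2 * (c.μh * √c.μh))
def α : ℝ := 4 * c.ρg ^ 2 * (2 * c.ρg ^ 2 * c.θh / (3 * c.θg) + c.ρh)

/-- The sum `θ_h (1 + √ρ_h ρ_g³ / 3) + √ρ_h θ_g (1 + ρ_g ρ_h)`. -/
def quadConst : ℝ := c.θh * (1 + √c.ρh * c.ρg ^ 3 / 3) + √c.ρh * c.θg * (1 + c.ρg * c.ρh)

/-- The value `δ̄` of the gap that determines the quadratic convergence phase. -/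
def gapBar : ℝ := 1 / (32 * c.ρh * c.quadConst ^ 2)

/-- The radius of quadratic convergence, `√(2 ρ_h δ̄)`, in terms of the Newton decrement. -/
def decrementBar : ℝ := 1 / (4 * c.quadConst)

/-- The number of iterations before the quadratic convergence phase for an initial gap `δ₀`. -/
def phaseBound (δ₀ : ℝ) : ℝ :=
  4 * c.θg * (√δ₀ - √c.gapBar) + 2 * c.ρh * Real.log (δ₀ / c.gapBar)
    + 2 * c.α * Real.log ((c.θg * √δ₀ + c.ρg) / (c.θg * √c.gapBar + c.ρg))

end Constants

/-! ### Counting basic operations -/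

/-- An input of the ILQR algorithm: a problem, an initial command and constants that satisfy the
standing assumptions. -/
structure Input (nx nu τ : ℕ) where
  P : ControlProblem nx nu τ
  u₀ : Seq τ nu
  c : Constants
  admissible : P.Admissible c

variable {nx nu τ : ℕ}

/-- The real quantities that are available before any operation is performed: numerical constants,
the coordinates of the initial state and of the initial command, and the problem's constants. -/
def initialQuantities (nx nu τ : ℕ) : Set (Input nx nu τ → ℝ) :=
  {φ | (∃ r : ℝ, φ = fun _ => r) ∨ (∃ i, φ = fun I => I.P.xinit i) ∨
    (∃ t i, φ = fun I => I.u₀ t i) ∨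
    φ = (fun I => I.c.μh) ∨ φ = (fun I => I.c.Lh) ∨ φ = (fun I => I.c.Mh) ∨
    φ = (fun I => I.c.lg) ∨ φ = (fun I => I.c.Lg) ∨ φ = (fun I => I.c.σg)}

/-- `BasicOperation S φ`: the quantity `φ` is obtained from the quantities in `S` by one basic
operation, that is, an arithmetic operation, a square root, or the evaluation of one entry of the
dynamics or of its partial Jacobians, or of a cost, its gradient or its Hessian, at a point whose
coordinates are in `S`. -/
inductive BasicOperation (S : Set (Input nx nu τ → ℝ)) : (Input nx nu τ → ℝ) → Prop
  | add {φ ψ} : φ ∈ S → ψ ∈ S → BasicOperation S (fun I => φ I + ψ I)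
  | sub {φ ψ} : φ ∈ S → ψ ∈ S → BasicOperation S (fun I => φ I - ψ I)
  | mul {φ ψ} : φ ∈ S → ψ ∈ S → BasicOperation S (fun I => φ I * ψ I)
  | div {φ ψ} : φ ∈ S → ψ ∈ S → BasicOperation S (fun I => φ I / ψ I)
  | sqrt {φ} : φ ∈ S → BasicOperation S (fun I => √(φ I))
  | dynamics (x : Input nx nu τ → Vec nx) (u : Input nx nu τ → Vec nu) (i : Fin nx) :
      (∀ j, (fun I => x I j) ∈ S) → (∀ j, (fun I => u I j) ∈ S) →
      BasicOperation S (fun I => I.P.f (x I, u I) i)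
  | jacobian_x (x : Input nx nu τ → Vec nx) (u : Input nx nu τ → Vec nu) (i j : Fin nx) :
      (∀ j, (fun I => x I j) ∈ S) → (∀ j, (fun I => u I j) ∈ S) →
      BasicOperation S (fun I => I.P.Dx (x I) (u I) (EuclideanSpace.single j 1) i)
  | jacobian_u (x : Input nx nu τ → Vec nx) (u : Input nx nu τ → Vec nu) (i : Fin nx) (j : Fin nu) :
      (∀ j, (fun I => x I j) ∈ S) → (∀ j, (fun I => u I j) ∈ S) →
      BasicOperation S (fun I => I.P.Du (x I) (u I) (EuclideanSpace.single j 1) i)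
  | cost (x : Input nx nu τ → Vec nx) (t : Fin τ) :
      (∀ j, (fun I => x I j) ∈ S) → BasicOperation S (fun I => I.P.h t (x I))
  | cost_gradient (x : Input nx nu τ → Vec nx) (t : Fin τ) (i : Fin nx) :
      (∀ j, (fun I => x I j) ∈ S) → BasicOperation S (fun I => gradient (I.P.h t) (x I) i)
  | cost_hessian (x : Input nx nu τ → Vec nx) (t : Fin τ) (i j : Fin nx) :
      (∀ j, (fun I => x I j) ∈ S) →
      BasicOperation S (fun I => hess (I.P.h t) (x I) (EuclideanSpace.single j 1) i)

/-- `Computation n S`: there is a straight-line program with `n` basic operations, the same for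
all inputs of the given dimensions, for which `S` is the set of all quantities that are available
at its end (the initial ones and the results of its operations). -/
inductive Computation : ℕ → Set (Input nx nu τ → ℝ) → Prop
  | start : Computation 0 (initialQuantities nx nu τ)
  | step {n S φ} : Computation n S → BasicOperation S φ → Computation (n + 1) (insert φ S)

end ILQR

end

/-! The objective is a strongly convex function h composed with a map g whose derivative G has an
adjoint bounded below. This has two consequences. The regularized Gauss-Newton direction v lies in
the range of Gᵀ, v = Gᵀw, so that ‖w‖, ‖v‖ and ‖Gv‖ control each other through σ_g and l_g. And the
gradient of h, not only that of 𝒥, measures progress, so the Polyak-Łojasiewicz inequality of h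
applies along the iterates although 𝒥 is not convex.

Decrease. Replacing h ∘ g by its model costs at most half of (L_g‖∇h‖ + l_g(M_h l_g²/3 + L_g
L_h)‖v‖)‖v‖². The energy identity of the linear quadratic problem gives ‖v‖(ν + σ_g l_g μ_h) ≤
l_g‖∇h‖, and ν(u) is chosen to dominate this error (`le_regOf`, `sufficient_decrease`). The optimal
model value is ½⟨∇h, Gv⟩, which is at most -½‖∇h‖²/(L_h + ν/σ_g²) (`gradient_sq_le_lqStationary`).

First phase. With the Polyak-Łojasiewicz inequality, the gap δ drops by at least δ / `rate` δ, where
`rate` δ = δ Φ'(δ) for an explicit increasing concave Φ (`potential`). Lying below its tangents, Φ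
loses at least one per iteration, and k₁ = Φ(δ₀) - Φ(δ̄). The same argument with an arbitrary target
in place of δ̄ shows that inf 𝒥 = inf h, so the gap may be measured against inf h throughout.

Quadratic phase. In the space of states, z = Gv solves ∇²h z + ∇h = -νw: an inexact Newton step,
followed by the error e = g(u + v) - g(u) - z. For a decrement λ, all of ν, ‖w‖, ‖z‖ are O(λ) and e
is O(λ²), hence the new decrement is O(λ²) (`newtonDec_perturbed_step`, `newtonDec_step_le`). The
decrement squared and the gap are equivalent up to factors of ρ_h, which turns λ ↦ 4Qλ² into the ln
ln(1/ε) term.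

Constants of g. Differences of states and of linearized states obey scalar recursions e_{t+1} ≤ l_x
e_t + d_t, and convolution with a geometric sequence has ℓ² norm at most S. For σ_g, an explicit
right inverse of G is built by choosing controls that follow a prescribed trajectory.

Operation count. The Riccati recursion solves the linear quadratic problem. A straight-line program
cannot branch, so the inverses are computed by rank one updates whose denominators never vanish, and
the degenerate case ∇h = 0 is handled by a factor p / p with 0 / 0 = 0. -/

noncomputable section

namespace ILQR

/-! ### Taylor and tangent inequalities. -/

section Calculus

variable {E F : Type*} [NormedAddCommGroup E] [NormedSpace ℝ E] [NormedAddCommGroup F]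
  [NormedSpace ℝ F]

/-- Second order Taylor bound for a map with Lipschitz derivative. -/
theorem norm_taylor_le_of_fderiv_lipschitz {f : E → F} {K : ℝ} (hf : Differentiable ℝ f)
    (hK : ∀ x y, ‖fderiv ℝ f x - fderiv ℝ f y‖ ≤ K * ‖x - y‖) (x z : E) :
    ‖f (x + z) - f x - fderiv ℝ f x z‖ ≤ K / 2 * ‖z‖ ^ 2 := by
  -- Along the segment the remainder has derivative of norm at most K s‖z‖²; the comparison form of
  -- the mean value inequality yields the factor 1/2 without integrating a derivative that need not
  -- be regular beyond Lipschitz.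
  have key := image_norm_le_of_norm_deriv_right_le_deriv_boundary
    (f := fun s : ℝ => f (x + s • z) - f x - s • fderiv ℝ f x z)
    (f' := fun s : ℝ => fderiv ℝ f (x + s • z) z - fderiv ℝ f x z)
    (B := fun s : ℝ => K / 2 * ‖z‖ ^ 2 * s ^ 2) (B' := fun s : ℝ => K * ‖z‖ ^ 2 * s)
    (a := 0) (b := 1) ?_ ?_ ?_ ?_ ?_ (x := 1) (by simp)
  · simpa using key
  · have := hf.continuous
    fun_prop
  · intro s _
    have h1 : HasDerivAt (fun s : ℝ => x + s • z) z s := by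
      simpa using ((hasDerivAt_id s).smul_const z).const_add x
    have h2 := (hf (x + s • z)).hasFDerivAt.comp_hasDerivAt s h1
    have h3 : HasDerivAt (fun s : ℝ => s • fderiv ℝ f x z) (fderiv ℝ f x z) s := by
      simpa using (hasDerivAt_id s).smul_const (fderiv ℝ f x z)
    exact ((h2.sub_const (f x)).sub h3).hasDerivWithinAt
  · simp
  · intro s
    have := ((hasDerivAt_pow 2 s).const_mul (K / 2 * ‖z‖ ^ 2))
    exact this.congr_deriv (by push_cast; ring)
  · intro s hs
    have h1 : ‖fderiv ℝ f (x + s • z) z - fderiv ℝ f x z‖ ≤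
        ‖fderiv ℝ f (x + s • z) - fderiv ℝ f x‖ * ‖z‖ := by
      simpa using (fderiv ℝ f (x + s • z) - fderiv ℝ f x).le_opNorm z
    have h2 := hK (x + s • z) x
    rw [add_sub_cancel_left, norm_smul, Real.norm_of_nonneg hs.1] at h2
    calc _ ≤ K * (s * ‖z‖) * ‖z‖ := h1.trans (by gcongr)
      _ = _ := by ring

/-- A differentiable convex function lies above its tangents. -/
theorem _root_.ConvexOn.add_fderiv_le {f : E → ℝ} (hf : ConvexOn ℝ Set.univ f) {x : E}
    (hd : DifferentiableAt ℝ f x) (z : E) : f x + fderiv ℝ f x z ≤ f (x + z) := by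
  have hc : ConvexOn ℝ Set.univ (fun s : ℝ => f (x + s • z)) := by
    have := hf.comp_affineMap (AffineMap.lineMap x (x + z) : ℝ →ᵃ[ℝ] E)
    rw [Set.preimage_univ] at this
    refine this.congr fun s _ => ?_
    simp [AffineMap.lineMap_apply, add_comm]
  have h1 : HasDerivAt (fun s : ℝ => x + s • z) z 0 := by
    simpa using ((hasDerivAt_id (0 : ℝ)).smul_const z).const_add x
  have h2 : HasDerivAt (fun s : ℝ => f (x + s • z)) (fderiv ℝ f x z) 0 := by
    have h3 : HasFDerivAt f (fderiv ℝ f x) (x + (0 : ℝ) • z) := by simpa using hd.hasFDerivAt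
    exact h3.comp_hasDerivAt (0 : ℝ) h1
  have := hc.le_slope_of_hasDerivAt (Set.mem_univ 0) (Set.mem_univ 1) one_pos h2
  simp [slope_def_field] at this
  linarith

end Calculus

/-- A strongly convex function with Lipschitz gradient and Lipschitz Hessian. -/
structure RegularCost {E : Type*} [NormedAddCommGroup E] [InnerProductSpace ℝ E] [CompleteSpace E]
    (φ : E → ℝ) (μ L M : ℝ) : Prop where
  pos : 0 < μ
  strongConvex : StrongConvexOn Set.univ μ φ
  differentiable : Differentiable ℝ φ
  twice_differentiable : Differentiable ℝ (gradient φ)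
  grad_lipschitz : ∀ x y, ‖gradient φ x - gradient φ y‖ ≤ L * ‖x - y‖
  hess_lipschitz : ∀ x y, ‖hess φ x - hess φ y‖ ≤ M * ‖x - y‖

/-! ### Inequalities for strongly convex costs with Lipschitz Hessian. -/

namespace RegularCost

variable {E : Type*} [NormedAddCommGroup E] [InnerProductSpace ℝ E] [CompleteSpace E]
  {φ : E → ℝ} {μ L M : ℝ}

/-- Subtracting μ/2 ‖x‖² leaves a convex function; its tangent inequality, with the expansion of the
square, is the claim. -/
theorem add_inner_gradient_le (h : RegularCost φ μ L M) (x z : E) :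
    φ x + ⟪gradient φ x, z⟫_ℝ + μ / 2 * ‖z‖ ^ 2 ≤ φ (x + z) := by
  have hc := strongConvexOn_iff_convex.1 h.strongConvex
  have hq : HasFDerivAt (fun x : E => μ / 2 * ‖x‖ ^ 2)
      ((μ / 2) • (2 • innerSL ℝ x)) x := (hasStrictFDerivAt_norm_sq x).hasFDerivAt.const_mul _
  have hd : HasFDerivAt (fun x => φ x - μ / 2 * ‖x‖ ^ 2)
      (fderiv ℝ φ x - (μ / 2) • (2 • innerSL ℝ x)) x := (h.differentiable x).hasFDerivAt.sub hq
  have := hc.add_fderiv_le hd.differentiableAt z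
  rw [hd.fderiv] at this
  have e := norm_add_sq_real x z
  rw [inner_gradient_left]
  simp [e] at this
  linarith

theorem hasFDerivAt_gradient (h : RegularCost φ μ L M) (x : E) :
    HasFDerivAt (gradient φ) (hess φ x) x := (h.twice_differentiable x).hasFDerivAt

/-- The tangent is taken at the endpoint y: in the sufficient decrease this is g(u + v), whose
gradient is controlled by that at g(u). -/
theorem le_gradient_add (h : RegularCost φ μ L M) (x y : E) :
    φ y - φ x ≤ ⟪gradient φ y, y - x⟫_ℝ := by
  have := h.add_inner_gradient_le y (x - y)
  rw [add_sub_cancel, ← neg_sub y x, inner_neg_right] at this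
  nlinarith [h.pos, sq_nonneg ‖-(y - x)‖]

theorem strong_monotone (h : RegularCost φ μ L M) (x z : E) :
    μ * ‖z‖ ^ 2 ≤ ⟪gradient φ (x + z) - gradient φ x, z⟫_ℝ := by
  have h1 := h.add_inner_gradient_le x z
  have h2 := h.add_inner_gradient_le (x + z) (-z)
  simp only [add_neg_cancel_right, inner_neg_right, norm_neg] at h2
  rw [inner_sub_left]
  linarith

/-- Strong monotonicity of the gradient, divided by s² along x + s z, in the limit s → 0+. -/
theorem hess_lower (h : RegularCost φ μ L M) (x z : E) :
    μ * ‖z‖ ^ 2 ≤ ⟪hess φ x z, z⟫_ℝ := by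
  have h1 : HasDerivAt (fun s : ℝ => x + s • z) z 0 := by
    simpa using ((hasDerivAt_id (0 : ℝ)).smul_const z).const_add x
  have h2 : HasDerivAt (fun s : ℝ => gradient φ (x + s • z)) (hess φ x z) 0 := by
    have h3 : HasFDerivAt (gradient φ) (hess φ x) (x + (0 : ℝ) • z) := by
      simpa using h.hasFDerivAt_gradient x
    exact h3.comp_hasDerivAt (0 : ℝ) h1
  have h4 := (h2.tendsto_slope_zero_right).inner (𝕜 := ℝ) (tendsto_const_nhds (x := z))
  refine ge_of_tendsto h4 ?_
  filter_upwards [self_mem_nhdsWithin] with s hs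
  have hs : (0 : ℝ) < s := hs
  have h5 := h.strong_monotone x (s • z)
  rw [inner_smul_right, norm_smul, Real.norm_of_nonneg hs.le] at h5
  simp only [zero_add, zero_smul, add_zero, inner_smul_left]
  rw [show (starRingEnd ℝ) s⁻¹ = s⁻¹ from rfl, inv_mul_eq_div, le_div_iff₀ hs]
  nlinarith

/-- Symmetry of the second derivative needs only that the gradient exists everywhere and is
differentiable at x. -/
theorem hess_symm (h : RegularCost φ μ L M) (x y z : E) :
    ⟪hess φ x y, z⟫_ℝ = ⟪y, hess φ x z⟫_ℝ := by
  have h1 : ∀ y, HasFDerivAt φ (innerSL ℝ (gradient φ y)) y := fun y =>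
    (h.differentiable y).hasGradientAt.hasFDerivAt
  have h2 : HasFDerivAt (fun y => innerSL ℝ (gradient φ y)) ((innerSL ℝ).comp (hess φ x)) x :=
    (innerSL ℝ).hasFDerivAt.comp x (h.hasFDerivAt_gradient x)
  have := second_derivative_symmetric h1 h2 y z
  simpa [real_inner_comm] using this

theorem hess_norm_le [Nontrivial E] (h : RegularCost φ μ L M) (x : E) : ‖hess φ x‖ ≤ L := by
  have hL : 0 ≤ L := by
    obtain ⟨a, b, hab⟩ := exists_pair_ne E
    have := (norm_nonneg _).trans (h.grad_lipschitz a b)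
    exact nonneg_of_mul_nonneg_left this (norm_pos_iff.2 (sub_ne_zero.2 hab))
  have : LipschitzWith ⟨L, hL⟩ (gradient φ) :=
    LipschitzWith.of_dist_le_mul fun x y => by
      rw [dist_eq_norm, dist_eq_norm]; exact h.grad_lipschitz x y
  exact norm_fderiv_le_of_lipschitz ℝ this

theorem norm_hess_apply_le [Nontrivial E] (h : RegularCost φ μ L M) (x z : E) :
    ‖hess φ x z‖ ≤ L * ‖z‖ := (hess φ x).le_of_opNorm_le (h.hess_norm_le x) z

theorem hess_upper [Nontrivial E] (h : RegularCost φ μ L M) (x z : E) :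
    ⟪hess φ x z, z⟫_ℝ ≤ L * ‖z‖ ^ 2 := by
  have := (real_inner_le_norm (hess φ x z) z).trans
    (mul_le_mul_of_nonneg_right (h.norm_hess_apply_le x z) (norm_nonneg z))
  nlinarith

theorem μ_le_L [Nontrivial E] (h : RegularCost φ μ L M) : μ ≤ L := by
  obtain ⟨z, hz⟩ := exists_ne (0 : E)
  have := (h.hess_lower 0 z).trans (h.hess_upper 0 z)
  exact le_of_mul_le_mul_right this (by positivity)

theorem M_nonneg [Nontrivial E] (h : RegularCost φ μ L M) : 0 ≤ M := by
  obtain ⟨a, b, hab⟩ := exists_pair_ne E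
  have := (norm_nonneg _).trans (h.hess_lipschitz a b)
  exact nonneg_of_mul_nonneg_left this (norm_pos_iff.2 (sub_ne_zero.2 hab))

/-- The Polyak-Łojasiewicz inequality. -/
theorem sub_le_norm_gradient_sq (h : RegularCost φ μ L M) (x y : E) :
    φ x - φ y ≤ ‖gradient φ x‖ ^ 2 / (2 * μ) := by
  have h1 := h.add_inner_gradient_le x (y - x)
  rw [add_sub_cancel] at h1
  have h2 := neg_le_of_abs_le (abs_real_inner_le_norm (gradient φ x) (y - x))
  have hμ := h.pos
  rw [le_div_iff₀ (by positivity)]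
  nlinarith [sq_nonneg (‖gradient φ x‖ - μ * ‖y - x‖)]

theorem taylor_gradient (h : RegularCost φ μ L M) (x z : E) :
    ‖gradient φ (x + z) - gradient φ x - hess φ x z‖ ≤ M / 2 * ‖z‖ ^ 2 :=
  norm_taylor_le_of_fderiv_lipschitz h.twice_differentiable h.hess_lipschitz x z

theorem hasDerivAt_line (h : RegularCost φ μ L M) (x z : E) (s : ℝ) :
    HasDerivAt (fun s : ℝ => φ (x + s • z)) ⟪gradient φ (x + s • z), z⟫_ℝ s := by
  have h1 : HasDerivAt (fun s : ℝ => x + s • z) z s := by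
    simpa using ((hasDerivAt_id s).smul_const z).const_add x
  have := (h.differentiable (x + s • z)).hasFDerivAt.comp_hasDerivAt s h1
  rwa [← inner_gradient_left] at this

theorem descent (h : RegularCost φ μ L M) (x z : E) :
    φ (x + z) ≤ φ x + ⟪gradient φ x, z⟫_ℝ + L / 2 * ‖z‖ ^ 2 := by
  have := norm_taylor_le_of_fderiv_lipschitz (K := L) h.differentiable (fun x y => by
    rw [← toDual_gradient, ← toDual_gradient, ← map_sub, LinearIsometryEquiv.norm_map]
    exact h.grad_lipschitz x y) x z
  rw [← inner_gradient_left] at this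
  linarith [Real.le_norm_self (φ (x + z) - φ x - ⟪gradient φ x, z⟫_ℝ)]

/-- The gradient step of length 1/L lowers φ by at least ‖∇φ‖²/(2L) and cannot pass below the lower
bound m. -/
theorem norm_gradient_sq_le [Nontrivial E] (h : RegularCost φ μ L M) {m : ℝ} (hm : ∀ y, m ≤ φ y)
    (x : E) : ‖gradient φ x‖ ^ 2 ≤ 2 * L * (φ x - m) := by
  have hL : 0 < L := h.pos.trans_le h.μ_le_L
  have h1 := (hm _).trans (h.descent x (-(1 / L) • gradient φ x))
  rw [inner_smul_right, real_inner_self_eq_norm_sq, norm_smul, norm_neg, mul_pow,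
    Real.norm_of_nonneg (by positivity)] at h1
  field_simp at h1
  linarith

theorem taylor (h : RegularCost φ μ L M) (x z : E) :
    φ (x + z) ≤ φ x + ⟪gradient φ x, z⟫_ℝ + 1 / 2 * ⟪z, hess φ x z⟫_ℝ + M / 6 * ‖z‖ ^ 3 := by
  -- The derivative of the remainder is the first order Taylor error of the gradient tested on z, at
  -- most M/2 ‖z‖³ s²; its primitive at s = 1 gives the constant M/6.
  have key := image_norm_le_of_norm_deriv_right_le_deriv_boundary
    (f := fun s : ℝ => φ (x + s • z) - φ x - s * ⟪gradient φ x, z⟫_ℝ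
      - s ^ 2 * (1 / 2 * ⟪z, hess φ x z⟫_ℝ))
    (f' := fun s : ℝ => ⟪gradient φ (x + s • z), z⟫_ℝ - 1 * ⟪gradient φ x, z⟫_ℝ
      - (2 * s) * (1 / 2 * ⟪z, hess φ x z⟫_ℝ))
    (B := fun s : ℝ => M / 6 * ‖z‖ ^ 3 * s ^ 3) (B' := fun s : ℝ => M / 2 * ‖z‖ ^ 3 * s ^ 2)
    (a := 0) (b := 1) ?_ ?_ ?_ ?_ ?_ (x := 1) (by simp)
  · simp only [one_smul, one_mul, one_pow, mul_one] at key
    have := (Real.le_norm_self _).trans key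
    linarith
  · have := h.differentiable.continuous
    fun_prop
  · intro s _
    have h2 := h.hasDerivAt_line x z s
    have h3 := (hasDerivAt_id s).mul_const ⟪gradient φ x, z⟫_ℝ
    have h4 := (hasDerivAt_pow 2 s).mul_const (1 / 2 * ⟪z, hess φ x z⟫_ℝ)
    refine (((h2.sub_const (φ x)).sub h3).sub ?_).hasDerivWithinAt
    simpa using h4
  · simp
  · intro s
    have := ((hasDerivAt_pow 3 s).const_mul (M / 6 * ‖z‖ ^ 3))
    exact this.congr_deriv (by push_cast; ring)
  · intro s hs
    have h1 := h.taylor_gradient x (s • z)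
    have h2 : ⟪gradient φ (x + s • z), z⟫_ℝ - 1 * ⟪gradient φ x, z⟫_ℝ
        - (2 * s) * (1 / 2 * ⟪z, hess φ x z⟫_ℝ)
        = ⟪gradient φ (x + s • z) - gradient φ x - hess φ x (s • z), z⟫_ℝ := by
      rw [inner_sub_left, inner_sub_left, map_smul, real_inner_smul_left,
        real_inner_comm z (hess φ x z)]
      ring
    rw [h2]
    rw [norm_smul, Real.norm_of_nonneg hs.1] at h1
    calc _ ≤ _ := norm_inner_le_norm _ _
      _ ≤ M / 2 * (s * ‖z‖) ^ 2 * ‖z‖ := by gcongr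
      _ = _ := by ring

end RegularCost

end ILQR

/-! ### Regularized Gauss-Newton directions: stationarity, size, decrease. -/

namespace ILQR

open ContinuousLinearMap (adjoint adjoint_inner_left adjoint_inner_right)

/-- A Lipschitz differentiable map with Lipschitz and uniformly surjective derivative. -/
structure RegularMap {U E : Type*} [NormedAddCommGroup U] [InnerProductSpace ℝ U] [CompleteSpace U]
    [NormedAddCommGroup E] [InnerProductSpace ℝ E] [CompleteSpace E]
    (g : U → E) (l K σ : ℝ) : Prop where
  differentiable : Differentiable ℝ g
  lipschitz : ∀ u v, ‖g u - g v‖ ≤ l * ‖u - v‖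
  grad_lipschitz : ∀ u v, ‖fderiv ℝ g u - fderiv ℝ g v‖ ≤ K * ‖u - v‖
  pos : 0 < σ
  surjective : ∀ u, ∀ m : E, σ * ‖m‖ ≤ ‖adjoint (fderiv ℝ g u) m‖

variable {U E : Type*} [NormedAddCommGroup U] [InnerProductSpace ℝ U] [CompleteSpace U]
  [NormedAddCommGroup E] [InnerProductSpace ℝ E] [CompleteSpace E]

namespace RegularMap

variable {g : U → E} {l K σ : ℝ}

/-- The lower bound on the adjoint makes it injective. A nonzero domain is what forces the Lipschitz
constant l to be nonnegative. -/
theorem nontrivial_domain [Nontrivial E] (h : RegularMap g l K σ) : Nontrivial U := by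
  obtain ⟨m, hm⟩ := exists_ne (0 : E)
  refine ⟨adjoint (fderiv ℝ g 0) m, 0, fun h0 => ?_⟩
  have := h.surjective 0 m
  rw [h0, norm_zero] at this
  have := mul_pos h.pos (norm_pos_iff.2 hm)
  linarith

theorem l_nonneg [Nontrivial E] (h : RegularMap g l K σ) : 0 ≤ l := by
  have := h.nontrivial_domain
  obtain ⟨a, b, hab⟩ := exists_pair_ne U
  have := (norm_nonneg _).trans (h.lipschitz a b)
  exact nonneg_of_mul_nonneg_left this (norm_pos_iff.2 (sub_ne_zero.2 hab))

theorem norm_fderiv_le [Nontrivial E] (h : RegularMap g l K σ) (u : U) : ‖fderiv ℝ g u‖ ≤ l := by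
  have : LipschitzWith ⟨l, h.l_nonneg⟩ g :=
    LipschitzWith.of_dist_le_mul fun x y => by
      rw [dist_eq_norm, dist_eq_norm]; exact h.lipschitz x y
  exact norm_fderiv_le_of_lipschitz ℝ this

theorem σ_le_l [Nontrivial E] (h : RegularMap g l K σ) : σ ≤ l := by
  obtain ⟨m, hm⟩ := exists_ne (0 : E)
  have h1 := (h.surjective 0 m).trans ((adjoint (fderiv ℝ g 0)).le_opNorm m)
  rw [LinearIsometryEquiv.norm_map] at h1
  exact (le_of_mul_le_mul_right h1 (norm_pos_iff.2 hm)).trans (h.norm_fderiv_le 0)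

theorem taylor (h : RegularMap g l K σ) (u v : U) :
    ‖g (u + v) - g u - fderiv ℝ g u v‖ ≤ K / 2 * ‖v‖ ^ 2 :=
  norm_taylor_le_of_fderiv_lipschitz h.differentiable h.grad_lipschitz u v

end RegularMap

/-- The first order optimality condition of the problem of minimizing
`⟪p, G v⟫ + ½ ⟪G v, H (G v)⟫ + ν / 2 ‖v‖²`. -/
def LQStationary (G : U →L[ℝ] E) (H : E →L[ℝ] E) (p : E) (ν : ℝ) (v : U) : Prop :=
  adjoint G (H (G v) + p) + ν • v = 0

/-- The objective `⟪p, G v⟫ + ½ ⟪G v, H (G v)⟫ + ν / 2 ‖v‖²`. -/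
def lqValue (G : U →L[ℝ] E) (H : E →L[ℝ] E) (p : E) (ν : ℝ) (v : U) : ℝ :=
  ⟪p, G v⟫_ℝ + 1 / 2 * ⟪G v, H (G v)⟫_ℝ + ν / 2 * ‖v‖ ^ 2

namespace LQStationary

variable {G : U →L[ℝ] E} {H : E →L[ℝ] E} {p : E} {ν : ℝ} {v : U}

theorem inner_eq (h : LQStationary G H p ν v) (d : U) :
    ⟪H (G v), G d⟫_ℝ + ⟪p, G d⟫_ℝ + ν * ⟪v, d⟫_ℝ = 0 := by
  have := congrArg (fun x => ⟪x, d⟫_ℝ) h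
  simpa [inner_add_left, adjoint_inner_left, real_inner_smul_left] using this

theorem energy (h : LQStationary G H p ν v) :
    ⟪H (G v), G v⟫_ℝ + ν * ‖v‖ ^ 2 = -⟪p, G v⟫_ℝ := by
  have := h.inner_eq v
  rw [real_inner_self_eq_norm_sq] at this
  linarith

/-- By the energy identity the quadratic terms cancel half of the linear one; this is the origin of
½∇𝒥(u)ᵀv in the sufficient decrease condition. -/
theorem lqValue_eq (h : LQStationary G H p ν v) :
    lqValue G H p ν v = 1 / 2 * ⟪p, G v⟫_ℝ := by
  have := h.energy
  rw [lqValue, real_inner_comm (H (G v)) (G v)]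
  linarith

theorem lqValue_add (h : LQStationary G H p ν v) (hs : ∀ x y, ⟪H x, y⟫_ℝ = ⟪x, H y⟫_ℝ) (d : U) :
    lqValue G H p ν (v + d)
      = lqValue G H p ν v + 1 / 2 * ⟪G d, H (G d)⟫_ℝ + ν / 2 * ‖d‖ ^ 2 := by
  have h1 := h.inner_eq d
  have h2 := norm_add_sq_real v d
  have h3 := hs (G v) (G d)
  have h4 := hs (G d) (G v)
  simp only [lqValue, map_add, inner_add_left, inner_add_right, h2]
  have h5 := real_inner_comm (H (G v)) (G d)
  linarith

/-- The excess ν/2 ‖w - v‖² is kept because it also yields uniqueness of the minimizer for ν > 0. -/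
theorem lqValue_le (h : LQStationary G H p ν v) (hs : ∀ x y, ⟪H x, y⟫_ℝ = ⟪x, H y⟫_ℝ)
    (hp : ∀ x, 0 ≤ ⟪H x, x⟫_ℝ) (w : U) :
    lqValue G H p ν v + ν / 2 * ‖w - v‖ ^ 2 ≤ lqValue G H p ν w := by
  have := h.lqValue_add hs (w - v)
  rw [add_sub_cancel] at this
  have h1 := hp (G (w - v))
  rw [real_inner_comm] at h1
  linarith

/-- The stationary direction lies in the range of `Gᵀ`. -/
theorem exists_multiplier (h : LQStationary G H p ν v) (hν : 0 < ν) :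
    ∃ w, v = adjoint G w ∧ H (G v) + p = -(ν • w) := by
  refine ⟨-(ν⁻¹ • (H (G v) + p)), ?_, ?_⟩
  · rw [map_neg, map_smul, eq_neg_of_add_eq_zero_left h, smul_neg, neg_neg, smul_smul,
      inv_mul_cancel₀ hν.ne', one_smul]
  · rw [smul_neg, neg_neg, smul_smul, mul_inv_cancel₀ hν.ne', one_smul]

end LQStationary

/-- GᵀHG + ν is injective, by the energy identity with p = 0, hence onto in finite dimension. -/
theorem exists_lqStationary [FiniteDimensional ℝ U] (G : U →L[ℝ] E) {H : E →L[ℝ] E} (p : E) {ν : ℝ}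
    (hp : ∀ x, 0 ≤ ⟪H x, x⟫_ℝ) (hν : 0 < ν) : ∃ v, LQStationary G H p ν v := by
  let T : U →ₗ[ℝ] U := ((adjoint G).comp (H.comp G) + ν • ContinuousLinearMap.id ℝ U).toLinearMap
  have hT : Function.Injective T := by
    refine (injective_iff_map_eq_zero T).2 fun v hv => ?_
    have h1 : LQStationary G H 0 ν v := by simpa [LQStationary, T] using hv
    have h2 := h1.energy
    rw [inner_zero_left, neg_zero] at h2
    have h3 : ν * ‖v‖ ^ 2 = 0 := le_antisymm (by linarith [hp (G v)]) (by positivity)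
    simpa [hν.ne'] using h3
  obtain ⟨v, hv⟩ := (LinearMap.injective_iff_surjective.1 hT) (-(adjoint G p))
  refine ⟨v, ?_⟩
  have : adjoint G (H (G v)) + ν • v = -(adjoint G p) := hv
  rw [LQStationary, map_add, add_right_comm, this, neg_add_cancel]

section Step

variable {φ : E → ℝ} {μ L M : ℝ} {g : U → E} {l K σ ν : ℝ} {u v w : U}

theorem RegularCost.inner_hess_nonneg (h : RegularCost φ μ L M) (x z : E) :
    0 ≤ ⟪hess φ x z, z⟫_ℝ := le_trans (by have := h.pos; positivity) (h.hess_lower x z)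

/-- Bounds on a stationary direction `v = Gᵀ w`. -/
theorem RegularMap.multiplier_le (hg : RegularMap g l K σ) {w : E}
    (hw : v = adjoint (fderiv ℝ g u) w) :
    σ * ‖w‖ ≤ ‖v‖ ∧ σ * ‖v‖ ≤ ‖fderiv ℝ g u v‖ := by
  have h1 : σ * ‖w‖ ≤ ‖v‖ := hw ▸ hg.surjective u w
  refine ⟨h1, ?_⟩
  rcases eq_or_ne v 0 with h0 | h0
  · simp [h0]
  -- ‖v‖² = ⟨v, Gᵀw⟩ = ⟨Gv, w⟩; with σ‖w‖ ≤ ‖v‖ this bounds G from below on the range of Gᵀ,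
  -- although G may have a kernel.
  have h2 : ‖v‖ ^ 2 ≤ ‖fderiv ℝ g u v‖ * ‖w‖ := by
    rw [← real_inner_self_eq_norm_sq]
    nth_rewrite 2 [hw]
    rw [adjoint_inner_right]
    exact real_inner_le_norm _ _
  have h3 : 0 < ‖v‖ := norm_pos_iff.2 h0
  refine le_of_mul_le_mul_right ?_ h3
  nlinarith [hg.pos, norm_nonneg (fderiv ℝ g u v)]

/-- The sufficient decrease condition holds for a large enough regularization. -/
theorem sufficient_decrease [Nontrivial E] (h : RegularCost φ μ L M) (hg : RegularMap g l K σ)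
    (hreg : K * ‖gradient φ (g u)‖ + l * (M * l ^ 2 / 3 + K * L) * ‖v‖ ≤ ν) :
    φ (g (u + v)) ≤ φ (g u)
      + lqValue (fderiv ℝ g u) (hess φ (g u)) (gradient φ (g u)) ν v := by
  have hl := hg.l_nonneg
  have hL : 0 < L := h.pos.trans_le h.μ_le_L
  have hM := h.M_nonneg
  set z := fderiv ℝ g u v
  have hz : ‖z‖ ≤ l * ‖v‖ := (fderiv ℝ g u).le_of_opNorm_le (hg.norm_fderiv_le u) v
  have h1 := h.taylor (g u) z
  have h2 := h.le_gradient_add (g u + z) (g (u + v))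
  have h3 := hg.taylor u v
  have h4 : ‖g (u + v) - g u‖ ≤ l * ‖v‖ := by simpa using hg.lipschitz (u + v) u
  have h5 : ‖gradient φ (g (u + v))‖ ≤ ‖gradient φ (g u)‖ + L * (l * ‖v‖) := by
    have := h.grad_lipschitz (g (u + v)) (g u)
    have e := norm_le_norm_add_norm_sub' (gradient φ (g (u + v))) (gradient φ (g u))
    exact e.trans (by gcongr; exact this.trans (by gcongr))
  -- Cost of the nonlinearity of g: the gradient at the new point times the second order error of g.
  have h6 : φ (g (u + v)) - φ (g u + z)
      ≤ (‖gradient φ (g u)‖ + L * (l * ‖v‖)) * (K / 2 * ‖v‖ ^ 2) := by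
    refine h2.trans ((real_inner_le_norm _ _).trans ?_)
    rw [← sub_sub]
    exact mul_le_mul h5 h3 (norm_nonneg _) (by positivity)
  have h7 : M / 6 * ‖z‖ ^ 3 ≤ M / 6 * (l * ‖v‖) ^ 3 := by gcongr
  rw [lqValue]
  change _ ≤ φ (g u) + (⟪gradient φ (g u), z⟫_ℝ + 1 / 2 * ⟪z, hess φ (g u) z⟫_ℝ + ν / 2 * ‖v‖ ^ 2)
  -- The errors `h6` and `h7` add up to half the left side of `hreg` times ‖v‖²; M l³/6 is half of l
  -- · M l²/3.
  nlinarith [mul_le_mul_of_nonneg_right hreg (sq_nonneg ‖v‖)]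

variable (h : RegularCost φ μ L M) (hg : RegularMap g l K σ) (hν : 0 < ν)
  (hv : LQStationary (fderiv ℝ g u) (hess φ (g u)) (gradient φ (g u)) ν v)

include h hg hν hv

/-- With z = Gv, energy gives μ‖z‖² + ν‖v‖² ≤ ‖∇φ‖‖z‖. Multiply by l, use σ‖v‖ ≤ ‖z‖ ≤ l‖v‖, and
divide by ‖z‖. The term σlμ is what keeps the bound useful for small ν. -/
theorem norm_lqStationary_le [Nontrivial E] :
    ‖v‖ * (ν + σ * l * μ) ≤ l * ‖gradient φ (g u)‖ := by
  obtain ⟨w, hw, -⟩ := hv.exists_multiplier hν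
  rcases eq_or_ne v 0 with h0 | h0
  · simpa [h0] using mul_nonneg hg.l_nonneg (norm_nonneg _)
  have hv0 : 0 < ‖v‖ := norm_pos_iff.2 h0
  have h1 := (hg.multiplier_le hw).2
  have h2 := (fderiv ℝ g u).le_of_opNorm_le (hg.norm_fderiv_le u) v
  have h3 := hv.energy
  have h4 := h.hess_lower (g u) (fderiv ℝ g u v)
  have h5 := neg_le_of_abs_le (abs_real_inner_le_norm (gradient φ (g u)) (fderiv ℝ g u v))
  set z := ‖fderiv ℝ g u v‖
  have hz : 0 < z := (mul_pos hg.pos hv0).trans_le h1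
  have hl := hg.l_nonneg
  have hμ := h.pos
  refine le_of_mul_le_mul_right ?_ hz
  have h6 : μ * z ^ 2 + ν * ‖v‖ ^ 2 ≤ ‖gradient φ (g u)‖ * z := by linarith
  have h7 : l * (μ * z * (σ * ‖v‖)) ≤ l * (μ * z * z) := by gcongr
  have h8 : ν * ‖v‖ * z ≤ ν * ‖v‖ * (l * ‖v‖) := by gcongr
  nlinarith [mul_le_mul_of_nonneg_left h6 hl]

/-- The decrease predicted by the model. -/
theorem gradient_sq_le_lqStationary [Nontrivial E] :
    ‖gradient φ (g u)‖ ^ 2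
      ≤ (L + ν / σ ^ 2) * -⟪gradient φ (g u), fderiv ℝ g u v⟫_ℝ := by
  obtain ⟨w, hw, hw'⟩ := hv.exists_multiplier hν
  have h1 := (hg.multiplier_le hw).1
  have hσ := hg.pos
  rw [← hv.energy]
  set z := fderiv ℝ g u v
  set H := hess φ (g u)
  have hL : 0 < L := h.pos.trans_le h.μ_le_L
  -- Since 0 ≤ H ≤ L: positivity of the quadratic form of H at z + s Hz, taken at s = -1/L.
  have h2 : ‖H z‖ ^ 2 ≤ L * ⟪H z, z⟫_ℝ := by
    rcases eq_or_ne (H z) 0 with h0 | h0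
    · simp [h0]
    have hd : ∀ s : ℝ, 0 ≤ ⟪H z, z⟫_ℝ + 2 * s * ‖H z‖ ^ 2 + s ^ 2 * (L * ‖H z‖ ^ 2) := by
      intro s
      have e1 := h.inner_hess_nonneg (g u) (z + s • H z)
      have e2 := h.hess_upper (g u) (H z)
      have e3 := h.hess_symm (g u) (H z) z
      simp only [map_add, map_smul, inner_add_left, inner_add_right, real_inner_smul_left,
        real_inner_smul_right] at e1
      change ⟪H (H z), z⟫_ℝ = ⟪H z, H z⟫_ℝ at e3
      change ⟪H (H z), H z⟫_ℝ ≤ _ at e2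
      rw [e3, real_inner_self_eq_norm_sq] at e1
      nlinarith [mul_le_mul_of_nonneg_left e2 (sq_nonneg s)]
    have := hd (-(1 / L))
    field_simp at this
    linarith
  have h3 : ‖gradient φ (g u)‖ ≤ ‖H z‖ + ν * (‖v‖ / σ) := by
    have e1 : gradient φ (g u) = -(H z) - ν • w := by
      rw [← neg_eq_iff_eq_neg.2 hw']; abel
    have e2 : ‖w‖ ≤ ‖v‖ / σ := by rw [le_div_iff₀ hσ]; linarith
    calc _ ≤ ‖-(H z)‖ + ‖ν • w‖ := e1 ▸ norm_sub_le _ _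
      _ = ‖H z‖ + ν * ‖w‖ := by rw [norm_neg, norm_smul, Real.norm_of_nonneg hν.le]
      _ ≤ _ := by gcongr
  have h4 : ‖gradient φ (g u)‖ ^ 2 ≤ (‖H z‖ + ν * (‖v‖ / σ)) ^ 2 := by gcongr
  have e5 : ‖H z‖ ^ 2 / L ≤ ⟪H z, z⟫_ℝ := by rw [div_le_iff₀ hL]; linarith
  refine h4.trans (le_trans ?_ (mul_le_mul_of_nonneg_left
    (add_le_add_left e5 (ν * ‖v‖ ^ 2)) (by positivity)))
  set b := ‖v‖ / σ with hb
  have hvb : ‖v‖ = b * σ := by rw [hb]; field_simp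
  rw [hvb]
  -- Weighted Cauchy-Schwarz, with its defect written as an explicit square.
  have : (L + ν / σ ^ 2) * (‖H z‖ ^ 2 / L + ν * (b * σ) ^ 2) - (‖H z‖ + ν * b) ^ 2
      = ν / L * (‖H z‖ / σ - L * b * σ) ^ 2 := by
    field_simp
    ring
  nlinarith [show 0 ≤ ν / L * (‖H z‖ / σ - L * b * σ) ^ 2 by positivity]

end Step

end ILQR

/-! ### Newton decrement and local norms. -/

namespace ILQR

open ContinuousLinearMap (adjoint adjoint_inner_left adjoint_inner_right)

section Newton

variable {E : Type*} [NormedAddCommGroup E] [InnerProductSpace ℝ E] [CompleteSpace E]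

/-- The Newton decrement of a function. -/
def newtonDec (φ : E → ℝ) (x : E) : ℝ :=
  √⟪gradient φ x, (hess φ x).inverse (gradient φ x)⟫_ℝ

/-- The norm defined by the Hessian. -/
def hessNorm (φ : E → ℝ) (x y : E) : ℝ := √⟪hess φ x y, y⟫_ℝ

namespace RegularCost

variable {φ : E → ℝ} {μ L M : ℝ} (h : RegularCost φ μ L M)
include h

theorem hessNorm_sq (x y : E) : hessNorm φ x y ^ 2 = ⟪hess φ x y, y⟫_ℝ :=
  Real.sq_sqrt (h.inner_hess_nonneg x y)

/-- Cauchy-Schwarz for the form of the Hessian, from the discriminant of s ↦ ⟨H(y + s z), y + s z⟩.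
-/
theorem inner_hess_le (x y z : E) : ⟪hess φ x y, z⟫_ℝ ≤ hessNorm φ x y * hessNorm φ x z := by
  rw [hessNorm, hessNorm, ← Real.sqrt_mul (h.inner_hess_nonneg x y)]
  refine Real.le_sqrt_of_sq_le ?_
  have := discrim_le_zero (a := ⟪hess φ x z, z⟫_ℝ) (b := 2 * ⟪hess φ x y, z⟫_ℝ)
    (c := ⟪hess φ x y, y⟫_ℝ) fun s => by
      have e1 := h.inner_hess_nonneg x (y + s • z)
      have e2 := h.hess_symm x z y
      have e3 := real_inner_comm z (hess φ x y)
      simp only [map_add, map_smul, inner_add_left, inner_add_right, real_inner_smul_left,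
        real_inner_smul_right] at e1
      have e4 : ⟪hess φ x z, y⟫_ℝ = ⟪hess φ x y, z⟫_ℝ := by rw [e2, ← e3]
      rw [e4] at e1
      linarith
  rw [discrim] at this
  linarith

theorem sqrt_mul_norm_le (x y : E) : √μ * ‖y‖ ≤ hessNorm φ x y := by
  refine Real.le_sqrt_of_sq_le ?_
  rw [mul_pow, Real.sq_sqrt h.pos.le]
  exact h.hess_lower x y

theorem hessNorm_le [Nontrivial E] (x y : E) : hessNorm φ x y ≤ √L * ‖y‖ := by
  have hL : 0 < L := h.pos.trans_le h.μ_le_L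
  refine Real.sqrt_le_iff.2 ⟨by positivity, ?_⟩
  rw [mul_pow, Real.sq_sqrt hL.le]
  exact h.hess_upper x y

/-- Required because `inverse` is zero by convention on operators that are not invertible, which
would make the decrement meaningless. -/
theorem isInvertible_hess [FiniteDimensional ℝ E] (x : E) : (hess φ x).IsInvertible := by
  have hinj : Function.Injective (hess φ x).toLinearMap := by
    refine (injective_iff_map_eq_zero _).2 fun z hz => ?_
    have h1 := h.hess_lower x z
    have h2 : hess φ x z = 0 := hz
    rw [h2, inner_zero_left] at h1
    have h3 : μ * ‖z‖ ^ 2 = 0 := le_antisymm h1 (by have := h.pos; positivity)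
    simpa [h.pos.ne'] using h3
  exact ⟨(LinearEquiv.ofInjectiveEndo _ hinj).toContinuousLinearEquiv, by ext z; rfl⟩

/-- The norms defined by the Hessians at two points are comparable. -/
theorem hessNorm_le_mul_hessNorm [Nontrivial E] (x d y : E) :
    hessNorm φ x y ≤ √(1 + M * ‖d‖ / μ) * hessNorm φ (x + d) y := by
  have hM := h.M_nonneg
  have hμ := h.pos
  rw [hessNorm, hessNorm, ← Real.sqrt_mul (by positivity)]
  refine Real.sqrt_le_sqrt ?_
  have h1 := h.hess_lower (x + d) y
  have h2 : ⟪hess φ x y, y⟫_ℝ - ⟪hess φ (x + d) y, y⟫_ℝ ≤ M * ‖d‖ * ‖y‖ ^ 2 := by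
    rw [← inner_sub_left, ← sub_apply]
    refine (real_inner_le_norm _ _).trans ?_
    have e1 := (hess φ x - hess φ (x + d)).le_of_opNorm_le (h.hess_lipschitz x (x + d)) y
    rw [sub_add_cancel_left, norm_neg] at e1
    rw [sq, ← mul_assoc]
    gcongr
  have h3 : M * ‖d‖ * ‖y‖ ^ 2 ≤ M * ‖d‖ / μ * ⟪hess φ (x + d) y, y⟫_ℝ := by
    rw [div_mul_eq_mul_div, le_div_iff₀ hμ]
    nlinarith [mul_le_mul_of_nonneg_left h1 (show 0 ≤ M * ‖d‖ by positivity)]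
  linarith

variable [FiniteDimensional ℝ E]

theorem exists_newton_direction (x : E) :
    ∃ z, hess φ x z = gradient φ x ∧ newtonDec φ x = hessNorm φ x z := by
  refine ⟨(hess φ x).inverse (gradient φ x), (h.isInvertible_hess x).self_apply_inverse _, ?_⟩
  rw [newtonDec, hessNorm, (h.isInvertible_hess x).self_apply_inverse]

/-- Together with `newtonDec_le_of_forall` this says that the decrement is the norm of the gradient
dual to the Hessian norm; later estimates use this duality and not the inverse. -/
theorem inner_gradient_le (x y : E) : ⟪gradient φ x, y⟫_ℝ ≤ newtonDec φ x * hessNorm φ x y := by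
  obtain ⟨z, hz, hz'⟩ := h.exists_newton_direction x
  rw [hz', ← hz]
  exact h.inner_hess_le x z y

theorem newtonDec_le_of_forall {x : E} {C : ℝ} (hC0 : 0 ≤ C)
    (hC : ∀ y, ⟪gradient φ x, y⟫_ℝ ≤ C * hessNorm φ x y) : newtonDec φ x ≤ C := by
  obtain ⟨z, hz, hz'⟩ := h.exists_newton_direction x
  have h1 := hC z
  rw [← hz, ← h.hessNorm_sq, ← hz', sq] at h1
  have h2 : 0 ≤ newtonDec φ x := Real.sqrt_nonneg _
  rcases h2.eq_or_lt with h0 | h0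
  · rwa [← h0]
  · exact le_of_mul_le_mul_right h1 h0

theorem norm_gradient_le_newtonDec [Nontrivial E] (x : E) :
    ‖gradient φ x‖ ≤ √L * newtonDec φ x := by
  have h1 := h.inner_gradient_le x (gradient φ x)
  have h2 := h.hessNorm_le x (gradient φ x)
  rw [real_inner_self_eq_norm_sq, sq] at h1
  have h3 : 0 ≤ newtonDec φ x := Real.sqrt_nonneg _
  rcases (norm_nonneg (gradient φ x)).eq_or_lt with h0 | h0
  · rw [← h0]; positivity
  · refine le_of_mul_le_mul_right (h1.trans ?_) h0
    nlinarith [mul_le_mul_of_nonneg_left h2 h3]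

theorem sqrt_mul_newtonDec_le (x : E) : √μ * newtonDec φ x ≤ ‖gradient φ x‖ := by
  have hs := Real.sqrt_pos.2 h.pos
  rw [← le_div_iff₀' hs]
  refine h.newtonDec_le_of_forall (by positivity) fun y => ?_
  have h1 := h.sqrt_mul_norm_le x y
  refine (real_inner_le_norm _ _).trans ?_
  rw [div_mul_eq_mul_div, le_div_iff₀ hs]
  nlinarith [norm_nonneg (gradient φ x)]

/-- The Newton decrement after a perturbed Newton step `z + e`, where
`∇φ(x) + ∇²φ(x) z = -q`. -/
theorem newtonDec_perturbed_step [Nontrivial E] {x z e q : E}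
    (hz : hess φ x z + gradient φ x = -q) :
    newtonDec φ (x + (z + e)) ≤ √(1 + M * ‖z + e‖ / μ)
      * (‖q‖ / √μ + √L * ‖e‖ + M / 2 * ‖z + e‖ ^ 2 / √μ) := by
  have hM := h.M_nonneg
  have hμ := h.pos
  have hs := Real.sqrt_pos.2 h.pos
  -- The new gradient is -q + He + r, with r the Taylor error of the gradient. Each part is bounded
  -- in the dual of the Hessian norm at x; passing to the norm at the new point costs the square
  -- root factor.
  refine h.newtonDec_le_of_forall (by positivity) fun y => ?_
  set r := gradient φ (x + (z + e)) - gradient φ x - hess φ x (z + e) with hr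
  have h1 : gradient φ (x + (z + e)) = -q + hess φ x e + r := by
    rw [hr, ← hz, map_add]; abel
  have h2 : ‖r‖ ≤ M / 2 * ‖z + e‖ ^ 2 := h.taylor_gradient x (z + e)
  have h3 : ‖y‖ ≤ hessNorm φ x y / √μ := by
    rw [le_div_iff₀' hs]; exact h.sqrt_mul_norm_le x y
  have hN : 0 ≤ hessNorm φ x y := Real.sqrt_nonneg _
  have h4 : ⟪-q, y⟫_ℝ ≤ ‖q‖ / √μ * hessNorm φ x y := by
    refine (real_inner_le_norm _ _).trans ?_
    rw [norm_neg, div_mul_eq_mul_div, ← mul_div_assoc']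
    gcongr
  have h5 : ⟪r, y⟫_ℝ ≤ M / 2 * ‖z + e‖ ^ 2 / √μ * hessNorm φ x y := by
    refine (real_inner_le_norm _ _).trans ?_
    rw [div_mul_eq_mul_div, ← mul_div_assoc']
    gcongr
  have h6 : ⟪hess φ x e, y⟫_ℝ ≤ √L * ‖e‖ * hessNorm φ x y :=
    (h.inner_hess_le x e y).trans (by gcongr; exact h.hessNorm_le x e)
  rw [h1, inner_add_left, inner_add_left]
  calc _ ≤ (‖q‖ / √μ + √L * ‖e‖ + M / 2 * ‖z + e‖ ^ 2 / √μ) * hessNorm φ x y := by linarith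
    _ ≤ (‖q‖ / √μ + √L * ‖e‖ + M / 2 * ‖z + e‖ ^ 2 / √μ)
        * (√(1 + M * ‖z + e‖ / μ) * hessNorm φ (x + (z + e)) y) := by
      gcongr; exact h.hessNorm_le_mul_hessNorm x (z + e) y
    _ = _ := by ring

end RegularCost

end Newton

/-- The positivity facts on the constants. -/
structure Constants.Proper (c : Constants) : Prop where
  μ_pos : 0 < c.μh
  μ_le : c.μh ≤ c.Lh
  M_nonneg : 0 ≤ c.Mh
  σ_pos : 0 < c.σg
  σ_le : c.σg ≤ c.lg
  L_pos : 0 < c.Lg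

/-- The regularization as a function of the norm of the gradient of the total cost. -/
def Constants.regOf (c : Constants) (a : ℝ) : ℝ :=
  c.Lg * a + 2 * c.lg ^ 2 * (c.Mh * c.lg ^ 2 / 3 + c.Lg * c.Lh) * a
      / (c.Lg * a + c.σg * c.lg * c.μh)

namespace Constants.Proper

variable {c : Constants} (hc : c.Proper)
include hc

theorem lg_pos : 0 < c.lg := hc.σ_pos.trans_le hc.σ_le
theorem Lh_pos : 0 < c.Lh := hc.μ_pos.trans_le hc.μ_le
theorem one_le_ρh : 1 ≤ c.ρh := (one_le_div hc.μ_pos).2 hc.μ_le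
theorem one_le_ρg : 1 ≤ c.ρg := (one_le_div hc.σ_pos).2 hc.σ_le
theorem θg_pos : 0 < c.θg := by
  have := hc.L_pos; have := hc.σ_pos; have := hc.μ_pos
  rw [Constants.θg]; positivity
theorem θh_nonneg : 0 ≤ c.θh := by
  have := hc.M_nonneg; have := hc.μ_pos
  rw [Constants.θh]; positivity
theorem α_pos : 0 < c.α := by
  have := hc.θh_nonneg; have := hc.θg_pos; have := hc.one_le_ρh; have := hc.one_le_ρg
  rw [Constants.α]; positivity
theorem quadConst_pos : 0 < c.quadConst := by
  have := hc.θh_nonneg; have := hc.θg_pos; have := hc.one_le_ρh; have := hc.one_le_ρg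
  rw [Constants.quadConst]; positivity
theorem gapBar_pos : 0 < c.gapBar := by
  have := hc.quadConst_pos; have := hc.one_le_ρh
  rw [Constants.gapBar]; positivity

theorem regOf_pos {a : ℝ} (ha : 0 < a) : 0 < c.regOf a := by
  have := hc.lg_pos; have := hc.Lh_pos; have := hc.L_pos; have := hc.σ_pos; have := hc.μ_pos
  have := hc.M_nonneg
  rw [Constants.regOf]; positivity

/-- Dropping the gradient term in the denominator: the regularization vanishes linearly with the
gradient, as quadratic convergence requires. -/
theorem regOf_le {a : ℝ} (ha : 0 ≤ a) :
    c.regOf a ≤ a * (c.Lg + 2 * c.lg * (c.Mh * c.lg ^ 2 / 3 + c.Lg * c.Lh) / (c.σg * c.μh)) := by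
  have h1 := hc.lg_pos; have h2 := hc.Lh_pos; have h3 := hc.L_pos; have h4 := hc.σ_pos
  have h5 := hc.μ_pos; have h6 := hc.M_nonneg
  rw [Constants.regOf]
  have : 2 * c.lg ^ 2 * (c.Mh * c.lg ^ 2 / 3 + c.Lg * c.Lh) * a
      / (c.Lg * a + c.σg * c.lg * c.μh) ≤ 2 * c.lg ^ 2 * (c.Mh * c.lg ^ 2 / 3 + c.Lg * c.Lh) * a
      / (c.σg * c.lg * c.μh) := by
    gcongr
    have : 0 ≤ c.Lg * a := by positivity
    linarith
  refine (add_le_add_right this _).trans (le_of_eq ?_)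
  field_simp

/-- The regularization is large enough for steps of the size of the oracle directions. -/
theorem le_regOf {a b : ℝ} (ha : 0 < a)
    (hb : b * (c.regOf a + c.σg * c.lg * c.μh) ≤ c.lg * a) :
    c.Lg * a + c.lg * (c.Mh * c.lg ^ 2 / 3 + c.Lg * c.Lh) * b ≤ c.regOf a := by
  have h1 := hc.lg_pos; have h2 := hc.Lh_pos; have h3 := hc.L_pos; have h4 := hc.σ_pos
  have h5 := hc.μ_pos; have h6 := hc.M_nonneg
  set D := c.Lg * a + c.σg * c.lg * c.μh with hD
  set m := c.Mh * c.lg ^ 2 / 3 + c.Lg * c.Lh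
  have hD0 : 0 < D := by positivity
  have hm : 0 < m := by positivity
  have h7 : c.regOf a = c.Lg * a + 2 * c.lg ^ 2 * m * a / D := rfl
  -- Only the part L_g a of ν is kept here. The resulting bound b ≤ l_g a / D is half of what the
  -- factor 2 in the definition of ν allows for.
  have hbD : b * D ≤ c.lg * a := by
    rcases le_or_gt b 0 with h0 | h0
    · nlinarith [mul_nonneg (neg_nonneg.2 h0) hD0.le, mul_pos h1 ha]
    · refine le_trans ?_ hb
      have : 0 ≤ 2 * c.lg ^ 2 * m * a / D := by positivity
      gcongr
      linarith
  have h8 : b ≤ c.lg * a / D := by rwa [le_div_iff₀ hD0]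
  have h9 : c.lg * m * b ≤ c.lg * m * (c.lg * a / D) := by gcongr
  rw [h7]
  have h10 : 2 * c.lg ^ 2 * m * a / D = 2 * (c.lg * m * (c.lg * a / D)) := by ring
  have h11 : 0 ≤ c.lg * m * (c.lg * a / D) := by positivity
  linarith

/-- The numerical inequality behind the radius of quadratic convergence. -/
theorem quadratic_bound {lam T s a R : ℝ} (hlam : 0 ≤ lam) (hlam' : lam ≤ c.decrementBar)
    (ha : a = √c.ρh * c.θg) (hR : R = √c.ρh * c.ρg ^ 3) (hs0 : 0 ≤ s)
    (hT0 : 0 ≤ T)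
    (hs : s ≤ 2 * c.θh * lam * (1 + a * lam / 2))
    (hT : T ≤ lam ^ 2 * (c.θh * (1 + a * lam / 2) ^ 2 + 4 / 3 * R * c.θh
      + a * (3 / 2 + 2 * c.ρg * c.ρh))) :
    √(1 + s) * T ≤ 4 * c.quadConst * lam ^ 2 := by
  have hh := hc.θh_nonneg
  have ha0 : 0 < a := by
    have := hc.θg_pos; have := hc.one_le_ρh
    rw [ha]; positivity
  have hR0 : 0 ≤ R := by
    have := hc.one_le_ρg
    rw [hR]; positivity
  have hQ0 := hc.quadConst_pos
  have hQ : c.quadConst = c.θh * (1 + R / 3) + a * (1 + c.ρg * c.ρh) := by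
    rw [Constants.quadConst, ha, hR]
  have hρ : 1 ≤ c.ρg * c.ρh := one_le_mul_of_one_le_of_one_le hc.one_le_ρg hc.one_le_ρh
  set Q := c.quadConst
  have hlQ : 4 * Q * lam ≤ 1 := by
    rw [Constants.decrementBar, le_div_iff₀ (by positivity)] at hlam'
    linarith
  -- Since ρ_gρ_h ≥ 1, 2a ≤ Q; with 4Qλ ≤ 1 this gives aλ ≤ 1/8, so 1 + aλ/2 ≤ 17/16, and 289/256 =
  -- (17/16)².
  have h1 : a * 2 ≤ Q := by nlinarith [mul_nonneg hh hR0]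
  have h2 : a * lam ≤ 1 / 8 := by nlinarith [mul_le_mul_of_nonneg_right h1 hlam]
  have h3 : c.θh * (1 + a * lam / 2) ^ 2 ≤ c.θh * (289 / 256) := by
    have : 0 ≤ a * lam := by positivity
    gcongr
    nlinarith
  have h4 : √(1 + s) ≤ 1 + 17 / 16 * (c.θh * lam) := by
    have e1 : √(1 + s) ≤ 1 + s / 2 := by
      rw [Real.sqrt_le_iff]; constructor <;> nlinarith
    have e2 : c.θh * lam * (1 + a * lam / 2) ≤ c.θh * lam * (17 / 16) := by
      gcongr; linarith
    linarith
  set B := c.θh * (289 / 256) + 4 / 3 * R * c.θh + a * (3 / 2 + 2 * c.ρg * c.ρh) with hB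
  have hB0 : 0 ≤ B := by
    have := mul_nonneg hR0 hh
    have := mul_nonneg ha0.le (zero_le_one.trans hρ)
    rw [hB]
    linarith
  have h5 : T ≤ lam ^ 2 * B :=
    hT.trans (mul_le_mul_of_nonneg_left (by linarith) (sq_nonneg _))
  have h6 : B ≤ 4 * Q := by rw [hQ, hB]; nlinarith [mul_nonneg hh hR0]
  -- The bound T ≤ λ²B is below 4Qλ² with room to spare: as λB ≤ 1, the factor √(1 + s) adds at most
  -- (17/16)θ_h to B, and the sum is still at most 4Q.
  have h7 : lam * B ≤ 1 := by nlinarith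
  have h8 : (1 + 17 / 16 * (c.θh * lam)) * B ≤ 4 * Q := by
    have : (1 + 17 / 16 * (c.θh * lam)) * B ≤ B + 17 / 16 * c.θh := by
      nlinarith [mul_le_mul_of_nonneg_left h7 hh]
    refine this.trans ?_
    rw [hQ, hB]
    nlinarith [mul_nonneg hh hR0]
  calc _ ≤ (1 + 17 / 16 * (c.θh * lam)) * (lam ^ 2 * B) := by gcongr
    _ = (1 + 17 / 16 * (c.θh * lam)) * B * lam ^ 2 := by ring
    _ ≤ _ := by gcongr

end Constants.Proper

/-! ### One iteration in the quadratic regime. -/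

section QuadraticStep

variable {U E : Type*} [NormedAddCommGroup U] [InnerProductSpace ℝ U] [CompleteSpace U]
  [NormedAddCommGroup E] [InnerProductSpace ℝ E] [CompleteSpace E]
  [Nontrivial E] {φ : E → ℝ} {g : U → E} {c : Constants} {u v : U}

theorem Constants.proper_of_regular (h : RegularCost φ c.μh c.Lh c.Mh)
    (hg : RegularMap g c.lg c.Lg c.σg) (hL : 0 < c.Lg) : c.Proper :=
  ⟨h.pos, h.μ_le_L, h.M_nonneg, hg.pos, hg.σ_le_l, hL⟩

/-- Local quadratic convergence in terms of the Newton decrement. -/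
theorem newtonDec_step_le [FiniteDimensional ℝ E] (h : RegularCost φ c.μh c.Lh c.Mh) (hg : RegularMap g c.lg c.Lg c.σg)
    (hL : 0 < c.Lg) (hp : 0 < ‖gradient φ (g u)‖)
    (hv : LQStationary (fderiv ℝ g u) (hess φ (g u)) (gradient φ (g u))
      (c.regOf ‖gradient φ (g u)‖) v)
    (hlam : newtonDec φ (g u) ≤ c.decrementBar) :
    newtonDec φ (g (u + v)) ≤ 4 * c.quadConst * newtonDec φ (g u) ^ 2 := by
  have hc := Constants.proper_of_regular h hg hL
  set ν := c.regOf ‖gradient φ (g u)‖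
  have hν : 0 < ν := hc.regOf_pos hp
  obtain ⟨w, hw, hw'⟩ := hv.exists_multiplier hν
  obtain ⟨h1, h2⟩ := hg.multiplier_le hw
  have henergy := hv.energy
  have h4 := hg.taylor u v
  set z := fderiv ℝ g u v with hz
  set e := g (u + v) - g u - z with he
  set lam := newtonDec φ (g u)
  have hlam0 : 0 ≤ lam := Real.sqrt_nonneg _
  have hx : g (u + v) = g u + (z + e) := by rw [he]; abel
  rw [hx]
  -- Inexact Newton step in the space of states, with residual q = νw from the regularization and
  -- displacement error e from the nonlinearity of g.
  refine (h.newtonDec_perturbed_step hw').trans ?_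
  have hμ := h.pos
  have hσ := hc.σ_pos
  have hM := hc.M_nonneg
  have hl := hc.lg_pos
  -- With √μ_h and √L_h as plain variables, all constants become rational functions and the final
  -- comparisons become field identities.
  obtain ⟨s, hs⟩ : ∃ s, s = √c.μh := ⟨_, rfl⟩
  obtain ⟨r, hr⟩ : ∃ r, r = √c.Lh := ⟨_, rfl⟩
  have hs0 : 0 < s := hs ▸ Real.sqrt_pos.2 hμ
  have hr0 : 0 < r := hr ▸ Real.sqrt_pos.2 hc.Lh_pos
  have hsr : s ≤ r := by rw [hs, hr]; exact Real.sqrt_le_sqrt hc.μ_le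
  have hμs : c.μh = s ^ 2 := by rw [hs, Real.sq_sqrt hμ.le]
  have hLr : c.Lh = r ^ 2 := by rw [hr, Real.sq_sqrt hc.Lh_pos.le]
  have hρ : √c.ρh = r / s := by rw [Constants.ρh, Real.sqrt_div hc.Lh_pos.le, hs, hr]
  -- Energy: the squared Hessian norm of z is at most -⟨∇φ, z⟩, which is at most λ times that norm.
  -- The bounds on ‖z‖, ‖v‖, ‖w‖ and e all start from here.
  have hzN : hessNorm φ (g u) z ≤ lam := by
    have e1 := h.inner_gradient_le (g u) (-z)
    have e2 : hessNorm φ (g u) (-z) = hessNorm φ (g u) z := by simp [hessNorm]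
    rw [e2, inner_neg_right, ← henergy, ← h.hessNorm_sq] at e1
    have e3 : 0 ≤ hessNorm φ (g u) z := Real.sqrt_nonneg _
    rcases e3.eq_or_lt with h0 | h0
    · rwa [← h0]
    · refine le_of_mul_le_mul_right ?_ h0
      have : 0 ≤ ν * ‖v‖ ^ 2 := by positivity
      nlinarith
  have hz1 : ‖z‖ ≤ lam / s := by
    rw [le_div_iff₀' hs0, hs]; exact (h.sqrt_mul_norm_le _ z).trans hzN
  have hv1 : ‖v‖ ≤ lam / (c.σg * s) := by
    rw [← div_div, div_right_comm, le_div_iff₀' hσ]; exact h2.trans hz1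
  have hw1 : ‖w‖ ≤ lam / (c.σg ^ 2 * s) := by
    rw [sq, mul_assoc, ← div_div, div_right_comm, le_div_iff₀' hσ]; exact h1.trans hv1
  set K := c.Lg with hK
  set σ := c.σg with hσ'
  set M := c.Mh with hM'
  set l := c.lg with hl'
  have he1 : ‖e‖ ≤ K / 2 * (lam / (σ * s)) ^ 2 := h4.trans (by gcongr)
  have ha : √c.ρh * c.θg = r * K / (σ ^ 2 * s ^ 2) := by
    rw [hρ, Constants.θg, ← hs, ← hK, ← hσ']; field_simp
  have hθ : c.θh = M / (2 * s ^ 3) := by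
    rw [Constants.θh, ← hs, hμs, ← hM']; field_simp
  have hR : √c.ρh * c.ρg ^ 3 = r / s * (l / σ) ^ 3 := by rw [hρ, Constants.ρg]
  have hd : ‖z + e‖ ≤ lam / s * (1 + √c.ρh * c.θg * lam / 2) := by
    -- A factor √ρ_h ≥ 1 is given away so that this error is expressed through the same product √ρ_h
    -- θ_g as the others.
    have e1 : K / 2 * (lam / (σ * s)) ^ 2 ≤ r / s * (K / 2 * (lam / (σ * s)) ^ 2) :=
      le_mul_of_one_le_left (by positivity) ((one_le_div hs0).2 hsr)
    calc ‖z + e‖ ≤ ‖z‖ + ‖e‖ := norm_add_le _ _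
      _ ≤ lam / s + r / s * (K / 2 * (lam / (σ * s)) ^ 2) := add_le_add hz1 (he1.trans e1)
      _ = _ := by rw [ha]; field_simp
  have hν1 : ν ≤ r * lam * (K + 2 * l * (M * l ^ 2 / 3 + K * r ^ 2) / (σ * s ^ 2)) := by
    have e1 := hc.regOf_le hp.le
    rw [hLr, hμs] at e1
    refine e1.trans ?_
    have e2 := h.norm_gradient_le_newtonDec (g u)
    rw [← hr] at e2
    gcongr
  refine hc.quadratic_bound hlam0 hlam rfl rfl (by positivity) (by positivity) ?_ ?_
  · calc M * ‖z + e‖ / c.μh ≤ M * (lam / s * (1 + √c.ρh * c.θg * lam / 2)) / s ^ 2 := by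
          rw [hμs]; gcongr
      _ = _ := by rw [hθ]; field_simp
  · rw [← hs, ← hr, norm_smul, Real.norm_of_nonneg hν.le]
    have t1 : ν * ‖w‖ / s ≤ r * lam * (K + 2 * l * (M * l ^ 2 / 3 + K * r ^ 2) / (σ * s ^ 2))
        * (lam / (σ ^ 2 * s)) / s := by gcongr
    have t2 : r * ‖e‖ ≤ r * (K / 2 * (lam / (σ * s)) ^ 2) := by gcongr
    have t3 : M / 2 * ‖z + e‖ ^ 2 / s
        ≤ M / 2 * (lam / s * (1 + √c.ρh * c.θg * lam / 2)) ^ 2 / s := by gcongr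
    refine (add_le_add (add_le_add t1 t2) t3).trans (le_of_eq ?_)
    rw [hθ, hR, ha, Constants.ρg, Constants.ρh, hLr, hμs, ← hl', ← hσ']
    field_simp
    ring

end QuadraticStep

end ILQR

/-! ### Potential argument and iteration count. -/

namespace ILQR

open ContinuousLinearMap (adjoint)

namespace Constants

variable (c : Constants)

/-- The potential whose decrease by one per iteration gives the length of the first phase. -/
def potential (δ : ℝ) : ℝ :=
  4 * c.θg * √δ + 2 * c.ρh * Real.log δ + 2 * c.α * Real.log (c.θg * √δ + c.ρg)

/-- The quantity `δ Φ'(δ)` for the potential `Φ`. -/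
def rate (δ : ℝ) : ℝ :=
  2 * c.ρh + 2 * c.θg * √δ + c.α * c.θg * √δ / (c.θg * √δ + c.ρg)

end Constants

namespace Constants.Proper

variable {c : Constants} (hc : c.Proper)
include hc

theorem phaseBound_eq {δ : ℝ} (hδ : 0 < δ) :
    c.phaseBound δ = c.potential δ - c.potential c.gapBar := by
  have h1 := hc.gapBar_pos
  have h2 := hc.θg_pos
  have h3 := zero_lt_one.trans_le hc.one_le_ρg
  rw [Constants.phaseBound, Constants.potential, Constants.potential,
    Real.log_div hδ.ne' h1.ne', Real.log_div (by positivity) (by positivity)]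
  ring

theorem potential_lt {b δ : ℝ} (hb : 0 < b) (h : b < δ) : c.potential b < c.potential δ := by
  have h2 := hc.θg_pos
  have h3 := zero_lt_one.trans_le hc.one_le_ρg
  have h4 := zero_lt_one.trans_le hc.one_le_ρh
  have h5 := hc.α_pos
  have h6 : √b < √δ := Real.sqrt_lt_sqrt hb.le h
  have h7 : 0 < √b := Real.sqrt_pos.2 hb
  rw [Constants.potential, Constants.potential]
  gcongr

/-- The potential decreases by at least one when the gap decreases by `δ / rate δ`. -/
theorem potential_drop {δ δ' : ℝ} (hδ : 0 < δ) (hδ' : 0 < δ') (h : δ ≤ c.rate δ * (δ - δ')) :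
    c.potential δ' + 1 ≤ c.potential δ := by
  have h2 := hc.θg_pos
  have h3 := zero_lt_one.trans_le hc.one_le_ρg
  have h4 := zero_lt_one.trans_le hc.one_le_ρh
  have h5 := hc.α_pos
  have hx : 0 < √δ := Real.sqrt_pos.2 hδ
  have hy : 0 < √δ' := Real.sqrt_pos.2 hδ'
  have hx2 : δ = √δ ^ 2 := (Real.sq_sqrt hδ.le).symm
  have hy2 : δ' = √δ' ^ 2 := (Real.sq_sqrt hδ'.le).symm
  set x := √δ with hxd
  set y := √δ' with hyd
  -- `e1` to `e3` are tangent inequalities for the concave terms of the potential; `e5` says that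
  -- the slopes add up to `rate` δ / δ.
  have e1 : y - x ≤ (δ' - δ) / (2 * x) := by
    rw [le_div_iff₀ (by positivity), hx2, hy2]; nlinarith [sq_nonneg (y - x)]
  have e2 : Real.log δ' - Real.log δ ≤ (δ' - δ) / δ := by
    rw [← Real.log_div hδ'.ne' hδ.ne']
    refine (Real.log_le_sub_one_of_pos (by positivity)).trans (le_of_eq ?_)
    field_simp
  have e3 : Real.log (c.θg * y + c.ρg) - Real.log (c.θg * x + c.ρg)
      ≤ c.θg * ((δ' - δ) / (2 * x)) / (c.θg * x + c.ρg) := by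
    rw [← Real.log_div (by positivity) (by positivity)]
    refine (Real.log_le_sub_one_of_pos (by positivity)).trans ?_
    have : (c.θg * y + c.ρg) / (c.θg * x + c.ρg) - 1
        = c.θg * (y - x) / (c.θg * x + c.ρg) := by
      field_simp; ring
    rw [this]
    gcongr
  have e4 : 4 * c.θg * ((δ' - δ) / (2 * x)) + 2 * c.ρh * ((δ' - δ) / δ)
      + 2 * c.α * (c.θg * ((δ' - δ) / (2 * x)) / (c.θg * x + c.ρg)) ≤ -1 := by
    have e5 : 4 * c.θg * ((δ' - δ) / (2 * x)) + 2 * c.ρh * ((δ' - δ) / δ)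
      + 2 * c.α * (c.θg * ((δ' - δ) / (2 * x)) / (c.θg * x + c.ρg))
        = -((c.rate δ * (δ - δ')) / δ) := by
      rw [Constants.rate, ← hxd, hx2]
      field_simp
      ring
    rw [e5, neg_le_neg_iff, one_le_div hδ]
    exact h
  rw [Constants.potential, Constants.potential, ← hxd, ← hyd]
  have f1 := mul_le_mul_of_nonneg_left e1 (show 0 ≤ 4 * c.θg by positivity)
  have f2 := mul_le_mul_of_nonneg_left e2 (show 0 ≤ 2 * c.ρh by positivity)
  have f3 := mul_le_mul_of_nonneg_left e3 (show 0 ≤ 2 * c.α by positivity)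
  linarith

/-- The decrease of an iteration in terms of the rate. -/
theorem le_rate_mul {δ a : ℝ} (hδ : 0 < δ) (ha : 0 < a) (hda : 2 * c.μh * δ ≤ a ^ 2) :
    δ ≤ c.rate δ * (1 / 2 * (a ^ 2 / (c.Lh + c.regOf a / c.σg ^ 2))) := by
  have hL := hc.Lh_pos
  have hK := hc.L_pos
  have hσ := hc.σ_pos
  have hν := hc.regOf_pos ha
  have hθ := hc.θg_pos
  have hρg := zero_lt_one.trans_le hc.one_le_ρg
  have hρh := zero_lt_one.trans_le hc.one_le_ρh
  have hθh := hc.θh_nonneg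
  have hμ := hc.μ_pos
  obtain ⟨s, hs⟩ : ∃ s, s = √c.μh := ⟨_, rfl⟩
  have hs0 : 0 < s := hs ▸ Real.sqrt_pos.2 hμ
  have hμs : c.μh = s ^ 2 := by rw [hs, Real.sq_sqrt hμ.le]
  have hx : 0 < √δ := Real.sqrt_pos.2 hδ
  have hx2 : δ = √δ ^ 2 := (Real.sq_sqrt hδ.le).symm
  have k1 : c.Lh = s ^ 2 * c.ρh := by rw [Constants.ρh, hμs]; field_simp
  have k2 : c.lg = c.ρg * c.σg := by rw [Constants.ρg]; field_simp
  have k3 : c.Lg = c.θg * c.σg ^ 2 * s := by rw [Constants.θg, ← hs]; field_simp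
  have k4 : c.Mh = 2 * s ^ 3 * c.θh := by rw [Constants.θh, ← hs, hμs]; field_simp
  set D := c.Lh + c.regOf a / c.σg ^ 2 with hD
  have hD0 : 0 < D := by positivity
  rw [Constants.rate]
  set x := √δ
  -- Only the weaker form μδ ≤ a² of the hypothesis is used from here on.
  have ha1 : s * x ≤ a := by
    refine le_of_sq_le_sq ?_ ha.le
    rw [mul_pow, ← hμs, ← hx2]
    nlinarith [mul_pos hμ hδ]
  have hα : c.α * c.θg = 4 * c.ρg ^ 2 * (2 * c.ρg ^ 2 * c.θh / 3 + c.θg * c.ρh) := by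
    rw [Constants.α]; field_simp
  -- The terms of the rate match those of L_h + ν/σ_g² one by one: 2ρ_h for L_h, 2θ_g√δ for L_g a,
  -- and the fraction with α for the fraction in ν. Each comparison reduces to s x ≤ a.
  have t3 : 2 * x ^ 2 * (c.regOf a / c.σg ^ 2)
      ≤ a ^ 2 * (2 * c.θg * x + c.α * c.θg * x / (c.θg * x + c.ρg)) := by
    have e1 : c.regOf a / c.σg ^ 2 = c.θg * s * a
        + a * s ^ 2 * (c.α * c.θg) / (2 * (c.θg * a + c.ρg * s)) := by
      rw [hα, Constants.regOf, k1, hμs, k4, k3, k2]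
      field_simp
      ring
    rw [e1]
    have e2 : 2 * x ^ 2 * (c.θg * s * a) ≤ a ^ 2 * (2 * c.θg * x) := by
      have := mul_le_mul_of_nonneg_left ha1 (show 0 ≤ 2 * c.θg * a * x by positivity)
      linarith
    have e3 : x * s ^ 2 / (c.θg * a + c.ρg * s) ≤ a / (c.θg * x + c.ρg) := by
      rw [div_le_div_iff₀ (by positivity) (by positivity)]
      have f1 : (s * x) ^ 2 ≤ a ^ 2 := by gcongr
      have f2 := mul_le_mul_of_nonneg_left ha1 hs0.le
      nlinarith [mul_le_mul_of_nonneg_left f1 hθ.le, mul_le_mul_of_nonneg_left f2 hρg.le]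
    have e4 : 2 * x ^ 2 * (a * s ^ 2 * (c.α * c.θg) / (2 * (c.θg * a + c.ρg * s)))
        = c.α * c.θg * a * x * (x * s ^ 2 / (c.θg * a + c.ρg * s)) := by
      field_simp
    have e5 : a ^ 2 * (c.α * c.θg * x / (c.θg * x + c.ρg))
        = c.α * c.θg * a * x * (a / (c.θg * x + c.ρg)) := by
      field_simp
    have hα0 := hc.α_pos
    have e6 := mul_le_mul_of_nonneg_left e3 (show 0 ≤ c.α * c.θg * a * x by positivity)
    rw [← e4, ← e5] at e6
    linarith
  have t1 : 2 * x ^ 2 * c.Lh ≤ a ^ 2 * (2 * c.ρh) := by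
    have f1 : (s * x) ^ 2 ≤ a ^ 2 := by gcongr
    rw [k1]
    have := mul_le_mul_of_nonneg_left f1 (show 0 ≤ 2 * c.ρh by positivity)
    linarith
  have t : 2 * x ^ 2 * D
      ≤ a ^ 2 * (2 * c.ρh + 2 * c.θg * x + c.α * c.θg * x / (c.θg * x + c.ρg)) := by
    rw [hD]; linarith
  rw [hx2]
  have : (2 * c.ρh + 2 * c.θg * x + c.α * c.θg * x / (c.θg * x + c.ρg))
      * (1 / 2 * (a ^ 2 / D)) = a ^ 2 * (2 * c.ρh + 2 * c.θg * x
        + c.α * c.θg * x / (c.θg * x + c.ρg)) / (2 * D) := by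
    field_simp
  rw [this, le_div_iff₀ (by positivity)]
  linarith

/-- The length of the first phase. -/
theorem gap_le_of_potential {δ : ℕ → ℝ} (h0 : ∀ n, 0 ≤ δ n) (hmono : Antitone δ)
    (hrate : ∀ n, 0 < δ n → δ n ≤ c.rate (δ n) * (δ n - δ (n + 1))) {b : ℝ} (hb : 0 < b) {n : ℕ}
    (hn : 0 < δ 0 → c.potential (δ 0) - c.potential b ≤ n) : δ n ≤ b := by
  -- The potential involves log δ, so the telescoping runs only while the gap is positive; a
  -- vanished gap satisfies the bound anyway.
  rcases (h0 n).eq_or_lt with h | h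
  · exact h ▸ hb.le
  have key : ∀ k, 0 < δ k → c.potential (δ k) + k ≤ c.potential (δ 0) := by
    intro k
    induction k with
    | zero => simp
    | succ k ih =>
      intro hk
      have hk' : 0 < δ k := hk.trans_le (hmono (Nat.le_succ k))
      have := hc.potential_drop hk' hk (hrate k hk')
      push_cast
      linarith [ih hk']
  by_contra! hlt
  have h1 := hc.potential_lt hb hlt
  have h2 := key n h
  have h3 := hn (h.trans_le (hmono (Nat.zero_le n)))
  linarith

/-- Uses 2ρ_h δ̄ = λ̄². The value q = 1 gives entry into the quadratic region, q = 2 entry at half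
its radius. -/
theorem sqrt_gap {lam δ : ℝ} {q : ℝ} (hq : 0 < q) (h1 : lam ^ 2 ≤ 2 * c.ρh * δ)
    (h : δ ≤ c.gapBar / q ^ 2) : lam ≤ c.decrementBar / q := by
  have hQ := hc.quadConst_pos
  have hρh := zero_lt_one.trans_le hc.one_le_ρh
  have hd : 0 < c.decrementBar := by rw [Constants.decrementBar]; positivity
  refine le_of_sq_le_sq (h1.trans ?_) (by positivity)
  calc 2 * c.ρh * δ ≤ 2 * c.ρh * (c.gapBar / q ^ 2) := by gcongr
    _ = _ := by rw [Constants.gapBar, Constants.decrementBar]; field_simp; norm_num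

/-- The local phase, started at a quarter of the gap `δ̄`. -/
theorem quadratic_phase {δ lam : ℕ → ℝ} (hmono : Antitone δ)
    (hlam : ∀ n, 0 ≤ lam n) (h1 : ∀ n, lam n ^ 2 ≤ 2 * c.ρh * δ n)
    (hq : ∀ n, lam n ≤ c.decrementBar → lam (n + 1) ≤ 4 * c.quadConst * lam n ^ 2)
    {n : ℕ} (hn : δ n ≤ c.gapBar / 2 ^ 2) (j : ℕ) :
    4 * c.quadConst * lam (n + j) ≤ (1 / 2) ^ 2 ^ j := by
  have hQ := hc.quadConst_pos
  -- At gap δ̄ one has only 4Qλ ≤ 1, which squaring need not decrease. A quarter of the gap gives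
  -- 4Qλ ≤ 1/2, and then each iteration squares the bound.
  induction j with
  | zero =>
    have := hc.sqrt_gap two_pos (h1 n) hn
    rw [Constants.decrementBar, div_div, le_div_iff₀ (by positivity)] at this
    norm_num
    linarith
  | succ j ih =>
    have h2 : lam (n + j) ≤ c.decrementBar := by
      have h3 : δ (n + j) ≤ c.gapBar / 1 ^ 2 := by
        have := hmono (Nat.le_add_right n j)
        have := hc.gapBar_pos
        linarith
      simpa using hc.sqrt_gap one_pos (h1 _) h3
    have h4 := hq _ h2
    have h5 : 0 ≤ 4 * c.quadConst * lam (n + j) := by have := hlam (n + j); positivity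
    calc 4 * c.quadConst * lam (n + (j + 1))
        ≤ 4 * c.quadConst * (4 * c.quadConst * lam (n + j) ^ 2) := by gcongr; exact h4
      _ = (4 * c.quadConst * lam (n + j)) ^ 2 := by ring
      _ ≤ ((1 / 2) ^ 2 ^ j) ^ 2 := by gcongr
      _ = _ := by rw [← pow_mul, pow_succ]

/-- Iterations after the first phase. -/
theorem exists_iteration_bound : ∃ C ε₀ : ℝ, 0 < ε₀ ∧ ∀ δ lam : ℕ → ℝ, (∀ n, 0 ≤ δ n) →
    Antitone δ → (∀ n, 0 < δ n → δ n ≤ c.rate (δ n) * (δ n - δ (n + 1))) →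
    (∀ n, 0 ≤ lam n) → (∀ n, lam n ^ 2 ≤ 2 * c.ρh * δ n) →
    (∀ n, δ n ≤ c.ρh / 2 * lam n ^ 2) →
    (∀ n, lam n ≤ c.decrementBar → lam (n + 1) ≤ 4 * c.quadConst * lam n ^ 2) →
    ∀ ε : ℝ, 0 < ε → ε ≤ ε₀ → ∃ k : ℕ,
      (k : ℝ) ≤ max 0 (c.phaseBound (δ 0)) + C * Real.log (Real.log (1 / ε)) ∧
      ∀ n, k ≤ n → δ n ≤ ε := by
  have hQ := hc.quadConst_pos
  have hρh := zero_lt_one.trans_le hc.one_le_ρh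
  have hb := hc.gapBar_pos
  -- Bound on the extra iterations from δ̄ to δ̄/4, which depends on the constants only.
  set N := max 0 (c.potential c.gapBar - c.potential (c.gapBar / 2 ^ 2)) with hN
  -- Chosen so that ρ_h λ²/2 = A (4Qλ)².
  set A := c.ρh / (32 * c.quadConst ^ 2) with hA
  have hA0 : 0 < A := by positivity
  -- ε ≤ exp(-e) makes ln ln(1/ε) ≥ 1, so that additive constants go into C: N + 1 from the first
  -- count and 2 + 2 ln ln(1/ε) from the second. ε ≤ 1/A absorbs the factor A at the end.
  refine ⟨N + 5, min (Real.exp (-Real.exp 1)) (1 / A), by positivity, ?_⟩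
  intro δ lam h0 hmono hrate hlam h1 h2 hq ε hε hε0
  set ℓ := Real.log (1 / ε) with hℓ
  have hℓ1 : Real.exp 1 ≤ ℓ := by
    rw [hℓ, one_div, Real.log_inv, le_neg]
    have := Real.log_le_log hε (hε0.trans (min_le_left _ _))
    rwa [Real.log_exp] at this
  have hℓ0 : 0 < ℓ := (Real.exp_pos 1).trans_le hℓ1
  have hlℓ : 1 ≤ Real.log ℓ := (Real.le_log_iff_exp_le hℓ0).2 hℓ1
  have hAε : A * ε ≤ 1 := by
    have := hε0.trans (min_le_right _ _)
    rw [le_div_iff₀ hA0] at this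
    linarith
  set k₀ := ⌈max 0 (c.phaseBound (δ 0)) + N⌉₊ with hk₀
  set j := ⌈Real.log (2 * ℓ) / Real.log 2⌉₊ with hj
  have hlog2 : 1 / 2 < Real.log 2 := by linarith [Real.log_two_gt_d9]
  have hk : δ k₀ ≤ c.gapBar / 2 ^ 2 := by
    refine hc.gap_le_of_potential h0 hmono hrate (by positivity) fun hpos => ?_
    have e1 := hc.phaseBound_eq hpos
    refine le_trans ?_ (Nat.le_ceil _)
    have e2 := le_max_right 0 (c.phaseBound (δ 0))
    have e3 := le_max_right 0 (c.potential c.gapBar - c.potential (c.gapBar / 2 ^ 2))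
    linarith
  refine ⟨k₀ + j, ?_, fun n hn => ?_⟩
  · have e1 : (k₀ : ℝ) < max 0 (c.phaseBound (δ 0)) + N + 1 := Nat.ceil_lt_add_one (by positivity)
    have e2 : (j : ℝ) < Real.log (2 * ℓ) / Real.log 2 + 1 := by
      refine Nat.ceil_lt_add_one (div_nonneg (Real.log_nonneg ?_) (by linarith))
      have := Real.add_one_le_exp 1
      linarith
    have e3 : Real.log (2 * ℓ) / Real.log 2 ≤ 1 + 2 * Real.log ℓ := by
      rw [Real.log_mul two_ne_zero hℓ0.ne', div_le_iff₀ (by linarith)]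
      nlinarith
    have hN0 : 0 ≤ N := le_max_left _ _
    push_cast
    nlinarith
  · refine (hmono hn).trans ?_
    have h3 := hc.quadratic_phase hmono hlam h1 hq hk j
    -- Then (4Qλ)² ≤ (1/4)^(2^j) ≤ exp(-2^j) ≤ ε²; the spare power of ε pays for A.
    have h4 : 2 * ℓ ≤ 2 ^ j := by
      have e1 : Real.log (2 * ℓ) ≤ j * Real.log 2 := by
        rw [← div_le_iff₀ (by linarith)]; exact Nat.le_ceil _
      rw [← Real.log_pow] at e1
      exact (Real.log_le_log_iff (by positivity) (by positivity)).1 e1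
    have h5 : ((1 / 2 : ℝ) ^ 2 ^ j) ^ 2 ≤ ε ^ 2 := by
      have e1 : ((1 / 2 : ℝ) ^ 2 ^ j) ^ 2 = (1 / 4) ^ 2 ^ j := by
        rw [← pow_mul, mul_comm, pow_mul]; norm_num
      have e2 : (1 / 4 : ℝ) ≤ Real.exp (-1) := by
        rw [Real.exp_neg, ← one_div]
        refine one_div_le_one_div_of_le (Real.exp_pos 1) ?_
        linarith [Real.exp_one_lt_d9]
      calc _ ≤ Real.exp (-1) ^ 2 ^ j := by rw [e1]; gcongr
        _ = Real.exp (-(2 ^ j)) := by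
          rw [← Real.exp_nat_mul]; push_cast; ring_nf
        _ ≤ Real.exp (-(2 * ℓ)) := Real.exp_le_exp.2 (by linarith)
        _ = ε ^ 2 := by
          rw [hℓ, one_div, Real.log_inv, mul_neg, neg_neg, ← Real.log_rpow hε,
            Real.exp_log (by positivity)]
          norm_num
    have h6 : 0 ≤ 4 * c.quadConst * lam (k₀ + j) := by have := hlam (k₀ + j); positivity
    have h7 : (4 * c.quadConst * lam (k₀ + j)) ^ 2 ≤ ε ^ 2 := le_trans (by gcongr) h5
    have h8 : c.ρh / 2 * lam (k₀ + j) ^ 2 = A * (4 * c.quadConst * lam (k₀ + j)) ^ 2 := by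
      rw [hA]; field_simp; ring
    refine (h2 _).trans ?_
    rw [h8]
    calc _ ≤ A * ε ^ 2 := by gcongr
      _ = A * ε * ε := by ring
      _ ≤ _ := by nlinarith

end Constants.Proper

/-! ### The algorithm for an abstract composition φ ∘ g. -/

section Abstract

variable {U E : Type*} [NormedAddCommGroup U] [InnerProductSpace ℝ U] [CompleteSpace U]
  [NormedAddCommGroup E] [InnerProductSpace ℝ E] [CompleteSpace E]
  {φ : E → ℝ} {g : U → E} {c : Constants} {u v : U}

/-- `v` is the regularized Gauss-Newton direction at `u` (the null direction where the gradient
of the outer function vanishes). -/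
def IsStep (φ : E → ℝ) (g : U → E) (c : Constants) (u v : U) : Prop :=
  gradient φ (g u) = 0 ∧ v = 0 ∨ 0 < ‖gradient φ (g u)‖ ∧
    LQStationary (fderiv ℝ g u) (hess φ (g u)) (gradient φ (g u)) (c.regOf ‖gradient φ (g u)‖) v

theorem IsStep.lqStationary (hv : IsStep φ g c u v) :
    LQStationary (fderiv ℝ g u) (hess φ (g u)) (gradient φ (g u))
      (c.regOf ‖gradient φ (g u)‖) v := by
  rcases hv with ⟨h0, rfl⟩ | ⟨-, h⟩
  · simp [LQStationary, h0]
  · exact h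

variable (h : RegularCost φ c.μh c.Lh c.Mh) (hg : RegularMap g c.lg c.Lg c.σg)
  (hL : 0 < c.Lg) [Nontrivial E]
include h hg hL

theorem IsStep.sufficient_decrease (hv : IsStep φ g c u v) :
    φ (g (u + v)) ≤ φ (g u) + lqValue (fderiv ℝ g u) (hess φ (g u)) (gradient φ (g u))
      (c.regOf ‖gradient φ (g u)‖) v := by
  have hc := Constants.proper_of_regular h hg hL
  rcases hv with ⟨h0, rfl⟩ | ⟨h0, hv⟩
  · simp [lqValue]
  · exact ILQR.sufficient_decrease h hg
      (hc.le_regOf h0 (norm_lqStationary_le h hg (hc.regOf_pos h0) hv))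

/-- The optimal model value ½⟨∇φ, Gv⟩ is bounded by `gradient_sq_le_lqStationary`. -/
theorem IsStep.decrease (hv : IsStep φ g c u v) (h0 : 0 < ‖gradient φ (g u)‖) :
    φ (g (u + v)) ≤ φ (g u) - 1 / 2 * (‖gradient φ (g u)‖ ^ 2
      / (c.Lh + c.regOf ‖gradient φ (g u)‖ / c.σg ^ 2)) := by
  have hc := Constants.proper_of_regular h hg hL
  have h1 := hv.sufficient_decrease h hg hL
  rw [hv.lqStationary.lqValue_eq] at h1
  have h2 := gradient_sq_le_lqStationary h hg (hc.regOf_pos h0) hv.lqStationary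
  have hν := hc.regOf_pos h0
  have := hc.σ_pos
  have := hc.Lh_pos
  rw [← div_le_iff₀' (by positivity)] at h2
  linarith

theorem IsStep.antitone (hv : IsStep φ g c u v) : φ (g (u + v)) ≤ φ (g u) := by
  have hc := Constants.proper_of_regular h hg hL
  rcases (norm_nonneg (gradient φ (g u))).eq_or_lt with h0 | h0
  · rcases hv with ⟨-, rfl⟩ | ⟨h1, -⟩
    · simp
    · exact absurd h0 h1.ne
  · have h1 := hv.decrease h hg hL h0
    have hν := hc.regOf_pos h0
    have := hc.σ_pos
    have := hc.Lh_pos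
    have : 0 ≤ 1 / 2 * (‖gradient φ (g u)‖ ^ 2
      / (c.Lh + c.regOf ‖gradient φ (g u)‖ / c.σg ^ 2)) := by positivity
    linarith

/-- The decrease of the gap to a value `m` for which the Polyak-Łojasiewicz inequality holds. -/
theorem IsStep.rate (hv : IsStep φ g c u v) {m : ℝ}
    (hm : φ (g u) - m ≤ ‖gradient φ (g u)‖ ^ 2 / (2 * c.μh)) (hpos : 0 < φ (g u) - m) :
    φ (g u) - m ≤ c.rate (φ (g u) - m) * ((φ (g u) - m) - (φ (g (u + v)) - m)) := by
  have hc := Constants.proper_of_regular h hg hL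
  have hμ := h.pos
  rw [le_div_iff₀ (by positivity)] at hm
  have h0 : 0 < ‖gradient φ (g u)‖ := by
    rw [norm_pos_iff]
    intro h0
    rw [h0, norm_zero] at hm
    nlinarith [mul_pos hμ hpos]
  refine (hc.le_rate_mul hpos h0 (by linarith)).trans ?_
  have h1 := hv.decrease h hg hL h0
  have : 0 ≤ c.rate (φ (g u) - m) := by
    have h2 := hc.θg_pos
    have h3 := zero_lt_one.trans_le hc.one_le_ρg
    have h4 := zero_lt_one.trans_le hc.one_le_ρh
    have h5 := hc.α_pos
    rw [Constants.rate]; positivity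
  exact mul_le_mul_of_nonneg_left (by linarith) this

theorem IsStep.newtonDec_le [FiniteDimensional ℝ E] (hv : IsStep φ g c u v)
    (hlam : newtonDec φ (g u) ≤ c.decrementBar) :
    newtonDec φ (g (u + v)) ≤ 4 * c.quadConst * newtonDec φ (g u) ^ 2 := by
  have hc := Constants.proper_of_regular h hg hL
  rcases hv with ⟨h0, rfl⟩ | ⟨h0, hv⟩
  · simp [newtonDec, h0]
  · exact newtonDec_step_le h hg hL h0 hv hlam

omit hg hL [Nontrivial E] in
theorem RegularCost.bddBelow : BddBelow (Set.range φ) :=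
  ⟨φ 0 - ‖gradient φ 0‖ ^ 2 / (2 * c.μh), by
    rintro _ ⟨y, rfl⟩
    linarith [h.sub_le_norm_gradient_sq 0 y]⟩

-- The infimum is over the whole space, not over the range of g, and need not be known to be
-- attained.
omit hg hL [Nontrivial E] in
theorem RegularCost.sub_iInf_le (x : E) :
    φ x - ⨅ y, φ y ≤ ‖gradient φ x‖ ^ 2 / (2 * c.μh) := by
  have : φ x - ‖gradient φ x‖ ^ 2 / (2 * c.μh) ≤ ⨅ y, φ y :=
    le_ciInf fun y => by linarith [h.sub_le_norm_gradient_sq x y]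
  linarith

/-- The infimum of the composition is the infimum of the outer function. -/
theorem iInf_comp_eq {u : ℕ → U} (hu : ∀ n, ∃ v, u (n + 1) = u n + v ∧ IsStep φ g c (u n) v) :
    ⨅ w, φ (g w) = ⨅ y, φ y := by
  have hc := Constants.proper_of_regular h hg hL
  have hb := h.bddBelow
  have hb' : BddBelow (Set.range fun w => φ (g w)) :=
    hb.mono (by rintro _ ⟨w, rfl⟩; exact ⟨g w, rfl⟩)
  refine le_antisymm (le_of_forall_pos_le_add fun b hb0 => ?_)
    (le_ciInf fun w => ciInf_le hb (g w))
  -- The potential argument needs only the Polyak-Łojasiewicz inequality relative to inf φ. It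
  -- brings the iterates within b of inf φ in finitely many steps, so the values of φ on the range
  -- of g come arbitrarily close to inf φ.
  obtain ⟨n, hn⟩ := exists_nat_ge
    (c.potential (φ (g (u 0)) - ⨅ y, φ y) - c.potential b)
  have := hc.gap_le_of_potential (δ := fun n => φ (g (u n)) - ⨅ y, φ y)
    (fun n => sub_nonneg.2 (ciInf_le hb _))
    (antitone_nat_of_succ_le fun n => by
      obtain ⟨v, hv, hs⟩ := hu n
      have := hs.antitone h hg hL
      rw [hv]
      linarith)
    (fun n hn => by
      obtain ⟨v, hv, hs⟩ := hu n
      have := hs.rate h hg hL (h.sub_iInf_le (g (u n))) hn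
      rwa [← hv] at this) hb0 (n := n) (fun _ => hn)
  have h2 := ciInf_le hb' (u n)
  linarith

end Abstract

end ILQR

/-! ### Identification of control problems with the abstract setting. -/

namespace ILQR

open ContinuousLinearMap (adjoint)

theorem nontrivial_seq {τ n : ℕ} (hτ : 0 < τ) (hn : 0 < n) : Nontrivial (Seq τ n) := by
  have : Nonempty (Fin τ) := ⟨⟨0, hτ⟩⟩
  have : Nonempty (Fin n) := ⟨⟨0, hn⟩⟩
  infer_instance

/-- The components of the derivative of a map into a space of sequences. -/
theorem apply_eq_of_hasFDerivAt {H : Type*} [NormedAddCommGroup H] [NormedSpace ℝ H] {τ n : ℕ}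
    {f : H → Seq τ n} {f' : H →L[ℝ] Seq τ n} {x : H} {t : Fin τ} {φ' : H →L[ℝ] Vec n}
    (h1 : HasFDerivAt f f' x) (h2 : HasFDerivAt (fun y => f y t) φ' x) (y : H) :
    f' y t = φ' y := by
  have h3 := (PiLp.hasFDerivAt_apply (𝕜 := ℝ) 2 (f x) t).comp x h1
  rw [← h3.unique h2]
  rfl

namespace ControlProblem

variable {nx nu τ : ℕ} {P : ControlProblem nx nu τ}

/-! ### The total cost -/

section TotalCost

variable {μ L M : ℝ}

theorem RegularCosts.hasGradientAt (hP : P.RegularCosts μ L M) (x : Seq τ nx) :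
    HasGradientAt P.totalCost (WithLp.toLp 2 fun t => gradient (P.h t) (x t)) x := by
  rw [hasGradientAt_iff_hasFDerivAt]
  have h1 : HasFDerivAt P.totalCost
      (∑ t, (fderiv ℝ (P.h t) (x t)).comp (PiLp.proj 2 (fun _ : Fin τ => Vec nx) t)) x :=
    HasFDerivAt.fun_sum fun t _ =>
      (hP.differentiable t (x t)).hasFDerivAt.comp x (PiLp.hasFDerivAt_apply 2 x t)
  refine h1.congr_fderiv ?_
  ext1 y
  rw [InnerProductSpace.toDual_apply_apply, PiLp.inner_apply]
  simp [inner_gradient_left]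

theorem RegularCosts.gradient_apply (hP : P.RegularCosts μ L M) (x : Seq τ nx) (t : Fin τ) :
    gradient P.totalCost x t = gradient (P.h t) (x t) := by
  rw [(hP.hasGradientAt x).gradient]

theorem RegularCosts.differentiable_gradient (hP : P.RegularCosts μ L M) :
    Differentiable ℝ (gradient P.totalCost) := by
  rw [differentiable_piLp]
  intro t
  simp_rw [hP.gradient_apply]
  exact (hP.twice_differentiable t).comp (PiLp.proj 2 (fun _ : Fin τ => Vec nx) t).differentiable

theorem RegularCosts.hess_apply (hP : P.RegularCosts μ L M) (x y : Seq τ nx) (t : Fin τ) :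
    hess P.totalCost x y t = hess (P.h t) (x t) (y t) := by
  have h2 := ((hP.twice_differentiable t) (x t)).hasFDerivAt.comp x
    (PiLp.hasFDerivAt_apply (𝕜 := ℝ) 2 x t)
  refine apply_eq_of_hasFDerivAt (hP.differentiable_gradient x).hasFDerivAt
    (h2.congr_of_eventuallyEq (.of_forall fun x => hP.gradient_apply x t)) y

/-- The costs act on separate blocks and the Hessian is block diagonal, so the constants are those
of a single cost, independent of τ. -/
theorem RegularCosts.regularCost (hP : P.RegularCosts μ L M) (hL : 0 ≤ L) (hM : 0 ≤ M) :
    RegularCost P.totalCost μ L M where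
  pos := hP.pos
  strongConvex := by
    refine ⟨convex_univ, fun x _ y _ a b ha hb hab => ?_⟩
    simp only [totalCost, smul_eq_mul]
    calc _ ≤ ∑ t, (a * P.h t (x t) + b * P.h t (y t) - a * b * (μ / 2 * ‖x t - y t‖ ^ 2)) :=
          Finset.sum_le_sum fun t _ =>
            (hP.strongConvex t).2 (Set.mem_univ (x t)) (Set.mem_univ (y t)) ha hb hab
      _ = _ := by
        rw [PiLp.norm_sq_eq_of_L2, Finset.sum_sub_distrib, Finset.sum_add_distrib,
          Finset.mul_sum, Finset.mul_sum, Finset.mul_sum, Finset.mul_sum]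
        rfl
  differentiable x := (hP.hasGradientAt x).differentiableAt
  twice_differentiable := hP.differentiable_gradient
  grad_lipschitz x y := by
    refine le_of_sq_le_sq ?_ (by positivity)
    rw [mul_pow, PiLp.norm_sq_eq_of_L2, PiLp.norm_sq_eq_of_L2, Finset.mul_sum]
    refine Finset.sum_le_sum fun t _ => ?_
    rw [PiLp.sub_apply, PiLp.sub_apply, hP.gradient_apply, hP.gradient_apply, ← mul_pow]
    gcongr
    exact hP.grad_lipschitz t _ _
  hess_lipschitz x y := by
    refine ContinuousLinearMap.opNorm_le_bound _ (by positivity) fun z => ?_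
    refine le_of_sq_le_sq ?_ (by positivity)
    rw [mul_pow, PiLp.norm_sq_eq_of_L2, PiLp.norm_sq_eq_of_L2 _ z, Finset.mul_sum]
    refine Finset.sum_le_sum fun t _ => ?_
    rw [sub_apply, PiLp.sub_apply, hP.hess_apply, hP.hess_apply, ← mul_pow,
      ← sub_apply]
    gcongr
    refine (ContinuousLinearMap.le_opNorm _ _).trans ?_
    gcongr
    refine (hP.hess_lipschitz t _ _).trans ?_
    gcongr
    exact PiLp.norm_apply_le (x - y) t

end TotalCost

/-! ### The control in `τ` steps -/

theorem hasFDerivAt_x (hf : Differentiable ℝ P.f) (x : Vec nx) (u : Vec nu) :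
    HasFDerivAt (fun z => P.f (z, u)) (P.Dx x u) x :=
  (DifferentiableAt.comp x (hf (x, u)) (by fun_prop)).hasFDerivAt

theorem hasFDerivAt_u (hf : Differentiable ℝ P.f) (x : Vec nx) (u : Vec nu) :
    HasFDerivAt (fun w => P.f (x, w)) (P.Du x u) u :=
  (DifferentiableAt.comp u (hf (x, u)) (by fun_prop)).hasFDerivAt

theorem fderiv_f_apply (hf : Differentiable ℝ P.f) (x y : Vec nx) (u v : Vec nu) :
    fderiv ℝ P.f (x, u) (y, v) = P.Dx x u y + P.Du x u v := by
  have h1 := (hf (x, u)).hasFDerivAt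
  have e1 := (h1.comp x (hasFDerivAt_prodMk_left x u)).unique (hasFDerivAt_x hf x u)
  have e2 := (h1.comp u (hasFDerivAt_prodMk_right x u)).unique (hasFDerivAt_u hf x u)
  rw [← e1, ← e2]
  simp [← map_add]

/-- The derivative of the state at time `t` with respect to the command. -/
def stateDeriv (P : ControlProblem nx nu τ) (u : Seq τ nu) : ℕ → Seq τ nu →L[ℝ] Vec nx
  | 0 => 0
  | t + 1 =>
    if ht : t < τ then
      (P.Dx (P.state u t) (u ⟨t, ht⟩)).comp (stateDeriv P u t)
        + (P.Du (P.state u t) (u ⟨t, ht⟩)).comp (PiLp.proj 2 (fun _ : Fin τ => Vec nu) ⟨t, ht⟩)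
    else stateDeriv P u t

theorem stateDeriv_apply (u v : Seq τ nu) (t : ℕ) : P.stateDeriv u t v = P.linState u v t := by
  induction t with
  | zero => rfl
  | succ t ih =>
    by_cases ht : t < τ <;> simp [stateDeriv, linState, ht, ih]

theorem hasFDerivAt_state (hf : Differentiable ℝ P.f) (u : Seq τ nu) (t : ℕ) :
    HasFDerivAt (fun u => P.state u t) (P.stateDeriv u t) u := by
  induction t with
  | zero => exact hasFDerivAt_const _ _
  | succ t ih =>
    by_cases ht : t < τ
    · have h1 := (hf (P.state u t, u ⟨t, ht⟩)).hasFDerivAt.comp u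
        (ih.prodMk (PiLp.hasFDerivAt_apply (𝕜 := ℝ) 2 u ⟨t, ht⟩))
      have h2 : (fun u => P.state u (t + 1)) = P.f ∘ fun u => (P.state u t, u ⟨t, ht⟩) := by
        funext u; simp [state, ht]
      rw [h2]
      refine h1.congr_fderiv ?_
      ext1 v
      simp [stateDeriv, ht, fderiv_f_apply hf]
    · simpa [state, stateDeriv, ht] using ih

theorem differentiable_g (hf : Differentiable ℝ P.f) : Differentiable ℝ P.g := by
  rw [differentiable_piLp]
  exact fun t u => (hasFDerivAt_state hf u (t + 1)).differentiableAt

theorem fderiv_g_apply (hf : Differentiable ℝ P.f) (u v : Seq τ nu) (t : Fin τ) :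
    fderiv ℝ P.g u v t = P.linState u v (t + 1) := by
  rw [← stateDeriv_apply]
  exact apply_eq_of_hasFDerivAt (differentiable_g hf u).hasFDerivAt
    (hasFDerivAt_state hf u (t + 1)) v

/-- Identifies the stagewise objective with the abstract one, so that the existence, uniqueness and
decrease results apply to the oracle. -/
theorem lqObjective_eq {μ L M : ℝ} (hf : Differentiable ℝ P.f) (hP : P.RegularCosts μ L M) (ν : ℝ)
    (u v : Seq τ nu) : P.lqObjective ν u v
      = lqValue (fderiv ℝ P.g u) (hess P.totalCost (P.g u)) (gradient P.totalCost (P.g u)) ν v := by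
  simp only [lqObjective, lqValue, PiLp.inner_apply, PiLp.norm_sq_eq_of_L2, hP.hess_apply,
    hP.gradient_apply, fderiv_g_apply hf, Finset.sum_add_distrib, Finset.mul_sum]
  simp only [g]
  ring

theorem lqr_eq {ν : ℝ} {u v : Seq τ nu} (hv : P.IsLQRSolution ν u v)
    (huniq : ∀ w, P.IsLQRSolution ν u w → w = v) : P.lqr ν u = v := by
  have h : ∃! v, P.IsLQRSolution ν u v := ⟨v, hv, huniq⟩
  rw [lqr, dif_pos h]
  exact huniq _ h.exists.choose_spec

namespace Admissible

variable {c : Constants} (hP : P.Admissible c) (hnx : 0 < nx) (hτ : 0 < τ)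
include hP hnx hτ

/-- Positive n_x and τ provide one cost on a nontrivial space, from which L_h ≥ 0 and M_h ≥ 0
follow; neither is assumed. -/
theorem regularCost : RegularCost P.totalCost c.μh c.Lh c.Mh := by
  have : Nonempty (Fin nx) := ⟨⟨0, hnx⟩⟩
  have h0 : RegularCost (P.h ⟨0, hτ⟩) c.μh c.Lh c.Mh :=
    ⟨hP.costs.pos, hP.costs.strongConvex _, hP.costs.differentiable _,
      hP.costs.twice_differentiable _, hP.costs.grad_lipschitz _, hP.costs.hess_lipschitz _⟩
  exact hP.costs.regularCost (h0.pos.le.trans h0.μ_le_L) h0.M_nonneg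

omit hnx hτ in
theorem regularMap : RegularMap P.g c.lg c.Lg c.σg :=
  ⟨differentiable_g hP.dynamics.differentiable, hP.trajectory.lipschitz,
    hP.trajectory.grad_lipschitz, hP.trajectory.pos, hP.trajectory.surjective⟩

theorem proper : c.Proper := by
  have := nontrivial_seq hτ hnx
  exact Constants.proper_of_regular (hP.regularCost hnx hτ) hP.regularMap hP.Lg_pos

theorem lqr_eq_of_lqStationary {ν : ℝ} (hν : 0 < ν) {u v : Seq τ nu}
    (hv : LQStationary (fderiv ℝ P.g u) (hess P.totalCost (P.g u)) (gradient P.totalCost (P.g u))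
      ν v) : P.IsLQRSolution ν u v ∧ P.lqr ν u = v := by
  have h := hP.regularCost hnx hτ
  have h1 := hv.lqValue_le (h.hess_symm _) (h.inner_hess_nonneg _)
  simp only [← lqObjective_eq hP.dynamics.differentiable hP.costs] at h1
  have h2 : P.IsLQRSolution ν u v := fun w => by
    have := h1 w
    have : 0 ≤ ν / 2 * ‖w - v‖ ^ 2 := by positivity
    linarith
  refine ⟨h2, lqr_eq h2 fun w hw => ?_⟩
  have h3 : ν / 2 * ‖w - v‖ ^ 2 = 0 :=
    le_antisymm (by linarith [h1 w, hw v]) (by positivity)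
  simpa [hν.ne', sub_eq_zero] using h3

/-- When ∇h vanishes, ν = 0 and the objective is a nonnegative quadratic form: zero is a minimizer,
and the oracle returns it whether or not it is the only one. Otherwise ν > 0 and the stationary
direction is the unique minimizer. -/
theorem lqr_spec (u : Seq τ nu) : P.IsLQRSolution (P.reg c u) u (P.lqr (P.reg c u) u) ∧
    IsStep P.totalCost P.g c u (P.lqr (P.reg c u) u) := by
  have h := hP.regularCost hnx hτ
  have hc := hP.proper hnx hτ
  rcases (norm_nonneg (gradient P.totalCost (P.g u))).eq_or_lt with h0 | h0
  · have h1 := norm_eq_zero.1 h0.symm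
    have hν : P.reg c u = 0 := by simp [reg, h1]
    have h2 : P.IsLQRSolution (P.reg c u) u 0 := fun w => by
      rw [lqObjective_eq hP.dynamics.differentiable hP.costs,
        lqObjective_eq hP.dynamics.differentiable hP.costs, h1, hν]
      simp only [lqValue, inner_zero_left, map_zero, zero_div, zero_mul, add_zero, zero_add,
        mul_zero]
      rw [real_inner_comm]
      have := h.inner_hess_nonneg (P.g u) (fderiv ℝ P.g u w)
      positivity
    have h3 : P.lqr (P.reg c u) u = 0 := by
      rw [lqr]
      split_ifs with hv
      · exact hv.unique hv.exists.choose_spec h2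
      · rfl
    rw [h3]
    exact ⟨h2, Or.inl ⟨h1, rfl⟩⟩
  · obtain ⟨v, hv⟩ := exists_lqStationary (fderiv ℝ P.g u) (gradient P.totalCost (P.g u))
      (h.inner_hess_nonneg (P.g u)) (hc.regOf_pos h0)
    have h1 := hP.lqr_eq_of_lqStationary hnx hτ (hc.regOf_pos h0) hv
    have h2 : P.reg c u = c.regOf ‖gradient P.totalCost (P.g u)‖ := rfl
    rw [h2, h1.2]
    exact ⟨h1.1, Or.inr ⟨h0, hv⟩⟩

theorem sufficientDecrease (u : Seq τ nu) : P.SufficientDecrease (P.reg c u) u := by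
  have := nontrivial_seq hτ hnx
  have h := hP.regularCost hnx hτ
  have hg := hP.regularMap
  have hs := (hP.lqr_spec hnx hτ u).2
  have h1 := hs.sufficient_decrease h hg hP.Lg_pos
  have h2 := hs.lqStationary.lqValue_eq
  have e : P.model u (P.lqr (P.reg c u) u) + P.reg c u / 2 * ‖P.lqr (P.reg c u) u‖ ^ 2
      = lqValue (fderiv ℝ P.g u) (hess P.totalCost (P.g u)) (gradient P.totalCost (P.g u))
        (c.regOf ‖gradient P.totalCost (P.g u)‖) (P.lqr (P.reg c u) u) := rfl
  refine ⟨?_, ?_⟩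
  · rw [add_assoc, e]
    exact h1
  -- The chain rule turns ⟨∇h, Gv⟩ into ⟨∇𝒥, v⟩.
  · have hJ : fderiv ℝ P.J u = (fderiv ℝ P.totalCost (P.g u)).comp (fderiv ℝ P.g u) :=
      fderiv_comp (g := P.totalCost) (f := P.g) u (h.differentiable _) (hg.differentiable u)
    rw [add_assoc, e, h2, inner_gradient_left, inner_gradient_left, hJ,
      ContinuousLinearMap.comp_apply]

/-- Any run of the algorithm serves as the minimizing sequence; here it starts at the zero command.
-/
theorem Jstar_eq : P.Jstar = ⨅ y, P.totalCost y := by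
  have := nontrivial_seq hτ hnx
  exact iInf_comp_eq (φ := P.totalCost) (g := P.g) (c := c) (hP.regularCost hnx hτ) hP.regularMap hP.Lg_pos
    (u := P.iterate c 0) fun n => ⟨_, rfl, (hP.lqr_spec hnx hτ _).2⟩

theorem gap_nonneg (u : Seq τ nu) : 0 ≤ P.J u - P.Jstar := by
  rw [hP.Jstar_eq hnx hτ]
  exact sub_nonneg.2 (ciInf_le (hP.regularCost hnx hτ).bddBelow _)

theorem gap_antitone (u₀ : Seq τ nu) : Antitone fun n => P.J (P.iterate c u₀ n) - P.Jstar := by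
  have := nontrivial_seq hτ hnx
  refine antitone_nat_of_succ_le fun n => sub_le_sub_right ?_ _
  have h1 := (hP.lqr_spec hnx hτ (P.iterate c u₀ n)).2
  have h2 := h1.antitone (hP.regularCost hnx hτ) hP.regularMap hP.Lg_pos
  exact h2

theorem gap_rate (u₀ : Seq τ nu) (n : ℕ) (hn : 0 < P.J (P.iterate c u₀ n) - P.Jstar) :
    P.J (P.iterate c u₀ n) - P.Jstar ≤ c.rate (P.J (P.iterate c u₀ n) - P.Jstar)
      * ((P.J (P.iterate c u₀ n) - P.Jstar) - (P.J (P.iterate c u₀ (n + 1)) - P.Jstar)) := by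
  have := nontrivial_seq hτ hnx
  have h := hP.regularCost hnx hτ
  have h1 := (hP.lqr_spec hnx hτ (P.iterate c u₀ n)).2
  refine h1.rate h hP.regularMap hP.Lg_pos ?_ hn
  rw [hP.Jstar_eq hnx hτ]
  exact h.sub_iInf_le _

/-- Compares both quantities with ‖∇h‖: μ_hλ² ≤ ‖∇h‖² ≤ 2L_h times the gap. The converse estimate
below uses ‖∇h‖² ≤ L_hλ² and the Polyak-Łojasiewicz inequality. -/
theorem newtonDecrement_sq_le (u : Seq τ nu) :
    P.newtonDecrement (P.g u) ^ 2 ≤ 2 * c.ρh * (P.J u - P.Jstar) := by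
  have := nontrivial_seq hτ hnx
  have h := hP.regularCost hnx hτ
  have h1 := h.sqrt_mul_newtonDec_le (P.g u)
  have h2 := h.norm_gradient_sq_le (fun y => ciInf_le h.bddBelow y) (P.g u)
  have h3 : (√c.μh * newtonDec P.totalCost (P.g u)) ^ 2 ≤ ‖gradient P.totalCost (P.g u)‖ ^ 2 := by
    have : 0 ≤ newtonDec P.totalCost (P.g u) := Real.sqrt_nonneg _
    gcongr
  have hμ := h.pos
  rw [mul_pow, Real.sq_sqrt hμ.le] at h3
  rw [hP.Jstar_eq hnx hτ, Constants.ρh]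
  change newtonDec P.totalCost (P.g u) ^ 2 ≤ 2 * (c.Lh / c.μh) * (P.totalCost (P.g u) - _)
  rw [mul_div_assoc', div_mul_eq_mul_div, le_div_iff₀ hμ]
  linarith

theorem gap_le_newtonDecrement_sq (u : Seq τ nu) :
    P.J u - P.Jstar ≤ c.ρh / 2 * P.newtonDecrement (P.g u) ^ 2 := by
  have := nontrivial_seq hτ hnx
  have h := hP.regularCost hnx hτ
  have h1 := h.norm_gradient_le_newtonDec (P.g u)
  have h2 := h.sub_iInf_le (P.g u)
  have hμ := h.pos
  have hL := hμ.trans_le h.μ_le_L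
  rw [hP.Jstar_eq hnx hτ, Constants.ρh]
  refine h2.trans ?_
  calc ‖gradient P.totalCost (P.g u)‖ ^ 2 / (2 * c.μh)
      ≤ (√c.Lh * newtonDec P.totalCost (P.g u)) ^ 2 / (2 * c.μh) := by gcongr
    _ = _ := by
      rw [mul_pow, Real.sq_sqrt hL.le, div_div, mul_comm c.μh, div_mul_eq_mul_div]; rfl

theorem newtonDecrement_iterate_le (u₀ : Seq τ nu) (n : ℕ)
    (hn : P.newtonDecrement (P.g (P.iterate c u₀ n)) ≤ c.decrementBar) :
    P.newtonDecrement (P.g (P.iterate c u₀ (n + 1)))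
      ≤ 4 * c.quadConst * P.newtonDecrement (P.g (P.iterate c u₀ n)) ^ 2 := by
  have := nontrivial_seq hτ hnx
  have h1 := (hP.lqr_spec hnx hτ (P.iterate c u₀ n)).2
  exact h1.newtonDec_le (hP.regularCost hnx hτ) hP.regularMap hP.Lg_pos hn

end Admissible

/-- Sufficient decrease and iteration complexity of the algorithm. -/
theorem iteration_complexity (c : Constants) : ∃ C ε₀ : ℝ, 0 < ε₀ ∧
    ∀ (nx nu τ : ℕ) (P : ControlProblem nx nu τ), 0 < nx → 0 < τ → P.Admissible c →
      (∀ u, P.IsLQRSolution (P.reg c u) u (P.lqr (P.reg c u) u) ∧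
        P.SufficientDecrease (P.reg c u) u) ∧
      ∀ u₀ : Seq τ nu,
        (∀ ε : ℝ, 0 < ε → ε ≤ ε₀ → ∃ k : ℕ,
          (k : ℝ) ≤ max 0 (c.phaseBound (P.J u₀ - P.Jstar))
            + C * Real.log (Real.log (1 / ε)) ∧
          ∀ n, k ≤ n → P.J (P.iterate c u₀ n) - P.Jstar ≤ ε) ∧
        (∀ n : ℕ, c.phaseBound (P.J u₀ - P.Jstar) ≤ n →
          P.J (P.iterate c u₀ n) - P.Jstar ≤ c.gapBar) ∧
        (∀ n : ℕ, P.J (P.iterate c u₀ n) - P.Jstar ≤ c.gapBar →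
          P.newtonDecrement (P.g (P.iterate c u₀ n)) ≤ c.decrementBar ∧
          P.newtonDecrement (P.g (P.iterate c u₀ (n + 1)))
            ≤ c.decrementBar⁻¹ * P.newtonDecrement (P.g (P.iterate c u₀ n)) ^ 2) := by
  by_cases hc : c.Proper
  swap
  · exact ⟨0, 1, one_pos, fun nx nu τ P hnx hτ hP => absurd (hP.proper hnx hτ) hc⟩
  obtain ⟨C, ε₀, hε₀, key⟩ := hc.exists_iteration_bound
  refine ⟨C, ε₀, hε₀, fun nx nu τ P hnx hτ hP => ⟨fun u =>
    ⟨(hP.lqr_spec hnx hτ u).1, hP.sufficientDecrease hnx hτ u⟩, fun u₀ => ⟨?_, ?_, ?_⟩⟩⟩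
  · exact key (fun n => P.J (P.iterate c u₀ n) - P.Jstar)
      (fun n => P.newtonDecrement (P.g (P.iterate c u₀ n))) (fun n => hP.gap_nonneg hnx hτ _)
      (hP.gap_antitone hnx hτ u₀) (hP.gap_rate hnx hτ u₀) (fun n => Real.sqrt_nonneg _)
      (fun n => hP.newtonDecrement_sq_le hnx hτ _)
      (fun n => hP.gap_le_newtonDecrement_sq hnx hτ _)
      (hP.newtonDecrement_iterate_le hnx hτ u₀)
  · intro n hn
    exact hc.gap_le_of_potential (δ := fun n => P.J (P.iterate c u₀ n) - P.Jstar)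
      (fun n => hP.gap_nonneg hnx hτ _) (hP.gap_antitone hnx hτ u₀) (hP.gap_rate hnx hτ u₀)
      hc.gapBar_pos fun hpos => hc.phaseBound_eq hpos ▸ hn
  · intro n hn
    have h1 : P.newtonDecrement (P.g (P.iterate c u₀ n)) ≤ c.decrementBar := by
      simpa using hc.sqrt_gap one_pos (hP.newtonDecrement_sq_le hnx hτ (P.iterate c u₀ n))
        (by simpa using hn)
    refine ⟨h1, ?_⟩
    have h2 := hP.newtonDecrement_iterate_le hnx hτ u₀ n h1
    rwa [Constants.decrementBar, one_div, inv_inv]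

end ControlProblem

end ILQR

namespace ILQR

open ContinuousLinearMap (adjoint adjoint_inner_left adjoint_inner_right)

/-! ### Linear recursions -/

/-- The `ℓ²` bound on the solution of a scalar linear recursion. -/
theorem sum_sq_recursion_le {a : ℝ} (ha : 0 ≤ a) {τ : ℕ} {e : ℕ → ℝ} {d : Fin τ → ℝ}
    (h0 : e 0 = 0) (he : ∀ t, 0 ≤ e t) (hd : ∀ t, 0 ≤ d t)
    (h : ∀ t : Fin τ, e (t + 1) ≤ a * e t + d t) :
    ∑ t : Fin τ, e (t + 1) ^ 2 ≤ (∑ t ∈ Finset.range τ, a ^ t) ^ 2 * ∑ t, d t ^ 2 := by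
  let d' : ℕ → ℝ := fun t => if ht : t < τ then d ⟨t, ht⟩ else 0
  have hd' : ∀ t : Fin τ, d t = d' t := fun t => by simp [d']
  have hd0 : ∀ t, 0 ≤ d' t := fun t => by
    by_cases ht : t < τ <;> simp [d', ht, hd]
  let S : ℕ → ℝ := fun n => ∑ t ∈ Finset.range n, a ^ t
  let D : ℕ → ℝ := fun n => ∑ t ∈ Finset.range n, d' t ^ 2
  -- Schur test for convolution with a^t: q_n = ∑ a^(n-1-t) d_t². Cauchy-Schwarz with these weights
  -- gives e_n² ≤ S_n q_n, and summing q costs another factor S.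
  let q : ℕ → ℝ := fun n => Nat.rec 0 (fun t x => a * x + d' t ^ 2) n
  have hq : ∀ n, q (n + 1) = a * q n + d' n ^ 2 := fun n => rfl
  have hS0 : ∀ n, 0 ≤ S n := fun n => Finset.sum_nonneg fun t _ => pow_nonneg ha t
  have hS : ∀ n, S (n + 1) = a * S n + 1 := fun n => by
    simp only [S]
    rw [Finset.sum_range_succ', Finset.mul_sum]
    simp only [pow_succ', pow_zero]
  have hD0 : ∀ n, 0 ≤ D n := fun n => Finset.sum_nonneg fun t _ => sq_nonneg _
  have hq0 : ∀ n, 0 ≤ q n := by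
    intro n
    induction n with
    | zero => exact le_rfl
    | succ n ih => rw [hq]; positivity
  have h1 : ∀ n ≤ τ, e n ^ 2 ≤ S n * q n := by
    intro n hn
    induction n with
    | zero => simp [h0, S]
    | succ n ih =>
      have ih := ih (Nat.le_of_succ_le hn)
      have h2 : e (n + 1) ≤ a * e n + d' n := hd' ⟨n, hn⟩ ▸ h ⟨n, hn⟩
      have h3 : 2 * (e n * d' n) ≤ S n * d' n ^ 2 + q n := by
        refine le_of_sq_le_sq ?_ (by have := hS0 n; have := hq0 n; positivity)
        nlinarith [sq_nonneg (S n * d' n ^ 2 - q n), mul_le_mul_of_nonneg_right ih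
          (sq_nonneg (d' n))]
      rw [hS, hq]
      calc e (n + 1) ^ 2 ≤ (a * e n + d' n) ^ 2 := by have := he (n + 1); gcongr
        _ ≤ _ := by
          nlinarith [mul_le_mul_of_nonneg_left h3 ha, mul_le_mul_of_nonneg_left ih (sq_nonneg a)]
  have h2 : ∀ n, ∑ t ∈ Finset.range n, q (t + 1) ≤ S n * D n := by
    intro n
    induction n with
    | zero => simp [S, D]
    | succ n ih =>
      have e1 : ∑ t ∈ Finset.range (n + 1), q (t + 1)
          = a * ∑ t ∈ Finset.range n, q (t + 1) + D (n + 1) := by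
        simp only [hq _, D]
        rw [Finset.sum_add_distrib, ← Finset.mul_sum, Finset.sum_range_succ']
        simp [hq, q]
      have e2 : D n ≤ D (n + 1) := by
        simp only [D]; rw [Finset.sum_range_succ]; nlinarith [sq_nonneg (d' n)]
      rw [e1, hS]
      nlinarith [mul_le_mul_of_nonneg_left ih ha,
        mul_le_mul_of_nonneg_left e2 (mul_nonneg ha (hS0 n))]
  have hmono : Monotone S := monotone_nat_of_le_succ fun n => by
    simp only [S]; rw [Finset.sum_range_succ]; nlinarith [pow_nonneg ha n]
  calc ∑ t : Fin τ, e (t + 1) ^ 2 ≤ ∑ t : Fin τ, S τ * q (t + 1) :=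
        Finset.sum_le_sum fun t _ => (h1 (t + 1) t.2).trans
          (mul_le_mul_of_nonneg_right (hmono t.2) (hq0 (t + 1)))
    _ = S τ * ∑ t ∈ Finset.range τ, q (t + 1) := by
      rw [← Finset.mul_sum, Fin.sum_univ_eq_sum_range (fun t => q (t + 1))]
    _ ≤ S τ * (S τ * D τ) := mul_le_mul_of_nonneg_left (h2 τ) (hS0 τ)
    _ = _ := by
      simp_rw [hd', D]
      rw [Fin.sum_univ_eq_sum_range (fun t => d' t ^ 2)]
      simp only [S]
      ring

/-- The forcing terms contain the states at times 0, …, τ-1, whereas g records times 1, …, τ. -/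
theorem sum_sq_shift_le {τ : ℕ} {e : ℕ → ℝ} (h0 : e 0 = 0) :
    ∑ t : Fin τ, e t ^ 2 ≤ ∑ t : Fin τ, e (t + 1) ^ 2 := by
  rw [Fin.sum_univ_eq_sum_range (fun t => e t ^ 2),
    Fin.sum_univ_eq_sum_range (fun t => e (t + 1) ^ 2)]
  have h1 := Finset.sum_range_succ (fun t => e t ^ 2) τ
  have h2 := Finset.sum_range_succ' (fun t => e t ^ 2) τ
  simp only [h0] at h2
  nlinarith [sq_nonneg (e τ)]

theorem sum_mul_le_of_sum_sq_le {ι : Type*} [Fintype ι] {a b : ι → ℝ} {A B : ℝ} (hA : 0 ≤ A)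
    (hB : 0 ≤ B) (ha : ∑ i, a i ^ 2 ≤ A ^ 2) (hb : ∑ i, b i ^ 2 ≤ B ^ 2) :
    ∑ i, a i * b i ≤ A * B := by
  refine le_of_sq_le_sq ?_ (by positivity)
  refine (Finset.sum_mul_sq_le_sq_mul_sq _ _ _).trans ?_
  rw [mul_pow]
  exact mul_le_mul ha hb (Finset.sum_nonneg fun i _ => sq_nonneg _) (sq_nonneg _)

/-- Bounded right inverses of operators with surjectivity constant `σ`. -/
theorem exists_preimage_le {U E : Type*} [NormedAddCommGroup U] [InnerProductSpace ℝ U]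
    [CompleteSpace U] [NormedAddCommGroup E] [InnerProductSpace ℝ E] [CompleteSpace E]
    [FiniteDimensional ℝ E] {B : U →L[ℝ] E} {σ : ℝ} (hσ : 0 < σ)
    (hB : ∀ l, σ * ‖l‖ ≤ ‖adjoint B l‖) (r : E) : ∃ v, B v = r ∧ σ * ‖v‖ ≤ ‖r‖ := by
  have hinj : Function.Injective (B.comp (adjoint B)).toLinearMap := by
    refine (injective_iff_map_eq_zero _).2 fun l hl => ?_
    have h1 : B (adjoint B l) = 0 := hl
    have h2 : ‖adjoint B l‖ ^ 2 = 0 := by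
      rw [← real_inner_self_eq_norm_sq, adjoint_inner_left, h1, inner_zero_right]
    have h3 := hB l
    rw [pow_eq_zero_iff two_ne_zero] at h2
    rw [h2] at h3
    exact norm_eq_zero.1 (le_antisymm (by nlinarith) (norm_nonneg l))
  -- The preimage is Bᵀ(BBᵀ)⁻¹r.
  obtain ⟨l, hl⟩ := (LinearMap.injective_iff_surjective.1 hinj) r
  have hl : B (adjoint B l) = r := hl
  refine ⟨adjoint B l, hl, ?_⟩
  have h2 : ‖adjoint B l‖ ^ 2 ≤ ‖l‖ * ‖r‖ := by
    rw [← real_inner_self_eq_norm_sq, adjoint_inner_left, hl]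
    exact real_inner_le_norm _ _
  have h3 := hB l
  rcases (norm_nonneg (adjoint B l)).eq_or_lt with h0 | h0
  · rw [← h0, mul_zero]; exact norm_nonneg r
  · refine le_of_mul_le_mul_right ?_ h0
    nlinarith [norm_nonneg r]

/-! ### Constants of the control in τ steps. -/

namespace ControlProblem

variable {nx nu τ : ℕ} {P : ControlProblem nx nu τ} {lx lu Lxx Lxu Luu σf : ℝ}

/-- L_xu bounds the variation of ∇ᵤf in x; by the mean value inequality it bounds the mixed second
difference of f, hence also the variation of ∇ₓf in u. This explains the coefficient 2L_xu in L_g.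
-/
theorem DynamicsConstants.norm_Dx_sub_le (hc : P.DynamicsConstants lx lu Lxx Lxu Luu)
    (hf : Differentiable ℝ P.f) (hLxu : 0 ≤ Lxu) (x : Vec nx) (u u' : Vec nu) :
    ‖P.Dx x u - P.Dx x u'‖ ≤ Lxu * ‖u - u'‖ := by
  have h1 : ∀ z z' : Vec nx, ‖(P.f (z, u) - P.f (z, u')) - (P.f (z', u) - P.f (z', u'))‖
      ≤ Lxu * ‖u - u'‖ * ‖z - z'‖ := by
    intro z z'
    have hd : ∀ w, HasFDerivAt (fun w => P.f (z, w) - P.f (z', w)) (P.Du z w - P.Du z' w) w :=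
      fun w => (hasFDerivAt_u hf z w).sub (hasFDerivAt_u hf z' w)
    have := convex_univ.norm_image_sub_le_of_norm_hasFDerivWithin_le
      (f := fun w => P.f (z, w) - P.f (z', w)) (fun w _ => (hd w).hasFDerivWithinAt)
      (fun w _ => hc.lip_xu w z z') (Set.mem_univ u') (Set.mem_univ u)
    rw [show P.f (z, u) - P.f (z, u') - (P.f (z', u) - P.f (z', u'))
      = P.f (z, u) - P.f (z', u) - (P.f (z, u') - P.f (z', u')) by abel]
    refine this.trans (le_of_eq (by ring))
  have h2 : LipschitzWith ⟨Lxu * ‖u - u'‖, by positivity⟩ fun z => P.f (z, u) - P.f (z, u') :=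
    LipschitzWith.of_dist_le_mul fun z z' => by rw [dist_eq_norm, dist_eq_norm]; exact h1 z z'
  exact ((hasFDerivAt_x hf x u).sub (hasFDerivAt_x hf x u')).le_of_lipschitz h2

theorem DynamicsConstants.norm_Dx_le (hc : P.DynamicsConstants lx lu Lxx Lxu Luu)
    (hf : Differentiable ℝ P.f) (hlx : 0 ≤ lx) (x : Vec nx) (u : Vec nu) : ‖P.Dx x u‖ ≤ lx :=
  (hasFDerivAt_x hf x u).le_of_lipschitz (C := ⟨lx, hlx⟩) (LipschitzWith.of_dist_le_mul
    fun z z' => by rw [dist_eq_norm, dist_eq_norm]; exact hc.lip_x u z z')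

theorem DynamicsConstants.g_lipschitz (hc : P.DynamicsConstants lx lu Lxx Lxu Luu)
    (hlx : 0 ≤ lx) (hlu : 0 ≤ lu) (u v : Seq τ nu) :
    ‖P.g u - P.g v‖ ≤ (lu * ∑ t ∈ Finset.range τ, lx ^ t) * ‖u - v‖ := by
  set S := ∑ t ∈ Finset.range τ, lx ^ t
  have hS0 : 0 ≤ S := Finset.sum_nonneg fun t _ => pow_nonneg hlx t
  refine le_of_sq_le_sq ?_ (by positivity)
  have h1 := sum_sq_recursion_le hlx (e := fun t => ‖P.state u t - P.state v t‖)
    (d := fun t : Fin τ => lu * ‖u t - v t‖) (by simp [state]) (fun t => norm_nonneg _)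
    (fun t => by positivity) (fun t => by
      simp only [state, t.2, dite_true]
      calc _ = ‖(P.f (P.state u t, u t) - P.f (P.state v t, u t))
            + (P.f (P.state v t, u t) - P.f (P.state v t, v t))‖ := by simp
        _ ≤ _ := (norm_add_le _ _).trans (add_le_add (hc.lip_x _ _ _) (hc.lip_u _ _ _)))
  rw [PiLp.norm_sq_eq_of_L2]
  refine h1.trans (le_of_eq ?_)
  simp only [mul_pow]
  rw [← Finset.mul_sum, PiLp.norm_sq_eq_of_L2]
  simp only [PiLp.sub_apply]
  ring

/-- Lipschitz continuity of the linearization of the control in `τ` steps, in terms of a Lipschitz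
constant `l` of the control in `τ` steps. -/
theorem DynamicsConstants.fderiv_g_lipschitz (hc : P.DynamicsConstants lx lu Lxx Lxu Luu)
    (hf : Differentiable ℝ P.f) (hlx : 0 ≤ lx) (hLxx : 0 ≤ Lxx) (hLxu : 0 ≤ Lxu) (hLuu : 0 ≤ Luu)
    {l : ℝ} (hl0 : 0 ≤ l) (hlip : ∀ u v, ‖P.g u - P.g v‖ ≤ l * ‖u - v‖)
    (hDg : ∀ u, ‖fderiv ℝ P.g u‖ ≤ l) (u v : Seq τ nu) :
    ‖fderiv ℝ P.g u - fderiv ℝ P.g v‖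
      ≤ (∑ t ∈ Finset.range τ, lx ^ t) * (Lxx * l ^ 2 + 2 * Lxu * l + Luu) * ‖u - v‖ := by
  have hDx := hc.norm_Dx_le hf hlx
  set S := ∑ t ∈ Finset.range τ, lx ^ t
  have hS0 : 0 ≤ S := Finset.sum_nonneg fun t _ => pow_nonneg hlx t
  refine ContinuousLinearMap.opNorm_le_bound _ (by positivity) fun w => ?_
  let X : ℕ → ℝ := fun t => ‖P.state u t - P.state v t‖
  let Y : ℕ → ℝ := fun t => ‖P.linState v w t‖
  -- Forcing term in the recursion for the difference of the linearized states: the change of the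
  -- Jacobians applied to the state and control of the linearization at v.
  let d : Fin τ → ℝ := fun t =>
    Lxx * (X t * Y t) + Lxu * (‖u t - v t‖ * Y t) + Lxu * (X t * ‖w t‖)
      + Luu * (‖u t - v t‖ * ‖w t‖)
  have hd0 : ∀ t, 0 ≤ d t := fun t => by
    simp only [d, X, Y]; positivity
  have h1 := sum_sq_recursion_le hlx (e := fun t => ‖P.linState u w t - P.linState v w t‖)
    (d := d) (by simp [linState]) (fun t => norm_nonneg _) hd0 (fun t => by
      simp only [linState, t.2, dite_true]
      set x := P.state u t
      set x' := P.state v t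
      have e1 : ‖P.Dx x (u t) - P.Dx x' (v t)‖ ≤ Lxx * X t + Lxu * ‖u t - v t‖ := by
        calc _ = ‖(P.Dx x (u t) - P.Dx x' (u t)) + (P.Dx x' (u t) - P.Dx x' (v t))‖ := by simp
          _ ≤ _ := (norm_add_le _ _).trans
            (add_le_add (hc.lip_xx _ _ _) (hc.norm_Dx_sub_le hf hLxu _ _ _))
      have e2 : ‖P.Du x (u t) - P.Du x' (v t)‖ ≤ Lxu * X t + Luu * ‖u t - v t‖ := by
        calc _ = ‖(P.Du x (u t) - P.Du x' (u t)) + (P.Du x' (u t) - P.Du x' (v t))‖ := by simp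
          _ ≤ _ := (norm_add_le _ _).trans (add_le_add (hc.lip_xu _ _ _) (hc.lip_uu _ _ _))
      set y := P.linState u w t
      set y' := P.linState v w t
      have e3 : P.Dx x (u t) y + P.Du x (u t) (w t) - (P.Dx x' (v t) y' + P.Du x' (v t) (w t))
          = P.Dx x (u t) (y - y') + ((P.Dx x (u t) - P.Dx x' (v t)) y'
            + (P.Du x (u t) - P.Du x' (v t)) (w t)) := by
        simp only [map_sub, sub_apply]; abel
      have f1 := (P.Dx x (u t)).le_of_opNorm_le (hDx x (u t)) (y - y')
      have f2 := (P.Dx x (u t) - P.Dx x' (v t)).le_of_opNorm_le e1 y'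
      have f3 := (P.Du x (u t) - P.Du x' (v t)).le_of_opNorm_le e2 (w t)
      have f4 := norm_add_le (P.Dx x (u t) (y - y')) ((P.Dx x (u t) - P.Dx x' (v t)) y'
            + (P.Du x (u t) - P.Du x' (v t)) (w t))
      have f5 := norm_add_le ((P.Dx x (u t) - P.Dx x' (v t)) y')
        ((P.Du x (u t) - P.Du x' (v t)) (w t))
      change ‖P.Dx x (u t) y + P.Du x (u t) (w t)
        - (P.Dx x' (v t) y' + P.Du x' (v t) (w t))‖ ≤ lx * ‖y - y'‖ + d t
      rw [e3]
      have f6 : d t = (Lxx * X t + Lxu * ‖u t - v t‖) * ‖y'‖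
          + (Lxu * X t + Luu * ‖u t - v t‖) * ‖w t‖ := by
        simp only [d, Y]; ring
      rw [f6]
      linarith)
  have hXs : ∑ t : Fin τ, X t ^ 2 ≤ (l * ‖u - v‖) ^ 2 := by
    refine (sum_sq_shift_le (e := X) (by simp [X, state])).trans ?_
    have e1 : ∑ t : Fin τ, X (t + 1) ^ 2 = ‖P.g u - P.g v‖ ^ 2 := by
      rw [PiLp.norm_sq_eq_of_L2]; rfl
    rw [e1]
    have := hlip u v
    gcongr
  have hYs : ∑ t : Fin τ, Y t ^ 2 ≤ (l * ‖w‖) ^ 2 := by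
    refine (sum_sq_shift_le (e := Y) (by simp [Y, linState])).trans ?_
    have e1 : ∑ t : Fin τ, Y (t + 1) ^ 2 = ‖fderiv ℝ P.g v w‖ ^ 2 := by
      rw [PiLp.norm_sq_eq_of_L2]
      simp only [fderiv_g_apply hf, Y]
    rw [e1]
    have := (fderiv ℝ P.g v).le_of_opNorm_le (hDg v) w
    gcongr
  have hUs : ∑ t : Fin τ, ‖u t - v t‖ ^ 2 ≤ ‖u - v‖ ^ 2 := by
    rw [PiLp.norm_sq_eq_of_L2]; rfl
  have hWs : ∑ t : Fin τ, ‖w t‖ ^ 2 ≤ ‖w‖ ^ 2 := by rw [PiLp.norm_sq_eq_of_L2]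
  have hds : ∑ t, d t ≤ (Lxx * l ^ 2 + 2 * Lxu * l + Luu) * (‖u - v‖ * ‖w‖) := by
    simp only [d, Finset.sum_add_distrib, ← Finset.mul_sum]
    have k1 := sum_mul_le_of_sum_sq_le (by positivity) (by positivity) hXs hYs
    have k2 := sum_mul_le_of_sum_sq_le (by positivity) (by positivity) hUs hYs
    have k3 := sum_mul_le_of_sum_sq_le (by positivity) (by positivity) hXs hWs
    have k4 := sum_mul_le_of_sum_sq_le (by positivity) (by positivity) hUs hWs
    linarith [mul_le_mul_of_nonneg_left k1 hLxx, mul_le_mul_of_nonneg_left k2 hLxu,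
      mul_le_mul_of_nonneg_left k3 hLxu, mul_le_mul_of_nonneg_left k4 hLuu]
  -- Each d_t is a sum of products of two ℓ² quantities: Cauchy-Schwarz bounds its ℓ¹ norm, which
  -- dominates its ℓ² norm.
  have hds2 : ∑ t, d t ^ 2 ≤ (∑ t, d t) ^ 2 :=
    Finset.sum_sq_le_sq_sum_of_nonneg fun t _ => hd0 t
  refine le_of_sq_le_sq ?_ (by positivity)
  rw [PiLp.norm_sq_eq_of_L2]
  have e1 : ∀ t : Fin τ, ((fderiv ℝ P.g u - fderiv ℝ P.g v) w) t
      = P.linState u w (t + 1) - P.linState v w (t + 1) := fun t => by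
    rw [sub_apply, PiLp.sub_apply, fderiv_g_apply hf, fderiv_g_apply hf]
  simp only [e1]
  refine h1.trans ?_
  have hsum0 : 0 ≤ ∑ t, d t := Finset.sum_nonneg fun t _ => hd0 t
  calc _ ≤ S ^ 2 * ((Lxx * l ^ 2 + 2 * Lxu * l + Luu) * (‖u - v‖ * ‖w‖)) ^ 2 := by
        refine mul_le_mul_of_nonneg_left (hds2.trans ?_) (sq_nonneg S)
        gcongr
    _ = _ := by ring

/-- Any trajectory can be followed, by solving B_t v_t = m_{t+1} - A_t m_t stage by stage. These
controls have norm at most (1 + l_x)/σ_f times ‖m‖, whatever τ, and ‖m‖² = ⟨Gᵀm, V⟩ transfers the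
bound to the adjoint. -/
theorem DynamicsConstants.fderiv_g_surjective (hc : P.DynamicsConstants lx lu Lxx Lxu Luu)
    (hf : Differentiable ℝ P.f) (hlx : 0 ≤ lx) (hσ : P.SurjectiveDynamics σf) (u : Seq τ nu)
    (m : Seq τ nx) : σf / (1 + lx) * ‖m‖ ≤ ‖adjoint (fderiv ℝ P.g u) m‖ := by
  have hDx := hc.norm_Dx_le hf hlx
  set σ := σf / (1 + lx) with hσd
  have hσ0 : 0 < σ := div_pos hσ.1 (by positivity)
  -- The target indexed by time: it is zero at time 0, and component t of m is the state at time t +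
  -- 1.
  let z : ℕ → Vec nx := fun t => Nat.casesOn t 0 fun t => if ht : t < τ then m ⟨t, ht⟩ else 0
  have hz : ∀ t : Fin τ, z (t + 1) = m t := fun t => by simp [z]
  choose v hv hv' using fun t : Fin τ => exists_preimage_le hσ.1
    (hσ.2 (P.state u t) (u t)) (z (t + 1) - P.Dx (P.state u t) (u t) (z t))
  let V : Seq τ nu := WithLp.toLp 2 v
  have h1 : ∀ t ≤ τ, P.linState u V t = z t := by
    intro t ht
    induction t with
    | zero => rfl
    | succ t ih =>
      have ht' : t < τ := ht
      have h2 := hv ⟨t, ht'⟩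
      simp only at h2
      simp only [linState, ht', dite_true]
      rw [ih ht'.le, h2]
      abel
  have h2 : fderiv ℝ P.g u V = m := by
    ext1 t
    rw [fderiv_g_apply hf, h1 _ t.2, hz]
  have h3 : σ * ‖V‖ ≤ ‖m‖ := by
    have e1 : σf * ‖V‖ ≤ (1 + lx) * ‖m‖ := by
      have := hσ.1
      refine le_of_sq_le_sq ?_ (by positivity)
      rw [mul_pow, mul_pow, PiLp.norm_sq_eq_of_L2, Finset.mul_sum]
      -- Convexity of the square, (a + l_x b)² ≤ (1 + l_x)(a² + l_x b²), so that summation gives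
      -- exactly (1 + l_x)².
      have k1 : ∀ t : Fin τ, σf ^ 2 * ‖V t‖ ^ 2
          ≤ (1 + lx) * ‖z (t + 1)‖ ^ 2 + (1 + lx) * lx * ‖z t‖ ^ 2 := by
        intro t
        have f1 : ‖P.Dx (P.state u t) (u t) (z t)‖ ≤ lx * ‖z t‖ :=
          (P.Dx (P.state u t) (u t)).le_of_opNorm_le (hDx _ _) _
        have f2 : σf * ‖V t‖ ≤ ‖z (t + 1)‖ + lx * ‖z t‖ :=
          (hv' t).trans ((norm_sub_le _ _).trans (by gcongr))
        have f3 : (σf * ‖V t‖) ^ 2 ≤ (‖z (t + 1)‖ + lx * ‖z t‖) ^ 2 := by gcongr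
        nlinarith [mul_nonneg hlx (sq_nonneg (‖z (t + 1)‖ - ‖z t‖))]
      refine (Finset.sum_le_sum fun t _ => k1 t).trans ?_
      rw [Finset.sum_add_distrib, ← Finset.mul_sum, ← Finset.mul_sum]
      have k2 : ∑ t : Fin τ, ‖z (t + 1)‖ ^ 2 = ‖m‖ ^ 2 := by
        rw [PiLp.norm_sq_eq_of_L2]; simp only [hz]
      have k3 : ∑ t : Fin τ, ‖z t‖ ^ 2 ≤ ‖m‖ ^ 2 :=
        k2 ▸ sum_sq_shift_le (e := fun t => ‖z t‖) (by simp [z])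
      rw [k2]
      nlinarith [mul_le_mul_of_nonneg_left k3 (show 0 ≤ (1 + lx) * lx by positivity)]
    rw [hσd, div_mul_eq_mul_div, div_le_iff₀ (by positivity)]
    linarith
  have h4 : ‖m‖ ^ 2 ≤ ‖adjoint (fderiv ℝ P.g u) m‖ * ‖V‖ := by
    rw [← real_inner_self_eq_norm_sq]
    nth_rewrite 2 [← h2]
    rw [← adjoint_inner_left]
    exact real_inner_le_norm _ _
  rcases (norm_nonneg m).eq_or_lt with h0 | h0
  · rw [← h0, mul_zero]; exact norm_nonneg _
  · refine le_of_mul_le_mul_right ?_ h0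
    nlinarith [norm_nonneg (adjoint (fderiv ℝ P.g u) m)]

/-- The control in `τ` steps inherits explicit constants from the dynamics. -/
theorem trajectoryConstants (hnx : 0 < nx) (hP : P.RegularDynamics)
    (hc : P.DynamicsConstants lx lu Lxx Lxu Luu) (hσ : P.SurjectiveDynamics σf) :
    P.TrajectoryConstants
      (lu * ∑ t ∈ Finset.range τ, lx ^ t)
      ((∑ t ∈ Finset.range τ, lx ^ t) *
        (Lxx * (lu * ∑ t ∈ Finset.range τ, lx ^ t) ^ 2
          + 2 * Lxu * (lu * ∑ t ∈ Finset.range τ, lx ^ t) + Luu))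
      (σf / (1 + lx)) := by
  have hf := hP.differentiable
  have : Nonempty (Fin nx) := ⟨⟨0, hnx⟩⟩
  obtain ⟨a, b, hab⟩ := exists_pair_ne (Vec nx)
  have hab' : 0 < ‖a - b‖ := norm_pos_iff.2 (sub_ne_zero.2 hab)
  -- The constants are not assumed nonnegative: this follows on nontrivial spaces, and surjectivity
  -- forces n_u > 0.
  have : Nontrivial (Vec nu) := by
    obtain ⟨m, hm⟩ := exists_ne (0 : Vec nx)
    refine ⟨adjoint (P.Du 0 0) m, 0, fun h0 => ?_⟩
    have h1 := hσ.2 0 0 m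
    rw [h0, norm_zero] at h1
    linarith [mul_pos hσ.1 (norm_pos_iff.2 hm)]
  obtain ⟨a', b', hab1⟩ := exists_pair_ne (Vec nu)
  have hab1' : 0 < ‖a' - b'‖ := norm_pos_iff.2 (sub_ne_zero.2 hab1)
  have hlx : 0 ≤ lx := nonneg_of_mul_nonneg_left ((norm_nonneg _).trans (hc.lip_x 0 a b)) hab'
  have hlu : 0 ≤ lu := nonneg_of_mul_nonneg_left ((norm_nonneg _).trans (hc.lip_u 0 a' b')) hab1'
  have hLxx : 0 ≤ Lxx := nonneg_of_mul_nonneg_left ((norm_nonneg _).trans (hc.lip_xx 0 a b)) hab'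
  have hLxu : 0 ≤ Lxu := nonneg_of_mul_nonneg_left ((norm_nonneg _).trans (hc.lip_xu 0 a b)) hab'
  have hLuu : 0 ≤ Luu :=
    nonneg_of_mul_nonneg_left ((norm_nonneg _).trans (hc.lip_uu 0 a' b')) hab1'
  have hl : 0 ≤ lu * ∑ t ∈ Finset.range τ, lx ^ t :=
    mul_nonneg hlu (Finset.sum_nonneg fun t _ => pow_nonneg hlx t)
  have hlip := hc.g_lipschitz (τ := τ) hlx hlu
  have hDg : ∀ u, ‖fderiv ℝ P.g u‖ ≤ lu * ∑ t ∈ Finset.range τ, lx ^ t := fun u =>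
    norm_fderiv_le_of_lipschitz ℝ (C := ⟨_, hl⟩) (LipschitzWith.of_dist_le_mul
      fun z z' => by rw [dist_eq_norm, dist_eq_norm]; exact hlip z z')
  exact ⟨hlip, hc.fderiv_g_lipschitz hf hlx hLxx hLxu hLuu hl hlip hDg,
    div_pos hσ.1 (by positivity), hc.fderiv_g_surjective hf hlx hσ⟩

end ControlProblem

end ILQR

namespace ILQR

open Matrix

/-! ### Inversion without pivoting -/

section Inversion

variable {n : ℕ}

/-- The matrix whose first `k` rows are those of `M` and whose other rows are those of the
identity. -/
def leadingRows (M : Matrix (Fin n) (Fin n) ℝ) (k : ℕ) : Matrix (Fin n) (Fin n) ℝ :=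
  Matrix.of fun i j => if (i : ℕ) < k then M i j else (1 : Matrix (Fin n) (Fin n) ℝ) i j

/-- Row `k` of `M - 1`. -/
def rowDiff (M : Matrix (Fin n) (Fin n) ℝ) (k : Fin n) : Fin n → ℝ := fun j =>
  M k j - (1 : Matrix (Fin n) (Fin n) ℝ) k j

/-- The rank one update of an inverse when row `k` of the identity is replaced by row `k`
of `M`. -/
def rankOneUpdate (M X : Matrix (Fin n) (Fin n) ℝ) (k : Fin n) : Matrix (Fin n) (Fin n) ℝ :=
  Matrix.of fun i j => X i j - X i k * (rowDiff M k ᵥ* X) j / (1 + (rowDiff M k ᵥ* X) k)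

/-- The inverses of the matrices `leadingRows M k`, computed by rank one updates. -/
def rowInverse (M : Matrix (Fin n) (Fin n) ℝ) : ℕ → Matrix (Fin n) (Fin n) ℝ
  | 0 => 1
  | k + 1 => if hk : k < n then rankOneUpdate M (rowInverse M k) ⟨k, hk⟩ else rowInverse M k

theorem leadingRows_succ (M : Matrix (Fin n) (Fin n) ℝ) {k : ℕ} (hk : k < n) :
    leadingRows M (k + 1)
      = leadingRows M k + vecMulVec (Pi.single ⟨k, hk⟩ 1) (rowDiff M ⟨k, hk⟩) := by
  ext i j
  simp only [leadingRows, of_apply, Matrix.add_apply, vecMulVec_apply, rowDiff, Pi.single_apply,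
    Fin.ext_iff]
  rcases lt_trichotomy (i : ℕ) k with h | h | h
  · simp [h, h.ne, Nat.lt_succ_of_lt h]
  · have : i = ⟨k, hk⟩ := Fin.ext h
    subst this
    simp
  · simp [h.ne', not_lt.2 h.le, not_lt.2 (Nat.succ_le_of_lt h)]

/-- On the kernel each term of zᵀMz vanishes: (Mz)_i = 0 for i < k and z_i = 0 otherwise. Positive
definiteness thus makes every intermediate matrix invertible, which is why no pivoting is needed. -/
theorem leadingRows_mulVec_injective {M : Matrix (Fin n) (Fin n) ℝ}
    (hM : ∀ z, z ≠ 0 → 0 < z ⬝ᵥ M *ᵥ z) {k : ℕ} {z : Fin n → ℝ} (hz : leadingRows M k *ᵥ z = 0) :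
    z = 0 := by
  by_contra h0
  refine (hM z h0).ne' (Finset.sum_eq_zero fun i _ => ?_)
  have h1 := congrFun hz i
  by_cases hi : (i : ℕ) < k
  · have h2 : (leadingRows M k *ᵥ z) i = (M *ᵥ z) i := by
      simp [leadingRows, mulVec, dotProduct, hi]
    rw [← h2, h1]
    simp
  · have h2 : (leadingRows M k *ᵥ z) i = z i := by
      simp [leadingRows, mulVec, dotProduct, hi, Matrix.one_apply]
    rw [← h2, h1]
    simp

/-- Sherman-Morrison formula, as consecutive matrices differ by a rank one term. -/
theorem leadingRows_mul_rowInverse {M : Matrix (Fin n) (Fin n) ℝ}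
    (hM : ∀ z, z ≠ 0 → 0 < z ⬝ᵥ M *ᵥ z) {k : ℕ} (hk : k ≤ n) :
    leadingRows M k * rowInverse M k = 1 := by
  induction k with
  | zero =>
    have : leadingRows M 0 = 1 := by ext i j; simp [leadingRows]
    rw [this, rowInverse, one_mul]
  | succ k ih =>
    have hk' : k < n := hk
    have ih := ih hk'.le
    rw [rowInverse, dif_pos hk']
    set X := rowInverse M k
    set e : Fin n → ℝ := Pi.single ⟨k, hk'⟩ 1
    set r := rowDiff M ⟨k, hk'⟩ with hr
    set w := r ᵥ* X with hw
    set s := 1 + w ⟨k, hk'⟩ with hs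
    have hwe : r ⬝ᵥ X *ᵥ e = w ⟨k, hk'⟩ := by
      rw [dotProduct_mulVec, ← hw]; simp [e]
    have hXe : leadingRows M (k + 1) *ᵥ (X *ᵥ e) = s • e := by
      rw [leadingRows_succ M hk', add_mulVec, mulVec_mulVec, ih, one_mulVec, vecMulVec_mulVec,
        ← hr, hwe, hs, add_smul, one_smul]
      simp [e]
    -- If the denominator vanished, the nonzero vector Xe would lie in the kernel of the next
    -- matrix.
    have hs0 : s ≠ 0 := by
      intro h0
      rw [h0, zero_smul] at hXe
      have h1 := leadingRows_mulVec_injective hM hXe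
      have h2 : leadingRows M k *ᵥ (X *ᵥ e) = e := by rw [mulVec_mulVec, ih, one_mulVec]
      rw [h1, mulVec_zero] at h2
      have := congrFun h2 ⟨k, hk'⟩
      simp [e] at this
    have hU : rankOneUpdate M X ⟨k, hk'⟩ = X - vecMulVec (X *ᵥ e) (s⁻¹ • w) := by
      ext i j
      have : (X *ᵥ e) i = X i ⟨k, hk'⟩ := by simp [e]
      rw [Matrix.sub_apply, vecMulVec_apply, this, rankOneUpdate, of_apply]
      change _ - _ * w j / s = _ - _ * (s⁻¹ * w j)
      ring
    rw [hU, mul_sub, mul_vecMulVec, hXe]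
    have h3 : vecMulVec (s • e) (s⁻¹ • w) = vecMulVec e w := by
      ext i j
      simp only [vecMulVec_apply, Pi.smul_apply, smul_eq_mul]
      field_simp
    rw [h3, leadingRows_succ M hk', add_mul, ih, vecMulVec_mul, ← hr, ← hw, add_sub_cancel_right]

/-- The inverse of a positive definite matrix, computed without pivoting. -/
def pdInverse (M : Matrix (Fin n) (Fin n) ℝ) : Matrix (Fin n) (Fin n) ℝ := rowInverse M n

theorem mul_pdInverse {M : Matrix (Fin n) (Fin n) ℝ} (hM : ∀ z, z ≠ 0 → 0 < z ⬝ᵥ M *ᵥ z) :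
    M * pdInverse M = 1 := by
  have := leadingRows_mul_rowInverse hM le_rfl
  rwa [show leadingRows M n = M by ext i j; simp [leadingRows]] at this

end Inversion

/-! ### The Riccati recursion -/

/-- The data of a linear quadratic control problem. -/
structure LQData (nx nu : ℕ) where
  A : ℕ → Matrix (Fin nx) (Fin nx) ℝ
  B : ℕ → Matrix (Fin nx) (Fin nu) ℝ
  H : ℕ → Matrix (Fin nx) (Fin nx) ℝ
  h : ℕ → Fin nx → ℝ
  ν : ℝ

namespace LQData

variable {nx nu : ℕ} (D : LQData nx nu) (τ : ℕ)

/-- The Hessian of the cost of a control at time `t` when the cost-to-go has Hessian `C`. -/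
def pivot (t : ℕ) (C : Matrix (Fin nx) (Fin nx) ℝ) : Matrix (Fin nu) (Fin nu) ℝ :=
  D.ν • (1 : Matrix (Fin nu) (Fin nu) ℝ) + (D.B t)ᵀ * (C * D.B t)

def gainMat (t : ℕ) (C : Matrix (Fin nx) (Fin nx) ℝ) : Matrix (Fin nu) (Fin nx) ℝ :=
  pdInverse (D.pivot t C) * ((D.B t)ᵀ * (C * D.A t))

def gainVec (t : ℕ) (C : Matrix (Fin nx) (Fin nx) ℝ) (c : Fin nx → ℝ) : Fin nu → ℝ :=
  pdInverse (D.pivot t C) *ᵥ ((D.B t)ᵀ *ᵥ c)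

/-- The Hessian of the cost-to-go at time `τ - j`. -/
def costMat : ℕ → Matrix (Fin nx) (Fin nx) ℝ
  | 0 => D.H τ
  | j + 1 => D.H (τ - 1 - j) + (D.A (τ - 1 - j))ᵀ * (costMat j * (D.A (τ - 1 - j)
      - D.B (τ - 1 - j) * D.gainMat (τ - 1 - j) (costMat j)))

/-- The gradient at zero of the cost-to-go at time `τ - j`. -/
def costVec : ℕ → Fin nx → ℝ
  | 0 => D.h τ
  | j + 1 => D.h (τ - 1 - j) + (D.A (τ - 1 - j))ᵀ *ᵥ (costVec j - D.costMat τ j *ᵥ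
      (D.B (τ - 1 - j) *ᵥ D.gainVec (τ - 1 - j) (D.costMat τ j) (costVec j)))

/-- The gains at time `τ - 1 - j`. -/
def feedback (j : ℕ) : Matrix (Fin nu) (Fin nx) ℝ := D.gainMat (τ - 1 - j) (D.costMat τ j)
def offset (j : ℕ) : Fin nu → ℝ := D.gainVec (τ - 1 - j) (D.costMat τ j) (D.costVec τ j)

/-- The control at time `t` in the state `y`. -/
def policy (t : ℕ) (y : Fin nx → ℝ) : Fin nu → ℝ :=
  -(D.feedback τ (τ - 1 - t) *ᵥ y + D.offset τ (τ - 1 - t))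

/-- The states of the optimal trajectory. -/
def traj : ℕ → Fin nx → ℝ
  | 0 => 0
  | t + 1 => D.A t *ᵥ traj t + D.B t *ᵥ D.policy τ t (traj t)

/-- The optimal controls. -/
def control (t : ℕ) : Fin nu → ℝ := D.policy τ t (D.traj τ t)

variable {D τ}

theorem pivot_pos (hν : 0 < D.ν) {C : Matrix (Fin nx) (Fin nx) ℝ} (hC : ∀ z, 0 ≤ z ⬝ᵥ C *ᵥ z)
    (t : ℕ) (z : Fin nu → ℝ) (hz : z ≠ 0) : 0 < z ⬝ᵥ D.pivot t C *ᵥ z := by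
  have h1 : z ⬝ᵥ D.pivot t C *ᵥ z = D.ν * (z ⬝ᵥ z) + (D.B t *ᵥ z) ⬝ᵥ C *ᵥ (D.B t *ᵥ z) := by
    rw [pivot, add_mulVec, dotProduct_add, smul_mulVec, one_mulVec, dotProduct_smul, smul_eq_mul,
      ← mulVec_mulVec, ← mulVec_mulVec, dotProduct_mulVec z, vecMul_transpose]
  have h2 : 0 < z ⬝ᵥ z := by
    refine lt_of_le_of_ne (Finset.sum_nonneg fun i _ => mul_self_nonneg _) fun h => hz ?_
    exact dotProduct_self_eq_zero.1 h.symm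
  rw [h1]
  have := hC (D.B t *ᵥ z)
  positivity

/-- The equation of the gain solved for its regularization term: it exhibits the closed-loop state
Ay - BKy, which both the positivity and the costate relations use. -/
theorem pivot_mulVec_gainMat (hν : 0 < D.ν) {C : Matrix (Fin nx) (Fin nx) ℝ}
    (hC : ∀ z, 0 ≤ z ⬝ᵥ C *ᵥ z) (t : ℕ) (y : Fin nx → ℝ) :
    D.ν • (D.gainMat t C *ᵥ y)
      = (D.B t)ᵀ *ᵥ (C *ᵥ (D.A t *ᵥ y - D.B t *ᵥ (D.gainMat t C *ᵥ y))) := by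
  have h1 : D.pivot t C *ᵥ (D.gainMat t C *ᵥ y) = (D.B t)ᵀ *ᵥ (C *ᵥ (D.A t *ᵥ y)) := by
    rw [gainMat, mulVec_mulVec, ← Matrix.mul_assoc, mul_pdInverse (pivot_pos hν hC t),
      Matrix.one_mul, ← mulVec_mulVec, ← mulVec_mulVec]
  rw [mulVec_sub, mulVec_sub, ← h1, pivot, add_mulVec, smul_mulVec, one_mulVec, ← mulVec_mulVec,
    ← mulVec_mulVec, add_sub_cancel_right]

theorem pivot_mulVec_gainVec (hν : 0 < D.ν) {C : Matrix (Fin nx) (Fin nx) ℝ}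
    (hC : ∀ z, 0 ≤ z ⬝ᵥ C *ᵥ z) (t : ℕ) (c : Fin nx → ℝ) :
    D.ν • D.gainVec t C c = (D.B t)ᵀ *ᵥ (c - C *ᵥ (D.B t *ᵥ D.gainVec t C c)) := by
  have h1 : D.pivot t C *ᵥ D.gainVec t C c = (D.B t)ᵀ *ᵥ c := by
    rw [gainVec, mulVec_mulVec, mul_pdInverse (pivot_pos hν hC t), one_mulVec]
  rw [mulVec_sub, ← h1, pivot, add_mulVec, smul_mulVec, one_mulVec, ← mulVec_mulVec,
    ← mulVec_mulVec, add_sub_cancel_right]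

/-- Closed-loop form of the Riccati recursion: the new form is yᵀHy + zᵀCz + ν‖w‖², with w = Ky and
z = Ay - Bw. Symmetry of the matrices plays no role. -/
theorem costMat_nonneg (hν : 0 < D.ν) (hH : ∀ t z, 0 ≤ z ⬝ᵥ D.H t *ᵥ z) (j : ℕ) :
    ∀ y, 0 ≤ y ⬝ᵥ D.costMat τ j *ᵥ y := by
  induction j with
  | zero => exact hH τ
  | succ j ih =>
    intro y
    rw [costMat]
    set t := τ - 1 - j
    set C := D.costMat τ j
    have h1 := pivot_mulVec_gainMat hν ih t y
    set w := D.gainMat t C *ᵥ y with hw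
    set z := D.A t *ᵥ y - D.B t *ᵥ w with hz
    have h2 : (D.H t + (D.A t)ᵀ * (C * (D.A t - D.B t * D.gainMat t C))) *ᵥ y
        = D.H t *ᵥ y + (D.A t)ᵀ *ᵥ (C *ᵥ z) := by
      rw [add_mulVec, ← mulVec_mulVec, ← mulVec_mulVec, sub_mulVec, ← mulVec_mulVec]
    have h3 : y ⬝ᵥ (D.A t)ᵀ *ᵥ (C *ᵥ z) = z ⬝ᵥ C *ᵥ z + D.ν * (w ⬝ᵥ w) := by
      have e1 : w ⬝ᵥ (D.ν • w) = (D.B t *ᵥ w) ⬝ᵥ C *ᵥ z := by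
        rw [h1, dotProduct_mulVec, vecMul_transpose]
      rw [dotProduct_smul, smul_eq_mul] at e1
      rw [dotProduct_mulVec, vecMul_transpose, e1, ← add_dotProduct, hz, sub_add_cancel]
    rw [h2, dotProduct_add, h3]
    have e2 : 0 ≤ w ⬝ᵥ w := Finset.sum_nonneg fun i _ => mul_self_nonneg _
    have := hH t y
    have := ih z
    positivity

/-- The costates of the optimal trajectory. -/
def costate (D : LQData nx nu) (τ t : ℕ) : Fin nx → ℝ :=
  D.costMat τ (τ - t) *ᵥ D.traj τ t + D.costVec τ (τ - t)

theorem costate_last : D.costate τ τ = D.H τ *ᵥ D.traj τ τ + D.h τ := by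
  simp [costate, costMat, costVec]

/-- The adjoint equation and the stationarity in the control, that is, the optimality system solved
by the backward pass. -/
theorem costate_step (hν : 0 < D.ν) (hH : ∀ t z, 0 ≤ z ⬝ᵥ D.H t *ᵥ z) {t : ℕ} (ht : t < τ) :
    D.costate τ t = D.H t *ᵥ D.traj τ t + D.h t + (D.A t)ᵀ *ᵥ D.costate τ (t + 1) ∧
      D.ν • D.control τ t = -((D.B t)ᵀ *ᵥ D.costate τ (t + 1)) := by
  -- The cost-to-go is indexed by the remaining time: j steps remain at time t + 1.
  obtain ⟨j, hj⟩ : ∃ j, j = τ - 1 - t := ⟨_, rfl⟩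
  have e1 : τ - t = j + 1 := by omega
  have e2 : τ - (t + 1) = j := by omega
  have e3 : τ - 1 - j = t := by omega
  have hC := costMat_nonneg (τ := τ) hν hH j
  have k1 := pivot_mulVec_gainMat hν hC t (D.traj τ t)
  have k2 := pivot_mulVec_gainVec hν hC t (D.costVec τ j)
  simp only [costate, control, policy, traj, e1, e2, costMat, costVec, feedback, offset, ← hj, e3]
  set C := D.costMat τ j
  set c := D.costVec τ j
  set y := D.traj τ t
  set K := D.gainMat t C
  set k := D.gainVec t C c
  constructor
  · simp only [mulVec_add, mulVec_neg, mulVec_sub, add_mulVec, sub_mulVec, ← mulVec_mulVec]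
    abel
  · rw [smul_neg, smul_add, k1, k2]
    simp only [mulVec_add, mulVec_neg, mulVec_sub]
    abel

/-- The first order optimality condition along the trajectory. -/
theorem stationary (hν : 0 < D.ν) (hH : ∀ t z, 0 ≤ z ⬝ᵥ D.H t *ᵥ z) {y : ℕ → Fin nx → ℝ}
    {d : ℕ → Fin nu → ℝ} (h0 : y 0 = 0) (hy : ∀ t < τ, y (t + 1) = D.A t *ᵥ y t + D.B t *ᵥ d t) :
    ∑ t ∈ Finset.range τ, ((D.H (t + 1) *ᵥ D.traj τ (t + 1) + D.h (t + 1)) ⬝ᵥ y (t + 1)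
      + D.ν * (D.control τ t ⬝ᵥ d t)) = 0 := by
  -- Summation by parts: the adjoint equation makes the sum telescope, the boundary term at 0
  -- vanishes with y_0, and the one at τ by the terminal value of the costate.
  have key : ∀ n ≤ τ, ∑ t ∈ Finset.range n,
      ((D.H (t + 1) *ᵥ D.traj τ (t + 1) + D.h (t + 1)) ⬝ᵥ y (t + 1)
      + D.ν * (D.control τ t ⬝ᵥ d t))
        = (D.H n *ᵥ D.traj τ n + D.h n - D.costate τ n) ⬝ᵥ y n := by
    intro n hn
    induction n with
    | zero => simp [h0]
    | succ n ih =>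
      obtain ⟨e1, e2⟩ := costate_step hν hH (τ := τ) (t := n) hn
      rw [Finset.sum_range_succ, ih (Nat.le_of_succ_le hn), e1, sub_add_cancel_left, sub_dotProduct,
        neg_dotProduct, mulVec_transpose, ← dotProduct_mulVec, ← smul_eq_mul, ← smul_dotProduct, e2,
        neg_dotProduct, mulVec_transpose, ← dotProduct_mulVec]
      have e3 : D.costate τ (n + 1) ⬝ᵥ y (n + 1)
          = D.costate τ (n + 1) ⬝ᵥ D.A n *ᵥ y n + D.costate τ (n + 1) ⬝ᵥ D.B n *ᵥ d n := by
        rw [hy n hn, dotProduct_add]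
      rw [e3]
      ring
  rw [key τ le_rfl, costate_last, sub_self, zero_dotProduct]

end LQData

end ILQR

namespace ILQR

open Matrix

variable {nx nu τ : ℕ}

/-! ### Straight-line programs -/

theorem BasicOperation.mono {S T : Set (Input nx nu τ → ℝ)} (h : S ⊆ T) {φ : Input nx nu τ → ℝ}
    (hφ : BasicOperation S φ) : BasicOperation T φ := by
  cases hφ with
  | add h1 h2 => exact .add (h h1) (h h2)
  | sub h1 h2 => exact .sub (h h1) (h h2)
  | mul h1 h2 => exact .mul (h h1) (h h2)
  | div h1 h2 => exact .div (h h1) (h h2)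
  | sqrt h1 => exact .sqrt (h h1)
  | dynamics x u i h1 h2 => exact .dynamics x u i (fun j => h (h1 j)) fun j => h (h2 j)
  | jacobian_x x u i j h1 h2 => exact .jacobian_x x u i j (fun j => h (h1 j)) fun j => h (h2 j)
  | jacobian_u x u i j h1 h2 => exact .jacobian_u x u i j (fun j => h (h1 j)) fun j => h (h2 j)
  | cost x t h1 => exact .cost x t fun j => h (h1 j)
  | cost_gradient x t i h1 => exact .cost_gradient x t i fun j => h (h1 j)
  | cost_hessian x t i j h1 => exact .cost_hessian x t i j fun j => h (h1 j)

theorem Computation.initial_subset {n : ℕ} {S : Set (Input nx nu τ → ℝ)} (h : Computation n S) :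
    initialQuantities nx nu τ ⊆ S := by
  induction h with
  | start => exact subset_rfl
  | step _ _ ih => exact ih.trans (Set.subset_insert _ _)

/-- The quantities `G` can be computed with at most `n` basic operations when the quantities `F`
are available. -/
def Prog (n : ℕ) (F G : Set (Input nx nu τ → ℝ)) : Prop :=
  ∀ (S : Set (Input nx nu τ → ℝ)) (m : ℕ), Computation m S → F ⊆ S →
    ∃ (T : Set (Input nx nu τ → ℝ)) (m' : ℕ), m' ≤ m + n ∧ Computation m' T ∧ S ⊆ T ∧ G ⊆ T

namespace Prog

variable {F F' G G' K : Set (Input nx nu τ → ℝ)} {a b n : ℕ} {φ ψ : Input nx nu τ → ℝ}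

theorem weaken (h : Prog a F G) (hF : F ⊆ F') (hG : G' ⊆ G) (hab : a ≤ b) : Prog b F' G' := by
  intro S m hS hFS
  obtain ⟨T, m', h1, h2, h3, h4⟩ := h S m hS (hF.trans hFS)
  exact ⟨T, m', by omega, h2, h3, hG.trans h4⟩

theorem le (h : Prog a F G) (hab : a ≤ b) : Prog b F G := h.weaken subset_rfl subset_rfl hab

theorem of_subset (h : G ⊆ F) : Prog 0 F G :=
  fun S m hS hFS => ⟨S, m, le_rfl, hS, subset_rfl, h.trans hFS⟩

theorem of_mem (h : φ ∈ F) : Prog 0 F {φ} := of_subset (Set.singleton_subset_iff.2 h)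

theorem initial (h : φ ∈ initialQuantities nx nu τ) : Prog 0 F {φ} := fun S m hS _ =>
  ⟨S, m, le_rfl, hS, subset_rfl, Set.singleton_subset_iff.2 (hS.initial_subset h)⟩

theorem const (r : ℝ) : Prog 0 F {fun _ : Input nx nu τ => r} := initial (Or.inl ⟨r, rfl⟩)

/-- Sequential composition. -/
theorem cut (h1 : Prog a F G) (h2 : Prog b (F ∪ G) K) : Prog (a + b) F (G ∪ K) := by
  intro S m hS hFS
  obtain ⟨T, m', e1, e2, e3, e4⟩ := h1 S m hS hFS
  obtain ⟨T', m'', f1, f2, f3, f4⟩ := h2 T m' e2 (Set.union_subset (hFS.trans e3) e4)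
  exact ⟨T', m'', by omega, f2, e3.trans f3, Set.union_subset (e4.trans f3) f4⟩

theorem bind (h1 : Prog a F G) (h2 : Prog b (F ∪ G) K) : Prog (a + b) F K :=
  (h1.cut h2).weaken subset_rfl Set.subset_union_right le_rfl

theorem union (h1 : Prog a F G) (h2 : Prog b F K) : Prog (a + b) F (G ∪ K) :=
  h1.cut (h2.weaken Set.subset_union_left subset_rfl le_rfl)

theorem op (h : BasicOperation F φ) : Prog 1 F {φ} := fun S m hS hFS =>
  ⟨insert φ S, m + 1, le_rfl, .step hS (h.mono hFS), Set.subset_insert _ _,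
    Set.singleton_subset_iff.2 (Set.mem_insert _ _)⟩

section Scalar

variable (h1 : Prog a F {φ}) (h2 : Prog b F {ψ})
include h1

theorem sqrt : Prog (a + 1) F {fun I => √(φ I)} := h1.bind (op (.sqrt (by simp)))

include h2

theorem add : Prog (a + b + 1) F {fun I => φ I + ψ I} :=
  (h1.union h2).bind (op (.add (by simp) (by simp)))

theorem sub : Prog (a + b + 1) F {fun I => φ I - ψ I} :=
  (h1.union h2).bind (op (.sub (by simp) (by simp)))

theorem mul : Prog (a + b + 1) F {fun I => φ I * ψ I} :=
  (h1.union h2).bind (op (.mul (by simp) (by simp)))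

theorem div : Prog (a + b + 1) F {fun I => φ I / ψ I} :=
  (h1.union h2).bind (op (.div (by simp) (by simp)))

end Scalar

theorem biUnion {ι : Type*} {G : ι → Set (Input nx nu τ → ℝ)} (s : Finset ι)
    (h : ∀ i ∈ s, Prog n F (G i)) : Prog (s.card * n) F (⋃ i ∈ s, G i) := by
  classical
  induction s using Finset.induction_on with
  | empty => exact (of_subset (Set.empty_subset _)).weaken subset_rfl (by simp) (Nat.zero_le _)
  | insert i s hi ih =>
    rw [Finset.set_biUnion_insert, Finset.card_insert_of_notMem hi]
    refine ((h i (Finset.mem_insert_self i s)).union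
      (ih fun j hj => h j (Finset.mem_insert_of_mem hj))).le (le_of_eq (by ring))

theorem iUnion {k : ℕ} {G : Fin k → Set (Input nx nu τ → ℝ)} (h : ∀ i, Prog n F (G i)) :
    Prog (k * n) F (⋃ i, G i) :=
  (biUnion Finset.univ fun i _ => h i).weaken subset_rfl (by simp) (by simp)

theorem sum {ι : Type*} {φ : ι → Input nx nu τ → ℝ} (s : Finset ι)
    (h : ∀ i ∈ s, Prog n F {φ i}) : Prog (s.card * (n + 1)) F {fun I => ∑ i ∈ s, φ i I} := by
  classical
  induction s using Finset.induction_on with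
  | empty => simpa using const 0
  | insert i s hi ih =>
    rw [Finset.card_insert_of_notMem hi]
    simp only [Finset.sum_insert hi]
    exact ((h i (Finset.mem_insert_self i s)).add
      (ih fun j hj => h j (Finset.mem_insert_of_mem hj))).le (le_of_eq (by ring))

/-- A loop with `k` passes. -/
theorem loop {G : ℕ → Set (Input nx nu τ → ℝ)} {k : ℕ} (h0 : Prog a F (G 0))
    (h : ∀ t < k, Prog n (F ∪ G t) (G (t + 1))) :
    Prog (a + k * n) F (⋃ t ∈ Finset.range (k + 1), G t) := by
  induction k with
  | zero => simpa using h0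
  | succ k ih =>
    have h1 := ih fun t ht => h t (Nat.lt_succ_of_lt ht)
    have h2 : Prog n (F ∪ ⋃ t ∈ Finset.range (k + 1), G t) (G (k + 1)) :=
      (h k (Nat.lt_succ_self k)).weaken (Set.union_subset_union_right _
        (Set.subset_biUnion_of_mem (u := G) (by simp))) subset_rfl le_rfl
    rw [Finset.range_add_one, Finset.set_biUnion_insert, Set.union_comm]
    exact (h1.cut h2).le (le_of_eq (by ring))

end Prog

/-! ### Vectors and matrices -/

/-- The coordinates of a vector of quantities. -/
def coords {k : ℕ} (x : Input nx nu τ → Fin k → ℝ) : Set (Input nx nu τ → ℝ) :=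
  ⋃ i, {fun I => x I i}

/-- The entries of a matrix of quantities. -/
def entries {k l : ℕ} (A : Input nx nu τ → Matrix (Fin k) (Fin l) ℝ) :
    Set (Input nx nu τ → ℝ) := ⋃ i, ⋃ j, {fun I => A I i j}

theorem mem_coords {k : ℕ} (x : Input nx nu τ → Fin k → ℝ) (i : Fin k) :
    (fun I => x I i) ∈ coords x := Set.mem_iUnion.2 ⟨i, rfl⟩

theorem mem_entries {k l : ℕ} (A : Input nx nu τ → Matrix (Fin k) (Fin l) ℝ) (i : Fin k)
    (j : Fin l) : (fun I => A I i j) ∈ entries A :=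
  Set.mem_iUnion.2 ⟨i, Set.mem_iUnion.2 ⟨j, rfl⟩⟩

namespace Prog

variable {F : Set (Input nx nu τ → ℝ)} {a b n N k l m : ℕ}

theorem coords_of {x : Input nx nu τ → Fin k → ℝ} (h : ∀ i, Prog n F {fun I => x I i}) :
    Prog (k * n) F (coords x) := iUnion h

theorem entries_of {A : Input nx nu τ → Matrix (Fin k) (Fin l) ℝ}
    (h : ∀ i j, Prog n F {fun I => A I i j}) : Prog (k * (l * n)) F (entries A) :=
  iUnion fun i => iUnion (h i)

section Vector

variable {x y : Input nx nu τ → Fin k → ℝ} (hk : k ≤ N) (h1 : Prog a F (coords x))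
  (h2 : Prog b F (coords y))
include hk h1

theorem vecNeg : Prog (a + N) F (coords fun I => -x I) := by
  refine h1.bind ((coords_of (n := 1) fun i => ?_).le (by omega))
  -- Negation is not a basic operation; it is performed as 0 - x.
  exact ((const 0).sub (of_mem (Or.inr (mem_coords x i)))).weaken subset_rfl (by simp) le_rfl

include h2

theorem vecAdd : Prog (a + b + N) F (coords fun I => x I + y I) :=
  (h1.union h2).bind ((coords_of (n := 1) fun i =>
    op (.add (φ := fun I => x I i) (ψ := fun I => y I i) (Or.inr (Or.inl (mem_coords x i)))
      (Or.inr (Or.inr (mem_coords y i))))).le (by omega))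

theorem vecSub : Prog (a + b + N) F (coords fun I => x I - y I) :=
  (h1.union h2).bind ((coords_of (n := 1) fun i =>
    op (.sub (φ := fun I => x I i) (ψ := fun I => y I i) (Or.inr (Or.inl (mem_coords x i)))
      (Or.inr (Or.inr (mem_coords y i))))).le (by omega))

end Vector

/-- Transposition only relabels quantities and costs nothing. -/
theorem transpose {A : Input nx nu τ → Matrix (Fin k) (Fin l) ℝ} (h : Prog a F (entries A)) :
    Prog a F (entries fun I => (A I)ᵀ) :=
  h.weaken subset_rfl (Set.iUnion_subset fun i => Set.iUnion_subset fun j =>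
    Set.singleton_subset_iff.2 (mem_entries A j i)) le_rfl

theorem matVec {A : Input nx nu τ → Matrix (Fin k) (Fin l) ℝ} {x : Input nx nu τ → Fin l → ℝ}
    (hk : k ≤ N) (hl : l ≤ N) (h1 : Prog a F (entries A)) (h2 : Prog b F (coords x)) :
    Prog (a + b + 2 * N ^ 2) F (coords fun I => A I *ᵥ x I) := by
  refine (h1.union h2).bind ((coords_of (n := l * 2) fun i => ?_).le ?_)
  · have := sum (F := F ∪ (entries A ∪ coords x)) (n := 1) (φ := fun j I => A I i j * x I j)
      Finset.univ fun j _ => op (.mul (φ := fun I => A I i j) (ψ := fun I => x I j)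
        (Or.inr (Or.inl (mem_entries A i j))) (Or.inr (Or.inr (mem_coords x j))))
    exact this.weaken subset_rfl subset_rfl (by simp)
  · nlinarith [Nat.mul_le_mul hk hl]

section Matrix

variable {A B : Input nx nu τ → Matrix (Fin k) (Fin l) ℝ} (hk : k ≤ N) (hl : l ≤ N)
  (h1 : Prog a F (entries A)) (h2 : Prog b F (entries B))
include hk hl h1 h2

theorem matAdd : Prog (a + b + N ^ 2) F (entries fun I => A I + B I) :=
  (h1.union h2).bind ((entries_of (n := 1) fun i j =>
    op (.add (φ := fun I => A I i j) (ψ := fun I => B I i j)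
      (Or.inr (Or.inl (mem_entries A i j))) (Or.inr (Or.inr (mem_entries B i j))))).le
        (by nlinarith [Nat.mul_le_mul hk hl]))

theorem matSub : Prog (a + b + N ^ 2) F (entries fun I => A I - B I) :=
  (h1.union h2).bind ((entries_of (n := 1) fun i j =>
    op (.sub (φ := fun I => A I i j) (ψ := fun I => B I i j)
      (Or.inr (Or.inl (mem_entries A i j))) (Or.inr (Or.inr (mem_entries B i j))))).le
        (by nlinarith [Nat.mul_le_mul hk hl]))

end Matrix

theorem matMul {A : Input nx nu τ → Matrix (Fin k) (Fin l) ℝ}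
    {B : Input nx nu τ → Matrix (Fin l) (Fin m) ℝ} (hk : k ≤ N) (hl : l ≤ N) (hm : m ≤ N)
    (h1 : Prog a F (entries A)) (h2 : Prog b F (entries B)) :
    Prog (a + b + 2 * N ^ 3) F (entries fun I => A I * B I) := by
  refine (h1.union h2).bind ((entries_of (n := l * 2) fun i j => ?_).le ?_)
  · have := sum (F := F ∪ (entries A ∪ entries B)) (n := 1) (φ := fun p I => A I i p * B I p j)
      Finset.univ fun p _ => op (.mul (φ := fun I => A I i p) (ψ := fun I => B I p j)
        (Or.inr (Or.inl (mem_entries A i p))) (Or.inr (Or.inr (mem_entries B p j))))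
    exact this.weaken subset_rfl subset_rfl (by simp)
  · calc k * (m * (l * 2)) ≤ N * (N * (N * 2)) := by gcongr
      _ = _ := by ring

theorem matOne : Prog 0 F (entries fun _ : Input nx nu τ => (1 : Matrix (Fin k) (Fin k) ℝ)) :=
  (entries_of (A := fun _ => 1) (n := 0) fun i j =>
    const ((1 : Matrix (Fin k) (Fin k) ℝ) i j)).le (by simp)

theorem matSmul {A : Input nx nu τ → Matrix (Fin k) (Fin l) ℝ} {ν : Input nx nu τ → ℝ}
    (hk : k ≤ N) (hl : l ≤ N) (h1 : Prog a F {ν}) (h2 : Prog b F (entries A)) :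
    Prog (a + b + N ^ 2) F (entries fun I => ν I • A I) :=
  (h1.union h2).bind ((entries_of (n := 1) fun i j =>
    op (.mul (φ := ν) (ψ := fun I => A I i j) (Or.inr (Or.inl rfl))
      (Or.inr (Or.inr (mem_entries A i j))))).le
        (by nlinarith [Nat.mul_le_mul hk hl]))

/-- The row vector is computed once and shared by all entries; this keeps an update quadratic and
the whole inverse cubic. -/
theorem rankOneUpdate {M X : Input nx nu τ → Matrix (Fin k) (Fin k) ℝ} (hk : k ≤ N) (p : Fin k)
    (hM : entries M ⊆ F) (hX : entries X ⊆ F) :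
    Prog (8 * N ^ 2) F (entries fun I => ILQR.rankOneUpdate (M I) (X I) p) := by
  have h1 : Prog (k * (k * 3)) F (coords fun I => rowDiff (M I) p ᵥ* X I) := by
    refine coords_of fun j => ?_
    have := sum (F := F) (n := 2) (φ := fun i I =>
      (M I p i - (1 : Matrix (Fin k) (Fin k) ℝ) p i) * X I i j) Finset.univ fun i _ =>
        (((of_mem (hM (mem_entries M p i))).sub (const _)).mul (of_mem (hX (mem_entries X i j))) :)
    exact this.weaken subset_rfl subset_rfl (by simp)
  refine (h1.bind (entries_of (n := 4) fun i j => ?_)).le (by nlinarith [Nat.mul_le_mul hk hk])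
  have hX' := fun i j => Set.mem_union_left (coords fun I => rowDiff (M I) p ᵥ* X I)
    (hX (mem_entries X i j))
  have hw := fun j => Set.mem_union_right F (mem_coords (fun I => rowDiff (M I) p ᵥ* X I) j)
  exact (of_mem (hX' i j)).sub (((of_mem (hX' i p)).mul (of_mem (hw j))).div
    ((const 1).add (of_mem (hw p))))

theorem inverse {M : Input nx nu τ → Matrix (Fin k) (Fin k) ℝ} (hk : k ≤ N)
    (h : Prog a F (entries M)) : Prog (a + 8 * N ^ 3) F (entries fun I => pdInverse (M I)) := by
  refine h.bind ?_
  have h1 := loop (F := F ∪ entries M) (k := k) (n := 8 * N ^ 2)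
    (G := fun p => entries fun I => rowInverse (M I) p) (matOne :) fun p hp => by
      simp only [rowInverse, hp, dite_true]
      exact rankOneUpdate hk ⟨p, hp⟩ (Set.subset_union_of_subset_left Set.subset_union_right _)
        Set.subset_union_right
  refine h1.weaken subset_rfl
    (Set.subset_biUnion_of_mem (u := fun p => entries fun I => rowInverse (M I) p) (x := k)
      (by simp)) ?_
  calc 0 + k * (8 * N ^ 2) ≤ 0 + N * (8 * N ^ 2) := by gcongr
    _ = _ := by ring

end Prog

end ILQR

namespace ILQR

open Matrix

variable {nx nu τ : ℕ}

/-! ### A program for the Riccati recursion -/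

/-- The data of a linear quadratic control problem with horizon `τ` are among the quantities `F`. -/
structure LQAvailable (F : Set (Input nx nu τ → ℝ)) (D : Input nx nu τ → LQData nx nu) :
    Prop where
  A : ∀ t < τ, entries (fun I => (D I).A t) ⊆ F
  B : ∀ t < τ, entries (fun I => (D I).B t) ⊆ F
  H : ∀ t ≤ τ, entries (fun I => (D I).H t) ⊆ F
  h : ∀ t ≤ τ, coords (fun I => (D I).h t) ⊆ F
  ν : (fun I => (D I).ν) ∈ F

namespace LQAvailable

variable {F F' : Set (Input nx nu τ → ℝ)} {D : Input nx nu τ → LQData nx nu} {N t : ℕ}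
  {C : Input nx nu τ → Matrix (Fin nx) (Fin nx) ℝ} {c : Input nx nu τ → Fin nx → ℝ}

theorem mono (h : LQAvailable F D) (hF : F ⊆ F') : LQAvailable F' D :=
  ⟨fun t ht => (h.A t ht).trans hF, fun t ht => (h.B t ht).trans hF,
    fun t ht => (h.H t ht).trans hF, fun t ht => (h.h t ht).trans hF, hF h.ν⟩

variable (hD : LQAvailable F D) (hx : nx ≤ N) (hu : nu ≤ N)
include hD hx hu

theorem pivot (ht : t < τ) (hC : entries C ⊆ F) :
    Prog (4 * N ^ 3 + 2 * N ^ 2) F (entries fun I => (D I).pivot t (C I)) := by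
  have hB := Prog.of_subset (hD.B t ht)
  have h1 := (Prog.of_mem hD.ν).matSmul hu hu Prog.matOne
  have h2 := hB.transpose.matMul hu hx hu ((Prog.of_subset hC).matMul hx hx hu hB)
  exact (h1.matAdd hu hu h2).le (by omega)

theorem gainMat (ht : t < τ) (hC : entries C ⊆ F) :
    Prog (18 * N ^ 3 + 2 * N ^ 2) F (entries fun I => (D I).gainMat t (C I)) := by
  have h1 := (hD.pivot hx hu ht hC).inverse hu
  have h2 := (Prog.of_subset (hD.B t ht)).transpose.matMul hu hx hx
    ((Prog.of_subset hC).matMul hx hx hx (Prog.of_subset (hD.A t ht)))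
  exact (h1.matMul hu hu hx h2).le (by omega)

theorem gainVec (ht : t < τ) (hC : entries C ⊆ F) (hc : coords c ⊆ F) :
    Prog (12 * N ^ 3 + 6 * N ^ 2) F (coords fun I => (D I).gainVec t (C I) (c I)) := by
  have h1 := (hD.pivot hx hu ht hC).inverse hu
  have h2 := (Prog.of_subset (hD.B t ht)).transpose.matVec hu hx (Prog.of_subset hc)
  exact (h1.matVec hu hu h2).le (by omega)

/-- One step of the backward pass. -/
theorem cost_step {j : ℕ} (hj : j < τ) (hC : entries (fun I => (D I).costMat τ j) ⊆ F)
    (hc : coords (fun I => (D I).costVec τ j) ⊆ F) :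
    Prog (36 * N ^ 3 + 16 * N ^ 2 + 2 * N) F (entries (fun I => (D I).costMat τ (j + 1)) ∪
      coords fun I => (D I).costVec τ (j + 1)) := by
  have ht : τ - 1 - j < τ := by omega
  have hA := Prog.of_subset (hD.A _ ht)
  have hB := Prog.of_subset (hD.B _ ht)
  have h1 := hA.matSub hx hx (hB.matMul hx hu hx (hD.gainMat hx hu ht hC))
  have h2 := (Prog.of_subset (hD.H _ ht.le)).matAdd hx hx
    (hA.transpose.matMul hx hx hx ((Prog.of_subset hC).matMul hx hx hx h1))
  have h3 := (Prog.of_subset hc).vecSub hx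
    ((Prog.of_subset hC).matVec hx hx (hB.matVec hx hu (hD.gainVec hx hu ht hC hc)))
  have h4 := (Prog.of_subset (hD.h _ ht.le)).vecAdd hx (hA.transpose.matVec hx hx h3)
  exact (h2.union h4).le (by omega)

/-- The program for the optimal controls: a backward and a forward pass. -/
theorem control (hN : 1 ≤ N) : Prog (120 * (τ * N ^ 3)) F
    (⋃ t ∈ Finset.range τ, coords fun I => (D I).control τ t) := by
  -- Lower order terms are absorbed into N³; the four passes cost 54, 38, 9 and 4 times τN³.
  have hN1 : N ≤ N ^ 3 := Nat.le_self_pow (by norm_num) N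
  have hN2 : N ^ 2 ≤ N ^ 3 := Nat.pow_le_pow_right hN (by norm_num)
  let G : ℕ → Set (Input nx nu τ → ℝ) := fun j =>
    entries (fun I => (D I).costMat τ j) ∪ coords fun I => (D I).costVec τ j
  let G₁ := ⋃ j ∈ Finset.range (τ + 1), G j
  have h1 : Prog (0 + τ * (54 * N ^ 3)) F G₁ := by
    refine Prog.loop (Prog.of_subset (Set.union_subset (hD.H τ le_rfl) (hD.h τ le_rfl)))
      fun j hj => ?_
    refine ((hD.mono Set.subset_union_left).cost_step hx hu hj ?_ ?_).le (by omega)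
    · exact Set.subset_union_of_subset_right Set.subset_union_left _
    · exact Set.subset_union_of_subset_right Set.subset_union_right _
  have hG : ∀ j < τ, G j ⊆ F ∪ G₁ := fun j hj => Set.subset_union_of_subset_right
    (Set.subset_biUnion_of_mem (u := G) (x := j) (Finset.mem_range.2 (by omega))) _
  let K : ℕ → Set (Input nx nu τ → ℝ) := fun j =>
    entries (fun I => (D I).feedback τ j) ∪ coords fun I => (D I).offset τ j
  let K₁ := ⋃ j ∈ Finset.range τ, K j
  -- The gains are recomputed from the stored costs-to-go, since the backward pass exports only the
  -- latter.
  have h2 : Prog (τ * (38 * N ^ 3)) (F ∪ G₁) K₁ := by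
    have : Prog ((Finset.range τ).card * (38 * N ^ 3)) (F ∪ G₁) K₁ :=
      Prog.biUnion (Finset.range τ) fun j hj => by
        have hj := Finset.mem_range.1 hj
        have ht : τ - 1 - j < τ := by omega
        have hD' := hD.mono (F' := F ∪ G₁) Set.subset_union_left
        have hC := Set.subset_union_left.trans (hG j hj)
        have hc := Set.subset_union_right.trans (hG j hj)
        exact ((hD'.gainMat hx hu ht hC).union (hD'.gainVec hx hu ht hC hc)).le (by omega)
    simpa using this
  have hK : ∀ j < τ, K j ⊆ F ∪ K₁ := fun j hj => Set.subset_union_of_subset_right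
    (Set.subset_biUnion_of_mem (u := K) (x := j) (Finset.mem_range.2 hj)) _
  let Y : ℕ → Set (Input nx nu τ → ℝ) := fun t => coords fun I => (D I).traj τ t
  let Y₁ := ⋃ t ∈ Finset.range (τ + 1), Y t
  have hpol : ∀ {F'' : Set (Input nx nu τ → ℝ)} {t : ℕ}, t < τ → F ∪ K₁ ⊆ F'' → Y t ⊆ F'' →
      Prog (2 * N ^ 2 + 2 * N) F'' (coords fun I => (D I).control τ t) := by
    intro F'' t ht hF hY
    have hj : τ - 1 - t < τ := by omega
    have e1 := Prog.of_subset ((Set.subset_union_left.trans (hK _ hj)).trans hF)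
    have e2 := Prog.of_subset ((Set.subset_union_right.trans (hK _ hj)).trans hF)
    exact (((e1.matVec hu hx (Prog.of_subset hY)).vecAdd hu e2).vecNeg hu).le (by omega)
  have h3 : Prog (0 + τ * (9 * N ^ 3)) (F ∪ K₁) Y₁ := by
    refine Prog.loop ((Prog.coords_of (n := 0) fun i => Prog.const 0).le (by simp)) fun t ht => ?_
    have hD' := hD.mono (F' := F ∪ K₁ ∪ Y t)
      (Set.subset_union_of_subset_left Set.subset_union_left _)
    have e1 := (Prog.of_subset (hD'.A t ht)).matVec hx hx
      (Prog.of_subset (show Y t ⊆ F ∪ K₁ ∪ Y t from Set.subset_union_right))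
    have e2 := (Prog.of_subset (hD'.B t ht)).matVec hx hu
      (hpol ht (Set.subset_union_left (t := Y t)) Set.subset_union_right)
    exact (e1.vecAdd hx e2).le (by omega)
  have h4 : Prog (τ * (4 * N ^ 3)) (F ∪ K₁ ∪ Y₁)
      (⋃ t ∈ Finset.range τ, coords fun I => (D I).control τ t) := by
    have := Prog.biUnion (n := 4 * N ^ 3) (F := F ∪ K₁ ∪ Y₁)
      (G := fun t => coords fun I => (D I).control τ t) (Finset.range τ) fun t ht => by
        have ht := Finset.mem_range.1 ht
        refine (hpol ht Set.subset_union_left (Set.subset_union_of_subset_right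
          (Set.subset_biUnion_of_mem (u := Y) (x := t) (Finset.mem_range.2 ?_)) _)).le ?_ <;> omega
    simpa using this
  exact ((h1.bind h2).bind (h3.bind h4)).le (by nlinarith)

end LQAvailable

end ILQR

namespace ILQR

open Matrix

variable {nx nu τ : ℕ}

/-- The matrix of an operator between Euclidean spaces. -/
def opMatrix {a b : ℕ} (T : Vec a →L[ℝ] Vec b) : Matrix (Fin b) (Fin a) ℝ :=
  Matrix.of fun i j => T (EuclideanSpace.single j 1) i

theorem opMatrix_mulVec {a b : ℕ} (T : Vec a →L[ℝ] Vec b) (x : Vec a) :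
    opMatrix T *ᵥ x.ofLp = (T x).ofLp := by
  ext i
  have h1 : x = ∑ j, x j • EuclideanSpace.single j (1 : ℝ) := by
    ext k
    simp [Finset.sum_apply, Pi.single_apply]
  conv_rhs => rw [h1]
  simp [mulVec, dotProduct, opMatrix, mul_comm]

theorem vec_inner_eq {a : ℕ} (x y : Vec a) : ⟪x, y⟫_ℝ = x.ofLp ⬝ᵥ y.ofLp := by
  simp [PiLp.inner_apply, dotProduct, mul_comm]

namespace ControlProblem

/-- The linear quadratic problem at a command. -/
def lqData (P : ControlProblem nx nu τ) (ν : ℝ) (u : Seq τ nu) : LQData nx nu where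
  A t := if ht : t < τ then opMatrix (P.Dx (P.state u t) (u ⟨t, ht⟩)) else 0
  B t := if ht : t < τ then opMatrix (P.Du (P.state u t) (u ⟨t, ht⟩)) else 0
  -- There is no cost on the initial state, and `P.h t` is the cost at time t + 1, hence the shift.
  H t := match t with
    | 0 => 0
    | t + 1 => if ht : t < τ then opMatrix (hess (P.h ⟨t, ht⟩) (P.state u (t + 1))) else 0
  h t := match t with
    | 0 => 0
    | t + 1 => if ht : t < τ then (gradient (P.h ⟨t, ht⟩) (P.state u (t + 1))).ofLp else 0
  ν := ν

/-- The controls computed by the Riccati recursion. -/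
def riccati (P : ControlProblem nx nu τ) (ν : ℝ) (u : Seq τ nu) : Seq τ nu :=
  WithLp.toLp 2 fun t : Fin τ => WithLp.toLp 2 ((P.lqData ν u).control τ t)

variable {P : ControlProblem nx nu τ} {ν : ℝ} {u : Seq τ nu}

theorem linState_eq_recursion (v : Seq τ nu) {t : ℕ} (ht : t < τ) :
    (P.linState u v (t + 1)).ofLp = (P.lqData ν u).A t *ᵥ (P.linState u v t).ofLp
      + (P.lqData ν u).B t *ᵥ (v ⟨t, ht⟩).ofLp := by
  simp only [linState, lqData, ht, dite_true, opMatrix_mulVec]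
  rfl

theorem traj_eq {t : ℕ} (ht : t ≤ τ) :
    (P.lqData ν u).traj τ t = (P.linState u (P.riccati ν u) t).ofLp := by
  induction t with
  | zero => rfl
  | succ t ih =>
    rw [linState_eq_recursion (ν := ν) _ ht, ← ih (Nat.le_of_succ_le ht)]
    rfl

namespace Admissible

variable {c : Constants} (hP : P.Admissible c) (hnx : 0 < nx) (hτ : 0 < τ)
include hP hnx hτ

-- Tested against a direction d, the stationarity condition is the vanishing first variation of
-- `LQData.stationary`, written with the linearized states driven by d.
omit hτ in
theorem riccati_lqStationary (hν : 0 < ν) :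
    LQStationary (fderiv ℝ P.g u) (hess P.totalCost (P.g u)) (gradient P.totalCost (P.g u)) ν
      (P.riccati ν u) := by
  have : Nonempty (Fin nx) := ⟨⟨0, hnx⟩⟩
  have hf := hP.dynamics.differentiable
  refine ext_inner_right ℝ fun d => ?_
  rw [inner_zero_left, inner_add_left, ContinuousLinearMap.adjoint_inner_left,
    real_inner_smul_left]
  have hH : ∀ t z, 0 ≤ z ⬝ᵥ (P.lqData ν u).H t *ᵥ z := by
    intro t z
    rcases t with _ | t
    · simp [lqData]
    · by_cases ht : t < τ
      · have h0 : RegularCost (P.h ⟨t, ht⟩) c.μh c.Lh c.Mh :=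
          ⟨hP.costs.pos, hP.costs.strongConvex _, hP.costs.differentiable _,
            hP.costs.twice_differentiable _, hP.costs.grad_lipschitz _, hP.costs.hess_lipschitz _⟩
        have h1 := h0.inner_hess_nonneg (P.state u (t + 1)) (WithLp.toLp 2 z)
        rw [real_inner_comm, vec_inner_eq, ← opMatrix_mulVec] at h1
        simpa [lqData, ht] using h1
      · simp [lqData, ht]
  let dd : ℕ → Fin nu → ℝ := fun t => if ht : t < τ then (d ⟨t, ht⟩).ofLp else 0
  have key := LQData.stationary (D := P.lqData ν u) (τ := τ) hν hH
    (y := fun t => (P.linState u d t).ofLp) (d := dd) rfl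
    (fun t ht => by
      rw [linState_eq_recursion (ν := ν) _ ht]
      simp [dd, ht])
  rw [← Fin.sum_univ_eq_sum_range (fun t => (((P.lqData ν u).H (t + 1) *ᵥ
    (P.lqData ν u).traj τ (t + 1) + (P.lqData ν u).h (t + 1)) ⬝ᵥ (P.linState u d (t + 1)).ofLp
      + (P.lqData ν u).ν * ((P.lqData ν u).control τ t ⬝ᵥ dd t)))] at key
  rw [← key, PiLp.inner_apply, PiLp.inner_apply, Finset.mul_sum, ← Finset.sum_add_distrib]
  refine Finset.sum_congr rfl fun t _ => ?_
  rw [PiLp.add_apply, hP.costs.hess_apply, hP.costs.gradient_apply, fderiv_g_apply hf,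
    fderiv_g_apply hf, vec_inner_eq, vec_inner_eq, traj_eq (Nat.succ_le_of_lt t.2)]
  simp only [lqData, t.2, dite_true, opMatrix_mulVec, dd]
  rfl

omit hnx hτ in
theorem norm_gradient_sq (u : Seq τ nu) : ‖gradient P.totalCost (P.g u)‖ ^ 2
    = ∑ t : Fin τ, ∑ i, (P.lqData ν u).h (t + 1) i * (P.lqData ν u).h (t + 1) i := by
  rw [PiLp.norm_sq_eq_of_L2]
  refine Finset.sum_congr rfl fun t _ => ?_
  rw [hP.costs.gradient_apply, ← real_inner_self_eq_norm_sq, vec_inner_eq]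
  simp [lqData, dotProduct, g]

/-- The oracle direction computed by the Riccati recursion; the factor replaces it by zero where
the gradient of the total cost vanishes. -/
theorem lqr_apply (u : Seq τ nu) (t : Fin τ) (i : Fin nu) :
    P.lqr (P.reg c u) u t i = (P.lqData (P.reg c u) u).control τ t i
      * (‖gradient P.totalCost (P.g u)‖ / ‖gradient P.totalCost (P.g u)‖) := by
  have hc := hP.proper hnx hτ
  rcases (hP.lqr_spec hnx hτ u).2 with ⟨h0, h1⟩ | ⟨h0, -⟩
  -- Here 0 / 0 = 0, so the factor is 0 or 1 and the program needs no case distinction on the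
  -- gradient.
  · simp [h0, h1]
  · have hν : 0 < P.reg c u := hc.regOf_pos h0
    rw [(hP.lqr_eq_of_lqStationary hnx hτ hν (hP.riccati_lqStationary hnx hν)).2,
      div_self h0.ne', mul_one]
    rfl

end Admissible

end ControlProblem

/-! ### A program for the iterations -/

/-- The coordinates of a command. -/
def commandCoords (u : Input nx nu τ → Seq τ nu) : Set (Input nx nu τ → ℝ) :=
  ⋃ t : Fin τ, coords fun I => (u I t).ofLp

namespace Prog

variable {F : Set (Input nx nu τ → ℝ)} {u : Input nx nu τ → Seq τ nu} {N : ℕ}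

theorem mem_command (hu : commandCoords u ⊆ F) (t : Fin τ) (i : Fin nu) :
    (fun I => u I t i) ∈ F :=
  hu (Set.mem_iUnion.2 ⟨t, mem_coords (fun I => (u I t).ofLp) i⟩)

/-- The states driven by a command. -/
theorem states (hx : nx ≤ N) (hu : commandCoords u ⊆ F) :
    Prog (τ * N) F (⋃ t ∈ Finset.range (τ + 1), coords fun I => (I.P.state (u I) t).ofLp) := by
  have := loop (F := F) (k := τ) (n := N) (a := 0)
    (G := fun t => coords fun I => (I.P.state (u I) t).ofLp)
    ((coords_of (n := 0) fun i => initial (Or.inr (Or.inl ⟨i, rfl⟩))).le (by simp))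
    fun t ht => by
      refine (coords_of (n := 1) fun i => ?_).le (by omega)
      have e : (fun I : Input nx nu τ => (I.P.state (u I) (t + 1)).ofLp i)
          = fun I => I.P.f (I.P.state (u I) t, u I ⟨t, ht⟩) i := by
        funext I; simp [ControlProblem.state, ht]
      rw [e]
      exact op (.dynamics _ _ i (fun j => Or.inr (mem_coords
        (fun I => (I.P.state (u I) t).ofLp) j)) fun j => Or.inl (mem_command hu _ j))
  simpa using this

/-- The problem data at a command, except for the regularization. -/
theorem derivatives (hx : nx ≤ N) (hu' : nu ≤ N) (hu : commandCoords u ⊆ F)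
    (ν : Input nx nu τ → ℝ) :
    ∃ G, Prog (τ * (5 * N ^ 2)) F G ∧
      (∀ t < τ, entries (fun I => (I.P.lqData (ν I) (u I)).A t) ⊆ G) ∧
      (∀ t < τ, entries (fun I => (I.P.lqData (ν I) (u I)).B t) ⊆ G) ∧
      (∀ t ≤ τ, entries (fun I => (I.P.lqData (ν I) (u I)).H t) ⊆ G) ∧
      (∀ t ≤ τ, coords (fun I => (I.P.lqData (ν I) (u I)).h t) ⊆ G) := by
  have hNN : N ≤ N ^ 2 := Nat.le_self_pow (by norm_num) N
  have hs := states hx hu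
  set X : Set (Input nx nu τ → ℝ) :=
    ⋃ t ∈ Finset.range (τ + 1), coords fun I => (I.P.state (u I) t).ofLp
  have hX : ∀ t ≤ τ, ∀ j, (fun I : Input nx nu τ => I.P.state (u I) t j) ∈ F ∪ X :=
    fun t ht j => Or.inr (Set.mem_biUnion (x := t) (by simpa using Nat.lt_succ_of_le ht)
      (mem_coords (fun I : Input nx nu τ => (I.P.state (u I) t).ofLp) j))
  have hU : ∀ (t : Fin τ) j, (fun I : Input nx nu τ => u I t j) ∈ F ∪ X :=
    fun t j => Or.inl (mem_command hu t j)
  have hA : Prog (τ * N ^ 2) (F ∪ X)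
      (⋃ t : Fin τ, entries fun I => (I.P.lqData (ν I) (u I)).A t) := by
    refine iUnion fun t => (entries_of (n := 1) fun i j => ?_).le (by
      nlinarith [Nat.mul_le_mul hx hx])
    simp only [ControlProblem.lqData, t.2, dite_true, opMatrix]
    exact op (.jacobian_x _ _ i j (hX t t.2.le) (hU t))
  have hB : Prog (τ * N ^ 2) (F ∪ X)
      (⋃ t : Fin τ, entries fun I => (I.P.lqData (ν I) (u I)).B t) := by
    refine iUnion fun t => (entries_of (n := 1) fun i j => ?_).le (by
      nlinarith [Nat.mul_le_mul hx hu'])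
    simp only [ControlProblem.lqData, t.2, dite_true, opMatrix]
    exact op (.jacobian_u _ _ i j (hX t t.2.le) (hU t))
  have hH : Prog (τ * N ^ 2) (F ∪ X)
      (⋃ t : Fin τ, entries fun I => (I.P.lqData (ν I) (u I)).H (t + 1)) := by
    refine iUnion fun t => (entries_of (n := 1) fun i j => ?_).le (by
      nlinarith [Nat.mul_le_mul hx hx])
    simp only [ControlProblem.lqData, t.2, dite_true, opMatrix]
    exact op (.cost_hessian _ t i j (hX (t + 1) t.2))
  have hh : Prog (τ * N) (F ∪ X)
      (⋃ t : Fin τ, coords fun I => (I.P.lqData (ν I) (u I)).h (t + 1)) := by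
    refine iUnion fun t => (coords_of (n := 1) fun i => ?_).le (by omega)
    simp only [ControlProblem.lqData, t.2, dite_true]
    exact op (.cost_gradient _ t i (hX (t + 1) t.2))
  have hH0 : Prog 0 (F ∪ X) (entries fun I => (I.P.lqData (ν I) (u I)).H 0) :=
    (entries_of (n := 0) fun i j => const 0).le (by simp)
  have hh0 : Prog 0 (F ∪ X) (coords fun I => (I.P.lqData (ν I) (u I)).h 0) :=
    (coords_of (n := 0) fun i => const 0).le (by simp)
  refine ⟨_, (hs.bind (hA.union (hB.union (hH.union (hh.union (hH0.union hh0)))))).le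
    (by nlinarith), fun t ht => ?_, fun t ht => ?_, fun t ht => ?_, fun t ht => ?_⟩
  · exact fun φ hφ => Or.inl (Set.mem_iUnion.2 ⟨⟨t, ht⟩, hφ⟩)
  · exact fun φ hφ => Or.inr (Or.inl (Set.mem_iUnion.2 ⟨⟨t, ht⟩, hφ⟩))
  · rcases t with _ | t
    · exact fun φ hφ => Or.inr (Or.inr (Or.inr (Or.inr (Or.inl hφ))))
    · exact fun φ hφ => Or.inr (Or.inr (Or.inl (Set.mem_iUnion.2 ⟨⟨t, ht⟩, hφ⟩)))
  · rcases t with _ | t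
    · exact fun φ hφ => Or.inr (Or.inr (Or.inr (Or.inr (Or.inr hφ))))
    · exact fun φ hφ => Or.inr (Or.inr (Or.inr (Or.inl (Set.mem_iUnion.2 ⟨⟨t, ht⟩, hφ⟩))))

/-- The norm of the gradient of the total cost. -/
theorem gradient_norm (hx : nx ≤ N) (hN : 1 ≤ N) {ν : Input nx nu τ → ℝ}
    (hh : ∀ t ≤ τ, coords (fun I => (I.P.lqData (ν I) (u I)).h t) ⊆ F) :
    Prog (τ * (3 * N) + 1) F {fun I => ‖gradient I.P.totalCost (I.P.g (u I))‖} := by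
  have e : (fun I : Input nx nu τ => ‖gradient I.P.totalCost (I.P.g (u I))‖)
      = fun I => √(∑ t : Fin τ, ∑ i, (I.P.lqData (ν I) (u I)).h (t + 1) i
        * (I.P.lqData (ν I) (u I)).h (t + 1) i) := by
    funext I
    rw [← I.admissible.norm_gradient_sq, Real.sqrt_sq (norm_nonneg _)]
  rw [e]
  refine sqrt ?_
  refine (sum (n := 2 * N) (φ := fun t : Fin τ => fun I : Input nx nu τ =>
    ∑ i, (I.P.lqData (ν I) (u I)).h (t + 1) i * (I.P.lqData (ν I) (u I)).h (t + 1) i)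
    Finset.univ fun t _ => ?_).le ?_
  · refine (sum (n := 1) (φ := fun i : Fin nx => fun I : Input nx nu τ =>
      (I.P.lqData (ν I) (u I)).h (t + 1) i * (I.P.lqData (ν I) (u I)).h (t + 1) i)
      Finset.univ fun i _ => ?_).le ?_
    · have := hh (t + 1) t.2 (mem_coords (fun I => (I.P.lqData (ν I) (u I)).h (t + 1)) i)
      exact op (.mul this this)
    · simp; omega
  · simp; nlinarith

/-- The regularization. -/
theorem regularization
    (hp : (fun I => ‖gradient I.P.totalCost (I.P.g (u I))‖) ∈ F) :
    Prog 30 F {fun I => I.P.reg I.c (u I)} := by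
  have hμ : Prog 0 F {fun I : Input nx nu τ => I.c.μh} := initial (by simp [initialQuantities])
  have hL : Prog 0 F {fun I : Input nx nu τ => I.c.Lh} := initial (by simp [initialQuantities])
  have hM : Prog 0 F {fun I : Input nx nu τ => I.c.Mh} := initial (by simp [initialQuantities])
  have hl : Prog 0 F {fun I : Input nx nu τ => I.c.lg} := initial (by simp [initialQuantities])
  have hK : Prog 0 F {fun I : Input nx nu τ => I.c.Lg} := initial (by simp [initialQuantities])
  have hσ : Prog 0 F {fun I : Input nx nu τ => I.c.σg} := initial (by simp [initialQuantities])
  have hp := of_mem hp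
  have h1 := (hK.mul hp).add (((((const 2).mul (hl.mul hl)).mul
    (((hM.mul (hl.mul hl)).div (const 3)).add (hK.mul hL))).mul hp).div
      ((hK.mul hp).add ((hσ.mul hl).mul hμ)))
  have e : (fun I : Input nx nu τ => I.P.reg I.c (u I)) = _ :=
    funext fun I => by rw [ControlProblem.reg, sq]
  rw [e]
  exact h1.le (by norm_num)

/-- One iteration of the algorithm. -/
theorem iteration (hnx : 0 < nx) (hτ : 0 < τ) (hu : commandCoords u ⊆ F) :
    Prog (200 * (τ * (nx + nu) ^ 3)) F
      (commandCoords fun I => u I + I.P.lqr (I.P.reg I.c (u I)) (u I)) := by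
  obtain ⟨N, hN'⟩ : ∃ N, N = nx + nu := ⟨_, rfl⟩
  rw [← hN']
  have hx : nx ≤ N := by omega
  have hu' : nu ≤ N := by omega
  have hN : 1 ≤ N := by omega
  have hN1 : N ≤ N ^ 3 := Nat.le_self_pow (by norm_num) N
  have hN2 : N ^ 2 ≤ N ^ 3 := Nat.pow_le_pow_right hN (by norm_num)
  obtain ⟨G, hG, hA, hB, hH, hh⟩ := derivatives hx hu' hu fun I => I.P.reg I.c (u I)
  have h1 := gradient_norm (F := F ∪ G) hx hN fun t ht => (hh t ht).trans Set.subset_union_right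
  set p : Input nx nu τ → ℝ := fun I => ‖gradient I.P.totalCost (I.P.g (u I))‖ with hp
  have h2 := regularization (F := F ∪ G ∪ {p}) (u := u) (Or.inr rfl)
  set r : Input nx nu τ → ℝ := fun I => I.P.reg I.c (u I) with hr
  have h3 : LQAvailable (F ∪ G ∪ {p} ∪ {r}) fun I => I.P.lqData (I.P.reg I.c (u I)) (u I) := by
    have hGF : G ⊆ F ∪ G ∪ {p} ∪ {r} := fun φ hφ => Or.inl (Or.inl (Or.inr hφ))
    exact ⟨fun t ht => (hA t ht).trans hGF, fun t ht => (hB t ht).trans hGF,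
      fun t ht => (hH t ht).trans hGF, fun t ht => (hh t ht).trans hGF, Or.inr rfl⟩
  have h4 := h3.control hx hu' hN
  set V := ⋃ t ∈ Finset.range τ, coords fun I : Input nx nu τ =>
    (I.P.lqData (I.P.reg I.c (u I)) (u I)).control τ t with hV
  have h5 : Prog (τ * (3 * N)) (F ∪ G ∪ {p} ∪ {r} ∪ V)
      (commandCoords fun I => u I + I.P.lqr (I.P.reg I.c (u I)) (u I)) := by
    refine iUnion fun t => (coords_of (n := 3) fun i => ?_).le (by omega)
    have e : (fun I : Input nx nu τ => (u I + I.P.lqr (I.P.reg I.c (u I)) (u I)) t i)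
        = fun I => u I t i + (I.P.lqData (I.P.reg I.c (u I)) (u I)).control τ t i
          * (p I / p I) := by
      funext I
      rw [PiLp.add_apply, PiLp.add_apply, I.admissible.lqr_apply hnx hτ]
    rw [e]
    have e1 : (fun I : Input nx nu τ => u I t i) ∈ F ∪ G ∪ {p} ∪ {r} ∪ V :=
      Or.inl (Or.inl (Or.inl (Or.inl (mem_command hu t i))))
    have e2 : (fun I : Input nx nu τ => (I.P.lqData (I.P.reg I.c (u I)) (u I)).control τ t i)
        ∈ F ∪ G ∪ {p} ∪ {r} ∪ V :=
      Or.inr (Set.mem_biUnion (x := (t : ℕ)) (by simp) (mem_coords (fun I : Input nx nu τ =>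
        (I.P.lqData (I.P.reg I.c (u I)) (u I)).control τ t) i))
    have e3 : p ∈ F ∪ G ∪ {p} ∪ {r} ∪ V := Or.inl (Or.inl (Or.inr rfl))
    exact (of_mem e1).add ((of_mem e2).mul ((of_mem e3).div (of_mem e3)))
  -- Derivatives, gradient norm, regularization, Riccati passes and update; all but the Riccati
  -- passes are of lower order in N.
  refine (hG.bind (h1.bind (h2.bind (h4.bind h5)))).le ?_
  have k0 : 1 ≤ τ * N ^ 3 := Nat.mul_pos hτ (by positivity)
  have k1 : τ * N ≤ τ * N ^ 3 := Nat.mul_le_mul_left τ hN1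
  have k2 : τ * N ^ 2 ≤ τ * N ^ 3 := Nat.mul_le_mul_left τ hN2
  nlinarith

end Prog

/-- The number of basic operations of the algorithm. -/
theorem operation_count {nx nu τ : ℕ} (hnx : 0 < nx) (hτ : 0 < τ) (k : ℕ) :
    ∃ (n : ℕ) (S : Set (Input nx nu τ → ℝ)), Computation n S ∧
      n ≤ 200 * (k * (τ * (nx + nu) ^ 3)) ∧
      ∀ j ≤ k, ∀ (t : Fin τ) (i : Fin nu),
        (fun I : Input nx nu τ => I.P.iterate I.c I.u₀ j t i) ∈ S := by
  have h0 : Prog 0 (∅ : Set (Input nx nu τ → ℝ)) (commandCoords fun I => I.P.iterate I.c I.u₀ 0) :=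
    (Prog.iUnion (n := 0) fun t => (Prog.coords_of (n := 0) fun i =>
      Prog.initial (Or.inr (Or.inr (Or.inl ⟨t, i, rfl⟩)))).le (by simp)).le (by simp)
  have h1 := Prog.loop (k := k) (G := fun j => commandCoords fun I : Input nx nu τ =>
    I.P.iterate I.c I.u₀ j) h0 fun j _ => Prog.iteration hnx hτ Set.subset_union_right
  obtain ⟨S, n, hn, hS, -, hG⟩ := h1 _ 0 .start (Set.empty_subset _)
  refine ⟨n, S, hS, hn.trans (le_of_eq (by ring)), fun j hj t i => ?_⟩
  exact Prog.mem_command ((Set.subset_biUnion_of_mem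
    (u := fun j => commandCoords fun I : Input nx nu τ => I.P.iterate I.c I.u₀ j)
    (x := j) (by simpa using Nat.lt_succ_of_le hj)).trans hG) t i

end ILQR

end

theorem mainTheorem1 :
    -- The control in `τ` steps inherits explicit constants from the dynamics.
    (∀ (nx nu τ : ℕ) (P : ILQR.ControlProblem nx nu τ) (lx lu Lxx Lxu Luu σf : ℝ),
      0 < nx → 0 < τ → P.RegularDynamics → P.DynamicsConstants lx lu Lxx Lxu Luu →
      P.SurjectiveDynamics σf →
      P.TrajectoryConstants
        (lu * ∑ t ∈ Finset.range τ, lx ^ t)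
        ((∑ t ∈ Finset.range τ, lx ^ t) *
          (Lxx * (lu * ∑ t ∈ Finset.range τ, lx ^ t) ^ 2
            + 2 * Lxu * (lu * ∑ t ∈ Finset.range τ, lx ^ t) + Luu))
        (σf / (1 + lx))) ∧
    -- Sufficient decrease and iteration complexity.
    (∀ c : ILQR.Constants, ∃ C ε₀ : ℝ, 0 < ε₀ ∧
      ∀ (nx nu τ : ℕ) (P : ILQR.ControlProblem nx nu τ), 0 < nx → 0 < τ → P.Admissible c →
        (∀ u, P.IsLQRSolution (P.reg c u) u (P.lqr (P.reg c u) u) ∧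
          P.SufficientDecrease (P.reg c u) u) ∧
        ∀ u₀ : ILQR.Seq τ nu,
          -- The total number of iterations to reach the accuracy `ε`.
          (∀ ε : ℝ, 0 < ε → ε ≤ ε₀ → ∃ k : ℕ,
            (k : ℝ) ≤ max 0 (c.phaseBound (P.J u₀ - P.Jstar))
              + C * Real.log (Real.log (1 / ε)) ∧
            ∀ n, k ≤ n → P.J (P.iterate c u₀ n) - P.Jstar ≤ ε) ∧
          -- The gap `δ̄` is reached within the leading terms of the bound.
          (∀ n : ℕ, c.phaseBound (P.J u₀ - P.Jstar) ≤ n →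
            P.J (P.iterate c u₀ n) - P.Jstar ≤ c.gapBar) ∧
          -- Below the gap `δ̄` the convergence is quadratic.
          (∀ n : ℕ, P.J (P.iterate c u₀ n) - P.Jstar ≤ c.gapBar →
            P.newtonDecrement (P.g (P.iterate c u₀ n)) ≤ c.decrementBar ∧
            P.newtonDecrement (P.g (P.iterate c u₀ (n + 1)))
              ≤ c.decrementBar⁻¹ * P.newtonDecrement (P.g (P.iterate c u₀ n)) ^ 2)) ∧
    -- The number of basic operations of `k` iterations.
    (∃ K : ℝ, ∀ nx nu τ : ℕ, 0 < nx → 0 < τ → ∀ k : ℕ,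
      ∃ (n : ℕ) (S : Set (ILQR.Input nx nu τ → ℝ)), ILQR.Computation n S ∧
        (n : ℝ) ≤ K * (k * (τ * (nx + nu) ^ 3)) ∧
        ∀ j ≤ k, ∀ (t : Fin τ) (i : Fin nu),
          (fun I : ILQR.Input nx nu τ => I.P.iterate I.c I.u₀ j t i) ∈ S) := by
  refine ⟨fun nx nu τ P lx lu Lxx Lxu Luu σf hnx _ hP hc hσ =>
    ILQR.ControlProblem.trajectoryConstants hnx hP hc hσ,
    ILQR.ControlProblem.iteration_complexity, 200, fun nx nu τ hnx hτ k => ?_⟩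
  obtain ⟨n, S, hS, hn, h⟩ := ILQR.operation_count (nx := nx) (nu := nu) (τ := τ) hnx hτ k
  exact ⟨n, S, hS, by exact_mod_cast hn, h⟩
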